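/- Let $n\ge 0$ and let $X$ be a smooth ($C^\infty$, Hausdorff, second countable) $(n+1)$-dimensional manifold with boundary $\partial X$. A *product decomposition* $(x,y)$ of $X$ near $\partial X$ is a diffeomorphism $p\mapsto (y(p),x(p))$ from an open neighbourhood $U$ of $\partial X$ in $X$ onto a collar $\{(q,t)\in\partial X\times[0,\infty) : 0\le t<\varepsilon(q)\}$, with $\varepsilon:\partial X\to(0,\infty)$ continuous, such that $(y(q),x(q))=(q,0)$ for all $q\in\partial X$; thus $x$ is a defining function of $\partial X$. Let $g$ be a smooth Riemannian metric on the interior of $X$ such that, in some product decomposition $(x,y)$ near $\partial X$, $$ g=\frac{dx^2+h(x,y,dx,dy)}{x^2} \quad\text{for } x>0, $$ where $h$ is a symmetric 2-tensor on $U$, smooth up to $\partial X$, such that $h|_{x=0}$ is independent of $dx$ (at points of $\partial X$ it has neither $dx^2$ nor $dx\,dy$ terms) and $h|_{x=0}$ restricts to a Riemannian metric on $\partial X$. Then there are a product decomposition $(\bar x,\bar y)$ of $X$ near $\partial X$, on an open neighbourhood $\bar U$ of $\partial X$, and a symmetric 2-tensor $\bar h$ on $\bar U$, smooth up to $\partial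 X$ and restricting to a Riemannian metric on $\partial X$ at $\bar x=0$, such that for $\bar x>0$ $$ g=\frac{d\bar x^2+\bar h(\bar x,\bar y,d\bar y)}{\bar x^2} $$ exactly, where $\bar h$ is independent of $d\bar x$ on all of $\bar U$ (it has neither $d\bar x^2$ nor $d\bar x\,d\bar y$ terms). If $\partial X$ is compact (in particular if $X$ is compact), the collar of $(\bar x,\bar y)$ can be taken to be $\partial X\times[0,\varepsilon)$ with a constant $\varepsilon>0$. -/

import Mathlib

open Set Bundle
open scoped Manifold ContDiff

noncomputable section

/-- The boundary `∂X` of the `(n+1)`-dimensional manifold with boundary `X`, as a topological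
subspace of `X`. -/
abbrev BoundaryOf (n : ℕ) (X : Type*) [TopologicalSpace X]
    [ChartedSpace (EuclideanHalfSpace (n + 1)) X] : Type _ :=
  ↥((𝓡∂ (n + 1)).boundary X)

/-- A (not necessarily continuous) field of bilinear forms on the tangent spaces of `X`. -/
abbrev TwoTensorField (n : ℕ) (X : Type*) [TopologicalSpace X]
    [ChartedSpace (EuclideanHalfSpace (n + 1)) X] : Type _ :=
  (p : X) → TangentSpace (𝓡∂ (n + 1)) p →L[ℝ] TangentSpace (𝓡∂ (n + 1)) p →L[ℝ] ℝ

section Tensors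

variable {n : ℕ} {X : Type*} [TopologicalSpace X]
  [ChartedSpace (EuclideanHalfSpace (n + 1)) X] [IsManifold (𝓡∂ (n + 1)) ∞ X]

/-- `T` is a symmetric 2-tensor on `s`, smooth as a section of the bundle of bilinear forms
(at points of `s ∩ ∂X` this means smooth up to the boundary). -/
structure TwoTensorField.IsSmoothSymmOn (T : TwoTensorField n X) (s : Set X) : Prop where
  smooth : ContMDiffOn (𝓡∂ (n + 1))
    ((𝓡∂ (n + 1)).prod 𝓘(ℝ, EuclideanSpace ℝ (Fin (n + 1)) →L[ℝ]
      EuclideanSpace ℝ (Fin (n + 1)) →L[ℝ] ℝ)) ∞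
    (fun p ↦ TotalSpace.mk' (EuclideanSpace ℝ (Fin (n + 1)) →L[ℝ]
      EuclideanSpace ℝ (Fin (n + 1)) →L[ℝ] ℝ)
      (E := fun p : X ↦ TangentSpace (𝓡∂ (n + 1)) p →L[ℝ]
        TangentSpace (𝓡∂ (n + 1)) p →L[ℝ] ℝ) p (T p)) s
  symm : ∀ p ∈ s, ∀ v w : TangentSpace (𝓡∂ (n + 1)) p, T p v w = T p w v

/-- `g` is a smooth Riemannian metric on `s`. -/
structure TwoTensorField.IsRiemannianMetricOn (g : TwoTensorField n X) (s : Set X) : Prop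
    extends TwoTensorField.IsSmoothSymmOn g s where
  pos : ∀ p ∈ s, ∀ v : TangentSpace (𝓡∂ (n + 1)) p, v ≠ 0 → 0 < g p v v

end Tensors

/-- A product decomposition `(x, y)` of `X` near its boundary: a diffeomorphism `p ↦ (y p, x p)`
of an open neighbourhood `domain` of `∂X` in `X` onto the collar
`{(q, t) | 0 ≤ t < width q} ⊆ ∂X × [0, ∞)`, with inverse `param`, such that `param (q, 0) = q`
for all `q ∈ ∂X`. The function `width` is positive and continuous; if it is a constant `ε`, then
the collar is `∂X × [0, ε)`. The values of `x`, `y` outside `domain` and of `param` outside the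
collar are irrelevant. -/
structure ProductDecomposition (n : ℕ) (X : Type*) [TopologicalSpace X]
    [ChartedSpace (EuclideanHalfSpace (n + 1)) X]
    [ChartedSpace (EuclideanSpace ℝ (Fin n)) (BoundaryOf n X)] where
  domain : Set X
  isOpen_domain : IsOpen domain
  boundary_subset_domain : (𝓡∂ (n + 1)).boundary X ⊆ domain
  x : X → ℝ
  y : X → BoundaryOf n X
  width : BoundaryOf n X → ℝ
  width_pos : ∀ q, 0 < width q
  continuous_width : Continuous width
  param : BoundaryOf n X × ℝ → X
  mapsTo_coord : ∀ p ∈ domain, 0 ≤ x p ∧ x p < width (y p)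
  mapsTo_param : ∀ q t, 0 ≤ t → t < width q → param (q, t) ∈ domain
  param_coord : ∀ p ∈ domain, param (y p, x p) = p
  x_param : ∀ q t, 0 ≤ t → t < width q → x (param (q, t)) = t
  y_param : ∀ q t, 0 ≤ t → t < width q → y (param (q, t)) = q
  param_zero : ∀ q : BoundaryOf n X, param (q, 0) = (q : X)
  smooth_x : ContMDiffOn (𝓡∂ (n + 1)) 𝓘(ℝ, ℝ) ∞ x domain
  smooth_y : ContMDiffOn (𝓡∂ (n + 1)) (𝓡 n) ∞ y domain
  smooth_param : ContMDiffOn ((𝓡 n).prod 𝓘(ℝ, ℝ)) (𝓡∂ (n + 1)) ∞ param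
    {c : BoundaryOf n X × ℝ | 0 ≤ c.2 ∧ c.2 < width c.1}

namespace ProductDecomposition

variable {n : ℕ} {X : Type*} [TopologicalSpace X]
  [ChartedSpace (EuclideanHalfSpace (n + 1)) X]
  [ChartedSpace (EuclideanSpace ℝ (Fin n)) (BoundaryOf n X)]

/-- The differential `dx` at `p`. -/
def dx (P : ProductDecomposition n X) (p : X) : TangentSpace (𝓡∂ (n + 1)) p →L[ℝ] ℝ :=
  mfderiv (𝓡∂ (n + 1)) 𝓘(ℝ, ℝ) P.x p

/-- The differential `dy` at `p`. -/
def dy (P : ProductDecomposition n X) (p : X) :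
    TangentSpace (𝓡∂ (n + 1)) p →L[ℝ] TangentSpace (𝓡 n) (P.y p) :=
  mfderiv (𝓡∂ (n + 1)) (𝓡 n) P.y p

/-- `h` is independent of `dx` at the points of `s`: there `h = h(x, y, dy)`, i.e. `h` depends on
tangent vectors only through `dy`. In coordinates: `h` has neither `dx²` nor `dx dy` terms. -/
def IndependentOfDx (P : ProductDecomposition n X) (h : TwoTensorField n X) (s : Set X) : Prop :=
  ∀ p ∈ s, ∀ v v' w w' : TangentSpace (𝓡∂ (n + 1)) p,
    P.dy p v = P.dy p v' → P.dy p w = P.dy p w' → h p v w = h p v' w'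

/-- `g = (dx² + h(x, y, dx, dy)) / x²` in the product decomposition `(x, y)`, where `h` is a
symmetric 2-tensor, smooth up to the boundary, which induces a Riemannian metric on `∂X`. -/
structure HasForm [IsManifold (𝓡∂ (n + 1)) ∞ X] (P : ProductDecomposition n X)
    (g h : TwoTensorField n X) : Prop where
  smoothSymm : h.IsSmoothSymmOn P.domain
  pos_boundary : ∀ p ∈ (𝓡∂ (n + 1)).boundary X, ∀ v : TangentSpace (𝓡∂ (n + 1)) p,
    v ≠ 0 → P.dx p v = 0 → 0 < h p v v
  eq_div : ∀ p ∈ P.domain ∩ (𝓡∂ (n + 1)).interior X, ∀ v w : TangentSpace (𝓡∂ (n + 1)) p,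
    g p v w = (P.dx p v * P.dx p w + h p v w) / P.x p ^ 2

end ProductDecomposition

end

/-! Put `γ = dx² + h`, seek `x̄ = x exp w` with `w = 0` on `∂X`, and let `α = dx + x dw`. Then `x̄²
g = exp (2w) γ` and `dx̄ = exp w · α`, so the only candidate for the new tensor is `h̄ = exp (2w) (γ
- α²)`. It is independent of `dx̄` exactly when it is annihilated by the vectors tangent to the
curves `ȳ = const`. This holds if these curves have a tangent vector `T` with `γ (T, ·) = α(T) α`,
which means that `α` has `γ`-length one and that `ȳ` is constant along the gradient dual to `α`.
`IsNormalAt` (on a half-space) and `IsNormalPair` (on `X`) record this condition together with the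
boundary values.

The condition `|α| = 1` is an eikonal equation for `w`. Since `h` is independent of `dx` on the
boundary, `dx` has length one there. Hence the quadratic equation for `1 + t ∂w/∂t` has a root equal
to `1` at `t = 0`, and Hadamard's lemma permits division by `t`. The outcome is a Hamilton–Jacobi
equation `∂w/∂t = f (t, y, ∂w/∂y)` with `f` smooth up to `t = 0`
(`IsInverseMetricOn.exists_hamiltonian`).

It is solved by characteristics, without inverting a flow on a domain with boundary. For given `(y,
t)` the characteristic ending at `(y, t)` is sought directly, rescaled to the time interval `[0,
1]`: its position is prescribed at the end, its momentum and value at the start. This is a fixed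
point equation in a space of continuous paths, contractive for small `t` (`exists_contDiffOn_bvp`).
Composition operators are smooth (`contDiffOn_nemytskii`) and contractive fixed points depend
smoothly on parameters ranging over sets with boundary (`contDiffOn_of_fixedPoint`), so the solution
is smooth up to `t = 0`. The starting position of the characteristic is the new `ȳ`. The same fixed
point theorem inverts `(y, t) ↦ (ȳ, x̄)` locally.

Germs of solutions at a boundary point are unique, because differences satisfy a transport equation
transverse to the boundary (`IsBoundaryMetric.isNormalAt_unique`). Hence local solutions glue along
a locally finite cover without averaging. What remains is topology: `(Y, x exp w)` is injective near
the whole boundary (`exists_isOpen_injOn`), and its image contains a collar of continuous width. -/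

noncomputable section

open Filter Topology

set_option linter.unusedSectionVars false

universe u

/-! ### Smoothness of composition operators on spaces of continuous maps -/

section Nemytskii

variable {K : Type*} [TopologicalSpace K] [CompactSpace K]
  {E F : Type*} [NormedAddCommGroup E] [NormedSpace ℝ E] [NormedAddCommGroup F] [NormedSpace ℝ F]

/-- The continuous maps with values in `Q`. -/
def mapsInto (K : Type*) [TopologicalSpace K] {E : Type*} [TopologicalSpace E] (Q : Set E) :
    Set C(K, E) := {c | ∀ t, c t ∈ Q}

open Classical in
/-- The composition operator `c ↦ f ∘ c`, with value `0` if the composition is discontinuous. -/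
def nemytskii (K : Type*) [TopologicalSpace K] {E F : Type*} [TopologicalSpace E]
    [TopologicalSpace F] [Zero F] (f : E → F) (c : C(K, E)) : C(K, F) :=
  if h : Continuous (f ∘ c) then ⟨f ∘ c, h⟩ else 0

theorem nemytskii_apply {f : E → F} {Q : Set E} (hf : ContinuousOn f Q) {c : C(K, E)}
    (hc : c ∈ mapsInto K Q) (t : K) : nemytskii K f c t = f (c t) := by
  have h : Continuous (f ∘ c) := hf.comp_continuous c.continuous hc
  simp [nemytskii, h]

theorem convex_mapsInto {Q : Set E} (hQ : Convex ℝ Q) : Convex ℝ (mapsInto K Q) :=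
  fun _ hc _ hd _ _ ha hb hab t ↦ hQ (hc t) (hd t) ha hb hab

theorem interior_mapsInto_nonempty {Q : Set E} (hQ : (interior Q).Nonempty) :
    (interior (mapsInto K Q)).Nonempty := by
  obtain ⟨x, hx⟩ := hQ
  obtain ⟨ε, hε, h⟩ := Metric.isOpen_iff.1 isOpen_interior x hx
  refine ⟨ContinuousMap.const K x, mem_interior.2
    ⟨Metric.ball (ContinuousMap.const K x) ε, ?_, Metric.isOpen_ball, Metric.mem_ball_self hε⟩⟩
  intro c hc t
  exact interior_subset (h ((ContinuousMap.dist_apply_le_dist t).trans_lt hc))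

theorem uniqueDiffOn_mapsInto {Q : Set E} (hQ : Convex ℝ Q) (hQ' : (interior Q).Nonempty) :
    UniqueDiffOn ℝ (mapsInto K Q) :=
  uniqueDiffOn_convex (convex_mapsInto hQ) (interior_mapsInto_nonempty hQ')

/-- Compactness of `K` makes the modulus of continuity of `f` uniform along the image of `c`, even
though `Q` need not be compact and `y` ranges over all of `Q`. -/
theorem ContinuousOn.exists_uniform_of_mapsInto {f : E → F} {Q : Set E} (hf : ContinuousOn f Q)
    {c : C(K, E)} (hc : c ∈ mapsInto K Q) {ε : ℝ} (hε : 0 < ε) :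
    ∃ δ > 0, ∀ t, ∀ y ∈ Q, dist y (c t) < δ → dist (f y) (f (c t)) < ε := by
  suffices ∃ δ > 0, ∀ t ∈ (univ : Set K), ∀ y ∈ Q, dist y (c t) < δ → dist (f y) (f (c t)) < ε by
    simpa using this
  refine isCompact_univ.induction_on ⟨1, one_pos, by simp⟩
    (fun s t hst ⟨δ, h0, h⟩ ↦ ⟨δ, h0, fun x hx ↦ h x (hst hx)⟩) ?_ ?_
  · rintro s t ⟨δ, h0, h⟩ ⟨δ', h0', h'⟩
    refine ⟨min δ δ', lt_min h0 h0', ?_⟩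
    rintro x (hx | hx) y hy hd
    · exact h x hx y hy (hd.trans_le (min_le_left _ _))
    · exact h' x hx y hy (hd.trans_le (min_le_right _ _))
  · intro t _
    obtain ⟨δ, h0, h⟩ := Metric.continuousOn_iff.1 hf (c t) (hc t) (ε / 2) (by positivity)
    refine ⟨{s | dist (c s) (c t) < δ / 2}, ?_, δ / 2, by positivity, ?_⟩
    · rw [nhdsWithin_univ]
      exact (continuous_iff_continuousAt.1 (c.continuous.dist continuous_const) t).eventually_lt_const
        (by simpa using by positivity)
    · intro s hs y hy hd
      have h1 := h y hy (by have := dist_triangle y (c s) (c t); simp only [mem_ofPred_eq] at hs; linarith)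
      have h2 := h (c s) (hc s) (by simp only [mem_ofPred_eq] at hs; linarith)
      have := dist_triangle_right (f y) (f (c s)) (f (c t))
      linarith

theorem continuousOn_nemytskii {f : E → F} {Q : Set E} (hf : ContinuousOn f Q) :
    ContinuousOn (nemytskii K f) (mapsInto K Q) := by
  rw [Metric.continuousOn_iff]
  intro c hc ε hε
  obtain ⟨δ, h0, h⟩ := hf.exists_uniform_of_mapsInto hc (half_pos hε)
  refine ⟨δ, h0, fun d hd hdc ↦ ?_⟩
  refine ((ContinuousMap.dist_le (half_pos hε).le).2 fun t ↦ ?_).trans_lt (half_lt_self hε)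
  rw [nemytskii_apply hf hc, nemytskii_apply hf hd]
  exact (h t _ (hd t) ((ContinuousMap.dist_apply_le_dist t).trans_lt hdc)).le

/-- Pointwise application of a continuous bilinear map. -/
def pointwiseBilin (K : Type*) [TopologicalSpace K] [CompactSpace K] {E F G : Type*}
    [NormedAddCommGroup E] [NormedSpace ℝ E] [NormedAddCommGroup F] [NormedSpace ℝ F]
    [NormedAddCommGroup G] [NormedSpace ℝ G] (L : G →L[ℝ] E →L[ℝ] F) :
    C(K, G) →L[ℝ] C(K, E) →L[ℝ] C(K, F) :=
  LinearMap.mkContinuous₂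
    (LinearMap.mk₂ ℝ
      (fun (A : C(K, G)) (c : C(K, E)) ↦
        (⟨fun t ↦ L (A t) (c t), (L.continuous.comp A.continuous).clm_apply c.continuous⟩ : C(K, F)))
      (fun A B c ↦ by ext t; simp) (fun r A c ↦ by ext t; simp) (fun A c d ↦ by ext t; simp)
      (fun r A c ↦ by ext t; simp)) ‖L‖ (fun A c ↦ by
        refine (ContinuousMap.norm_le _ (by positivity)).2 fun t ↦ ?_
        exact (L.le_opNorm₂ _ _).trans (by gcongr; exacts [A.norm_coe_le_norm t, c.norm_coe_le_norm t]))

@[simp] theorem pointwiseBilin_apply {G : Type*} [NormedAddCommGroup G] [NormedSpace ℝ G]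
    (L : G →L[ℝ] E →L[ℝ] F) (A : C(K, G)) (c : C(K, E)) (t : K) :
    pointwiseBilin K L A c t = L (A t) (c t) := rfl

-- The mean value inequality is applied for each `t` on the convex set `Q ∩ ball (c t) δ`, where
-- `f'` stays within `ε` of `f' (c t)`. As `δ` does not depend on `t`, the remainder is `ε ‖d - c‖`
-- in the supremum norm.
set_option synthInstance.maxHeartbeats 400000 in
theorem hasFDerivWithinAt_nemytskii {f : E → F} {f' : E → E →L[ℝ] F} {Q : Set E}
    (hQ : Convex ℝ Q) (hf : ∀ x ∈ Q, HasFDerivWithinAt f (f' x) Q x) (hf' : ContinuousOn f' Q)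
    {c : C(K, E)} (hc : c ∈ mapsInto K Q) :
    HasFDerivWithinAt (nemytskii K f) (pointwiseBilin K
      (ContinuousLinearMap.id ℝ (E →L[ℝ] F)) (nemytskii K f' c)) (mapsInto K Q) c := by
  have hfc : ContinuousOn f Q := fun x hx ↦ (hf x hx).continuousWithinAt
  rw [hasFDerivWithinAt_iff_isLittleO, Asymptotics.isLittleO_iff]
  intro ε hε
  obtain ⟨δ, h0, h⟩ := hf'.exists_uniform_of_mapsInto hc hε
  filter_upwards [self_mem_nhdsWithin, mem_nhdsWithin_of_mem_nhds (Metric.ball_mem_nhds c h0)]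
    with d hd hdc
  refine (ContinuousMap.norm_le _ (by positivity)).2 fun t ↦ ?_
  simp only [ContinuousMap.sub_apply, pointwiseBilin_apply, ContinuousLinearMap.id_apply, nemytskii_apply hfc hc,
    nemytskii_apply hfc hd, nemytskii_apply hf' hc]
  have hdt : d t ∈ Metric.ball (c t) δ := (ContinuousMap.dist_apply_le_dist t).trans_lt hdc
  refine (Convex.norm_image_sub_le_of_norm_hasFDerivWithin_le' (s := Q ∩ Metric.ball (c t) δ)
    (f' := f') (C := ε) (fun x hx ↦ (hf x hx.1).mono inter_subset_left) (fun x hx ↦ ?_)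
    (hQ.inter (convex_ball _ _)) ⟨hc t, Metric.mem_ball_self h0⟩ ⟨hd t, hdt⟩).trans ?_
  · rw [← dist_eq_norm]; exact (h t x hx.1 hx.2).le
  · gcongr
    exact (d - c).norm_coe_le_norm t

-- Induction on the order: the derivative of the composition operator of `f` is the composition
-- operator of the derivative of `f`, followed by a continuous linear map. The target changes from
-- `F` to `E →L[ℝ] F` in the induction, so both spaces share one universe.
set_option synthInstance.maxHeartbeats 400000 in
theorem contDiffOn_nemytskii {E F : Type u} [NormedAddCommGroup E] [NormedSpace ℝ E]
    [NormedAddCommGroup F] [NormedSpace ℝ F] {f : E → F} {Q : Set E} (hQ : Convex ℝ Q)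
    (hQ' : (interior Q).Nonempty) (hf : ContDiffOn ℝ ∞ f Q) :
    ContDiffOn ℝ ∞ (nemytskii K f) (mapsInto K Q) := by
  refine contDiffOn_infty.2 fun n ↦ ?_
  have hu := uniqueDiffOn_convex hQ hQ'
  induction n generalizing F with
  | zero => exact contDiffOn_zero.2 (continuousOn_nemytskii hf.continuousOn)
  | succ n ih =>
    obtain ⟨hd, hf'⟩ := (contDiffOn_infty_iff_fderivWithin hu).1 hf
    rw [Nat.cast_add_one, contDiffOn_succ_iff_hasFDerivWithinAt_of_uniqueDiffOn
      (uniqueDiffOn_mapsInto hQ hQ')]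
    exact ⟨by simp, fun c ↦ pointwiseBilin K (ContinuousLinearMap.id ℝ (E →L[ℝ] F)) (nemytskii K (fderivWithin ℝ f Q) c),
      (pointwiseBilin K (ContinuousLinearMap.id ℝ (E →L[ℝ] F))).contDiff.comp_contDiffOn (ih hf'), fun c hc ↦
      hasFDerivWithinAt_nemytskii hQ (fun x hx ↦ (hd x hx).hasFDerivWithinAt) hf'.continuousOn hc⟩

end Nemytskii

/-! ### Contractive fixed point equations with parameters, on sets with boundary -/

section FixedPoint

variable {P B : Type u} [NormedAddCommGroup P] [NormedSpace ℝ P] [NormedAddCommGroup B]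
  [NormedSpace ℝ B] [CompleteSpace B]

open ContinuousLinearMap in
omit [CompleteSpace B] in
theorem norm_sub_le_of_norm_fderivWithin_comp_inr_le {Φ : P × B → B} {S : Set P} {D : Set B}
    {C : ℝ} (hD : Convex ℝ D) (hd : DifferentiableOn ℝ Φ (S ×ˢ D))
    (hb : ∀ z ∈ S ×ˢ D, ‖(fderivWithin ℝ Φ (S ×ˢ D) z).comp (inr ℝ P B)‖ ≤ C)
    {s : P} (hs : s ∈ S) {v w : B} (hv : v ∈ D) (hw : w ∈ D) :
    ‖Φ (s, w) - Φ (s, v)‖ ≤ C * ‖w - v‖ := by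
  refine Convex.norm_image_sub_le_of_norm_hasFDerivWithin_le (f := fun v ↦ Φ (s, v))
    (f' := fun v ↦ (fderivWithin ℝ Φ (S ×ˢ D) (s, v)).comp (inr ℝ P B)) (fun x hx ↦ ?_)
    (fun x hx ↦ hb (s, x) ⟨hs, hx⟩) hD hv hw
  exact (hd (s, x) ⟨hs, hx⟩).hasFDerivWithinAt.comp x
    (hasFDerivAt_prodMk_right s x).hasFDerivWithinAt (fun y hy ↦ ⟨hs, hy⟩)

open ContinuousLinearMap in
/-- A solution of a contractive fixed point equation depends smoothly on the parameter, also at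
boundary points of the domains. -/
theorem contDiffOn_of_fixedPoint {Φ : P × B → B} {S : Set P} {D : Set B} {u : P → B}
    (hS : UniqueDiffOn ℝ S) (hD : Convex ℝ D) (hΦ : ContDiffOn ℝ ∞ Φ (S ×ˢ D))
    (hSD : UniqueDiffOn ℝ (S ×ˢ D))
    (hb : ∀ z ∈ S ×ˢ D, ‖(fderivWithin ℝ Φ (S ×ˢ D) z).comp (inr ℝ P B)‖ ≤ 1 / 2)
    (hu : ∀ s ∈ S, u s ∈ D) (hfix : ∀ s ∈ S, Φ (s, u s) = u s) :
    ContDiffOn ℝ ∞ u S := by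
  obtain ⟨hd, hΦ'⟩ := (contDiffOn_infty_iff_fderivWithin hSD).1 hΦ
  have hlip : ∀ s ∈ S, ∀ v ∈ D, ∀ w ∈ D, ‖Φ (s, w) - Φ (s, v)‖ ≤ 1 / 2 * ‖w - v‖ :=
    fun s hs v hv w hw ↦ norm_sub_le_of_norm_fderivWithin_comp_inr_le hD hd hb hs hv hw
  -- The change of `Φ` caused by its second argument is at most half of `‖u s' - u s‖` and is
  -- absorbed on the left, whence the factor `2`.
  have hdiff : ∀ s ∈ S, ∀ s' ∈ S, ‖u s' - u s‖ ≤ 2 * ‖Φ (s', u s) - Φ (s, u s)‖ := by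
    intro s hs s' hs'
    have h1 := hlip s' hs' (u s) (hu s hs) (u s') (hu s' hs')
    rw [hfix s' hs'] at h1
    have h2 : u s' - u s = (u s' - Φ (s', u s)) + (Φ (s', u s) - Φ (s, u s)) := by
      rw [hfix s hs]; abel
    have h3 := norm_add_le (u s' - Φ (s', u s)) (Φ (s', u s) - Φ (s, u s))
    rw [← h2] at h3
    linarith
  have hpar : ∀ s ∈ S, HasFDerivWithinAt (fun s' ↦ Φ (s', u s))
      ((fderivWithin ℝ Φ (S ×ˢ D) (s, u s)).comp (inl ℝ P B)) S s := by
    intro s hs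
    refine (hd (s, u s) ⟨hs, hu s hs⟩).hasFDerivWithinAt.comp (t := S ×ˢ D) s
      (hasFDerivAt_prodMk_left s (u s)).hasFDerivWithinAt ?_
    exact fun y hy ↦ ⟨hy, hu s hs⟩
  have hO : ∀ s ∈ S, (fun s' ↦ u s' - u s) =O[𝓝[S] s] fun s' ↦ s' - s := by
    intro s hs
    refine Asymptotics.IsBigO.trans ?_ (hpar s hs).isBigO_sub
    refine Asymptotics.IsBigO.of_bound 2 ?_
    filter_upwards [self_mem_nhdsWithin] with s' hs' using hdiff s hs s' hs'
  have hcont : ContinuousOn u S := by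
    intro s hs
    have h1 : Tendsto (fun s' ↦ s' - s) (𝓝[S] s) (𝓝 0) := by
      have : Tendsto (fun s' ↦ s' - s) (𝓝 s) (𝓝 (s - s)) := (continuous_id.sub continuous_const).tendsto s
      rw [sub_self] at this
      exact this.mono_left nhdsWithin_le_nhds
    have := ((hO s hs).trans_tendsto h1).add_const (u s)
    simpa [ContinuousWithinAt] using this
  set A : P → B →L[ℝ] B := fun s ↦ (fderivWithin ℝ Φ (S ×ˢ D) (s, u s)).comp (inr ℝ P B)
  have hA : ∀ s ∈ S, ‖A s‖ < 1 := fun s hs ↦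
    (hb (s, u s) ⟨hs, hu s hs⟩).trans_lt (by norm_num)
  have hinv : ∀ s ∈ S, ∃ e : (B →L[ℝ] B)ˣ, (e : B →L[ℝ] B) = 1 - A s := fun s hs ↦
    ⟨Units.oneSub (A s) (hA s hs), rfl⟩
  -- Differentiating `Φ (s, u s) = u s` formally gives `(1 - A) u' = ∂Φ/∂s`, where `1 - A` is
  -- invertible by the Neumann series.
  have hderiv : ∀ s ∈ S, HasFDerivWithinAt u ((Ring.inverse (1 - A s)).comp
      ((fderivWithin ℝ Φ (S ×ˢ D) (s, u s)).comp (inl ℝ P B))) S s := by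
    intro s hs
    obtain ⟨e, he⟩ := hinv s hs
    have hgraph : Tendsto (fun s' ↦ (s', u s')) (𝓝[S] s) (𝓝[S ×ˢ D] (s, u s)) := by
      refine tendsto_nhdsWithin_iff.2 ⟨?_, ?_⟩
      · exact (continuousWithinAt_id.prodMk (hcont s hs))
      · filter_upwards [self_mem_nhdsWithin] with s' hs' using ⟨hs', hu s' hs'⟩
    have h1 := ((hd (s, u s) ⟨hs, hu s hs⟩).hasFDerivWithinAt).isLittleO.comp_tendsto hgraph
    have h2 : (fun s' ↦ (s', u s') - (s, u s)) =O[𝓝[S] s] fun s' ↦ s' - s := by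
      simpa using (Asymptotics.isBigO_refl (fun s' ↦ s' - s) (𝓝[S] s)).prod_left (hO s hs)
    have h3 := h1.trans_isBigO h2
    have h4 := ((Ring.inverse (1 - A s)).isBigO_comp
      ((Φ ∘ fun s' ↦ (s', u s')) - fun s' ↦ Φ (s, u s) +
        (fderivWithin ℝ Φ (S ×ˢ D) (s, u s)) ((s', u s') - (s, u s))) (𝓝[S] s))
    rw [hasFDerivWithinAt_iff_isLittleO]
    have h5 : (fun s' ↦ Ring.inverse (1 - A s) (((Φ ∘ fun s' ↦ (s', u s')) - fun s' ↦ Φ (s, u s) +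
        (fderivWithin ℝ Φ (S ×ˢ D) (s, u s)) ((s', u s') - (s, u s))) s')) =o[𝓝[S] s]
        fun s' ↦ s' - s := by
      refine Asymptotics.IsBigO.trans_isLittleO h4 (Asymptotics.IsLittleO.congr_left h3 ?_)
      intro s'
      simp only [Function.comp_apply, Pi.sub_apply]
      abel
    refine h5.congr' ?_ EventuallyEq.rfl
    filter_upwards [self_mem_nhdsWithin] with s' hs'
    have key : ∀ x, Ring.inverse (1 - A s) ((1 - A s) x) = x := by
      intro x
      rw [← he, Ring.inverse_unit, ← mul_apply_eq_comp, Units.inv_mul]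
      rfl
    have h6 : (fderivWithin ℝ Φ (S ×ˢ D) (s, u s)) ((s', u s') - (s, u s)) =
        (fderivWithin ℝ Φ (S ×ˢ D) (s, u s)).comp (inl ℝ P B) (s' - s) + A s (u s' - u s) := by
      simp only [A, ContinuousLinearMap.comp_apply, ← map_add]
      simp
    have h7 : ((Φ ∘ fun s' ↦ (s', u s')) - fun s' ↦ Φ (s, u s) +
        (fderivWithin ℝ Φ (S ×ˢ D) (s, u s)) ((s', u s') - (s, u s))) s' =
        (1 - A s) (u s' - u s) -
          (fderivWithin ℝ Φ (S ×ˢ D) (s, u s)).comp (inl ℝ P B) (s' - s) := by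
      simp only [Pi.sub_apply, Function.comp_apply, hfix s' hs', hfix s hs, h6,
        sub_apply, one_apply_eq_self]
      abel
    rw [h7, map_sub, key]
    rfl
  -- Bootstrap: the formula for `u'` contains only `u` and smooth maps, so `u` of class `Cⁿ` has a
  -- derivative of class `Cⁿ`.
  refine contDiffOn_infty.2 fun n ↦ ?_
  induction n with
  | zero => exact contDiffOn_zero.2 hcont
  | succ n ih =>
    rw [Nat.cast_add_one, contDiffOn_succ_iff_hasFDerivWithinAt_of_uniqueDiffOn hS]
    refine ⟨by simp, _, ?_, hderiv⟩
    have h1 : ContDiffOn ℝ n (fun s ↦ fderivWithin ℝ Φ (S ×ˢ D) (s, u s)) S :=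
      (hΦ'.of_le (by exact_mod_cast le_top)).comp (contDiffOn_id.prodMk ih) fun s hs ↦ ⟨hs, hu s hs⟩
    have h2 : ContDiffOn ℝ n (fun s ↦ Ring.inverse (1 - A s)) S := by
      intro s hs
      obtain ⟨e, he⟩ := hinv s hs
      have h3 := contDiffAt_ringInverse ℝ (n := n) e
      rw [he] at h3
      exact h3.comp_contDiffWithinAt s
        ((contDiffOn_const.sub (h1.clm_comp contDiffOn_const)) s hs)
    exact h2.clm_comp (h1.clm_comp contDiffOn_const)

open ContinuousLinearMap in
/-- Local solvability of `Φ (s, u) = u` near a solution at which the partial derivative of `Φ` in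
`u` vanishes; `S` and `D` may have a boundary. -/
theorem exists_contDiffOn_fixedPoint {Φ : P × B → B} {S : Set P} {D : Set B} (hS : UniqueDiffOn ℝ S)
    (hD : UniqueDiffOn ℝ D) (hDc : Convex ℝ D) (hDcl : IsClosed D) {s₀ : P} (hs₀ : s₀ ∈ S) {u₀ : B}
    (hu₀ : u₀ ∈ D) {ρ : ℝ} (hρ : 0 < ρ)
    (hΦ : ContDiffOn ℝ ∞ Φ (S ×ˢ (D ∩ Metric.ball u₀ ρ)))
    (hmaps : ∀ s ∈ S, ∀ v ∈ D ∩ Metric.ball u₀ ρ, Φ (s, v) ∈ D) (h0 : Φ (s₀, u₀) = u₀)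
    (hd : (fderivWithin ℝ Φ (S ×ˢ (D ∩ Metric.ball u₀ ρ)) (s₀, u₀)).comp (inr ℝ P B) = 0) :
    ∃ r > 0, ∃ r₁ > 0, ∃ u : P → B, r₁ ≤ ρ ∧ ContDiffOn ℝ ∞ u (S ∩ Metric.ball s₀ r) ∧
      u s₀ = u₀ ∧ ∀ s ∈ S ∩ Metric.ball s₀ r, u s ∈ D ∩ Metric.ball u₀ r₁ ∧ Φ (s, u s) = u s ∧
        (∀ v ∈ D ∩ Metric.ball u₀ r₁, Φ (s, v) = v → v = u s) ∧
        ∀ v ∈ D ∩ Metric.ball u₀ r₁,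
          ‖(fderivWithin ℝ Φ (S ×ˢ (D ∩ Metric.ball u₀ ρ)) (s, v)).comp (inr ℝ P B)‖ ≤ 1 / 2 := by
  set Q := S ×ˢ (D ∩ Metric.ball u₀ ρ) with hQ
  have hQu : UniqueDiffOn ℝ Q := hS.prod (hD.inter Metric.isOpen_ball)
  have hz₀ : (s₀, u₀) ∈ Q := ⟨hs₀, hu₀, Metric.mem_ball_self hρ⟩
  have hc : ContinuousOn (fun z ↦ ‖(fderivWithin ℝ Φ Q z).comp (inr ℝ P B)‖) Q :=
    ((hΦ.continuousOn_fderivWithin hQu (by simp)).clm_comp continuousOn_const).norm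
  -- The partial derivative vanishes at the base point, so by continuity it is a contraction nearby.
  have hev : ∀ᶠ z in 𝓝[Q] (s₀, u₀), ‖(fderivWithin ℝ Φ Q z).comp (inr ℝ P B)‖ < 1 / 2 :=
    (hc _ hz₀).eventually_lt_const (by simp [hd])
  obtain ⟨η, hη, hball⟩ := Metric.mem_nhdsWithin_iff.1 hev
  set r₁ := min η ρ
  have hr₁ : 0 < r₁ := lt_min hη hρ
  have hev' : ∀ᶠ s in 𝓝[S] s₀, ‖Φ (s, u₀) - u₀‖ < r₁ / 8 := by
    have h1 : ContinuousWithinAt (fun s ↦ Φ (s, u₀)) S s₀ :=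
      ContinuousWithinAt.comp (f := fun s ↦ (s, u₀)) (hΦ.continuousOn _ hz₀)
        (continuousWithinAt_id.prodMk continuousWithinAt_const) fun s hs ↦ ⟨hs, hz₀.2⟩
    have h2 := (h1.sub (continuousWithinAt_const (b := u₀))).norm
    exact h2.eventually_lt_const (by simpa [h0] using by positivity)
  obtain ⟨η', hη', hball'⟩ := Metric.mem_nhdsWithin_iff.1 hev'
  set r := min η' η
  have hr : 0 < r := lt_min hη' hη
  set S' := S ∩ Metric.ball s₀ r
  set D' := D ∩ Metric.ball u₀ r₁
  have hS'u : UniqueDiffOn ℝ S' := hS.inter Metric.isOpen_ball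
  have hD'u : UniqueDiffOn ℝ D' := hD.inter Metric.isOpen_ball
  have hD'c : Convex ℝ D' := hDc.inter (convex_ball _ _)
  have hsub : S' ×ˢ D' = Q ∩ (Metric.ball s₀ r ×ˢ Metric.ball u₀ r₁) := by
    ext ⟨s, v⟩
    simp only [S', D', Q, mem_prod, mem_inter_iff]
    constructor
    · rintro ⟨⟨h1, h2⟩, h3, h4⟩
      exact ⟨⟨h1, h3, Metric.ball_subset_ball (min_le_right _ _) h4⟩, h2, h4⟩
    · rintro ⟨⟨h1, h3, -⟩, h2, h4⟩
      exact ⟨⟨h1, h2⟩, h3, h4⟩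
  have hfd : ∀ z ∈ S' ×ˢ D', fderivWithin ℝ Φ (S' ×ˢ D') z = fderivWithin ℝ Φ Q z := by
    intro z hz
    rw [hsub] at hz ⊢
    exact fderivWithin_inter ((Metric.isOpen_ball.prod Metric.isOpen_ball).mem_nhds hz.2)
  have hb : ∀ z ∈ S' ×ˢ D', ‖(fderivWithin ℝ Φ Q z).comp (inr ℝ P B)‖ ≤ 1 / 2 := by
    intro z hz
    rw [hsub] at hz
    refine le_of_lt (hball ⟨?_, hz.1⟩)
    rw [← ball_prod_same]
    exact ⟨Metric.ball_subset_ball (min_le_right _ _) hz.2.1,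
      Metric.ball_subset_ball (min_le_left _ _) hz.2.2⟩
  have hΦ' : ContDiffOn ℝ ∞ Φ (S' ×ˢ D') := hΦ.mono (by rw [hsub]; exact inter_subset_left)
  have hb' : ∀ z ∈ S' ×ˢ D', ‖(fderivWithin ℝ Φ (S' ×ˢ D') z).comp (inr ℝ P B)‖ ≤ 1 / 2 :=
    fun z hz ↦ by rw [hfd z hz]; exact hb z hz
  have hlip : ∀ s ∈ S', ∀ v ∈ D', ∀ w ∈ D', ‖Φ (s, w) - Φ (s, v)‖ ≤ 1 / 2 * ‖w - v‖ :=
    fun s hs v hv w hw ↦ norm_sub_le_of_norm_fderivWithin_comp_inr_le hD'c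
      (hΦ'.differentiableOn (by simp)) hb' hs hv hw
  have hu₀' : u₀ ∈ D' := ⟨hu₀, Metric.mem_ball_self hr₁⟩
  have hex : ∀ s ∈ S', ∃ v ∈ D', Φ (s, v) = v := by
    intro s hs
    -- A complete set is needed for Banach's theorem. This one is mapped into itself because `(1/2)
    -- (r₁/2) + r₁/8 ≤ r₁/2`. Uniqueness is proved separately in the larger open ball.
    set C := D ∩ Metric.closedBall u₀ (r₁ / 2)
    have hCD : C ⊆ D' := fun v hv ↦ ⟨hv.1, (Metric.mem_closedBall.1 hv.2).trans_lt (by linarith)⟩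
    have hCmaps : MapsTo (fun v ↦ Φ (s, v)) C C := by
      intro v hv
      have hvD := hCD hv
      refine ⟨hmaps s hs.1 v ⟨hvD.1, Metric.ball_subset_ball (min_le_right _ _) hvD.2⟩, ?_⟩
      rw [Metric.mem_closedBall, dist_eq_norm]
      have h1 := hlip s hs u₀ hu₀' v hvD
      have h2 : ‖Φ (s, u₀) - u₀‖ < r₁ / 8 :=
        hball' ⟨Metric.ball_subset_ball (min_le_left _ _) hs.2, hs.1⟩
      have h3 := norm_sub_le_norm_sub_add_norm_sub (Φ (s, v)) (Φ (s, u₀)) u₀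
      have h4 := Metric.mem_closedBall.1 hv.2
      rw [dist_eq_norm] at h4
      linarith
    have hcontr : ContractingWith (1 / 2) (hCmaps.restrict (fun v ↦ Φ (s, v)) C C) := by
      refine ⟨by rw [← NNReal.coe_lt_coe]; norm_num, LipschitzWith.of_dist_le_mul fun v w ↦ ?_⟩
      have := hlip s hs w (hCD w.2) v (hCD v.2)
      simpa [dist_eq_norm, Subtype.dist_eq] using this
    obtain ⟨v, hv, hfix, -⟩ := hcontr.exists_fixedPoint'
      ((hDcl.inter Metric.isClosed_closedBall).isComplete) hCmaps
      (x := u₀) ⟨hu₀, Metric.mem_closedBall_self (by positivity)⟩ (edist_ne_top _ _)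
    exact ⟨v, hCD hv, hfix⟩
  have huniq : ∀ s ∈ S', ∀ v ∈ D', ∀ w ∈ D', Φ (s, v) = v → Φ (s, w) = w → v = w := by
    intro s hs v hv w hw h1 h2
    have h3 := hlip s hs w hw v hv
    rw [h1, h2] at h3
    have h4 := norm_nonneg (v - w)
    exact sub_eq_zero.1 (norm_eq_zero.1 (by linarith))
  choose! u hu hfix using hex
  refine ⟨r, hr, r₁, hr₁, u, min_le_right _ _,
    contDiffOn_of_fixedPoint hS'u hD'c hΦ' (hS'u.prod hD'u) hb' hu hfix, ?_, fun s hs ↦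
    ⟨hu s hs, hfix s hs, fun v hv h ↦ huniq s hs v hv _ (hu s hs) h (hfix s hs),
      fun v hv ↦ hb (s, v) ⟨hs, hv⟩⟩⟩
  have hs₀' : s₀ ∈ S' := ⟨hs₀, Metric.mem_ball_self hr⟩
  exact huniq s₀ hs₀' _ (hu s₀ hs₀') _ hu₀' (hfix s₀ hs₀') h0

end FixedPoint

/-! ### Integration over the unit interval and Hadamard's lemma -/

section UnitInterval

variable {E F : Type u} [NormedAddCommGroup E] [NormedSpace ℝ E] [NormedAddCommGroup F]
  [NormedSpace ℝ F] [CompleteSpace F]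

open MeasureTheory

/-- Integration of continuous functions from `0` to `σ`. -/
def primitiveAt (F : Type*) [NormedAddCommGroup F] [NormedSpace ℝ F] (σ : ℝ) :
    C(unitInterval, F) →ₗ[ℝ] F where
  toFun c := ∫ τ in (0 : ℝ)..σ, c (projIcc 0 1 zero_le_one τ)
  map_add' c d := by
    have h : ∀ c : C(unitInterval, F), Continuous fun τ : ℝ ↦ c (projIcc 0 1 zero_le_one τ) :=
      fun c ↦ c.continuous.comp continuous_projIcc
    simp only [ContinuousMap.add_apply]
    exact intervalIntegral.integral_add ((h c).intervalIntegrable _ _) ((h d).intervalIntegrable _ _)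
  map_smul' r c := by simp [intervalIntegral.integral_smul]

theorem hasDerivAt_primitiveAt (c : C(unitInterval, F)) (σ : ℝ) :
    HasDerivAt (fun σ ↦ primitiveAt F σ c) (c (projIcc 0 1 zero_le_one σ)) σ :=
  ((c.continuous.comp (continuous_projIcc (h := zero_le_one))).integral_hasStrictDerivAt 0 σ).hasDerivAt

/-- The primitive vanishing at `0`. -/
def primitive (F : Type*) [NormedAddCommGroup F] [NormedSpace ℝ F] [CompleteSpace F] :
    C(unitInterval, F) →L[ℝ] C(unitInterval, F) :=
  LinearMap.mkContinuous
    { toFun := fun c ↦ ⟨fun σ ↦ primitiveAt F σ c, by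
        have h : Continuous fun σ ↦ primitiveAt F σ c :=
          continuous_iff_continuousAt.2 fun σ ↦ (hasDerivAt_primitiveAt c σ).continuousAt
        exact h.comp continuous_subtype_val⟩
      map_add' := fun c d ↦ by ext σ; simp
      map_smul' := fun r c ↦ by ext σ; simp } 1 (fun c ↦ by
        refine (ContinuousMap.norm_le _ (by positivity)).2 fun σ ↦ ?_
        refine (intervalIntegral.norm_integral_le_of_norm_le_const (C := ‖c‖)
          fun τ _ ↦ c.norm_coe_le_norm _).trans ?_
        rw [sub_zero, abs_of_nonneg σ.2.1]
        nlinarith [σ.2.2, norm_nonneg c])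

theorem primitive_apply (c : C(unitInterval, F)) (σ : unitInterval) :
    primitive F c σ = primitiveAt F σ c := rfl

/-- The difference of `C` and the primitive has right derivative zero. Only derivatives within `[0,
1]` are assumed, because the curves used later are not differentiable beyond the endpoints. -/
theorem primitive_eq_sub {C : ℝ → F} (g : C(unitInterval, F))
    (h : ∀ σ : unitInterval, HasDerivWithinAt C (g σ) (Icc 0 1) σ) (σ : unitInterval) :
    primitive F g σ = C σ - C 0 := by
  have h1 : ContinuousOn (fun s ↦ C s - primitiveAt F s g) (Icc 0 1) := fun s hs ↦
    ((h ⟨s, hs⟩).continuousWithinAt).sub (hasDerivAt_primitiveAt g s).continuousAt.continuousWithinAt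
  have h2 := constant_of_has_deriv_right_zero h1 (fun s hs ↦ ?_) σ σ.2
  · have h3 : primitiveAt F 0 g = 0 := intervalIntegral.integral_same
    rw [h3, sub_zero] at h2
    rw [primitive_apply, ← h2]
    abel
  · have h3 := (h ⟨s, hs.1, hs.2.le⟩).sub (hasDerivAt_primitiveAt g s).hasDerivWithinAt
    rw [projIcc_of_mem zero_le_one ⟨hs.1, hs.2.le⟩, sub_self] at h3
    exact (h3.mono_of_mem_nhdsWithin (Icc_mem_nhdsGE_of_mem hs))

/-- Constant paths. -/
def constPath (E : Type*) [NormedAddCommGroup E] [NormedSpace ℝ E] : E →L[ℝ] C(unitInterval, E) :=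
  LinearMap.mkContinuous
    { toFun := fun v ↦ ContinuousMap.const _ v
      map_add' := fun _ _ ↦ rfl
      map_smul' := fun _ _ ↦ rfl } 1 fun v ↦
        (ContinuousMap.norm_le _ (by positivity)).2 fun τ ↦ (one_mul ‖v‖).ge

@[simp] theorem constPath_apply (v : E) (τ : unitInterval) : constPath E v τ = v := rfl

/-- The paths `τ ↦ τ • v`. -/
def rayPath (E : Type*) [NormedAddCommGroup E] [NormedSpace ℝ E] : E →L[ℝ] C(unitInterval, E) :=
  LinearMap.mkContinuous
    { toFun := fun v ↦ ⟨fun τ ↦ (τ : ℝ) • v, by fun_prop⟩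
      map_add' := fun v w ↦ by ext τ; simp
      map_smul' := fun r v ↦ by ext τ; exact smul_comm _ _ _ } 1 fun v ↦
        (ContinuousMap.norm_le _ (by positivity)).2 fun τ ↦ by
          simp only [LinearMap.coe_mk, AddHom.coe_mk, ContinuousMap.coe_mk, norm_smul, one_mul]
          rw [Real.norm_of_nonneg τ.2.1]
          exact mul_le_of_le_one_left (norm_nonneg v) τ.2.2

@[simp] theorem rayPath_apply (v : E) (τ : unitInterval) : rayPath E v τ = (τ : ℝ) • v := rfl

/-- **Hadamard's lemma**: on a convex set containing with `z` the segment from `p z` to `z`, a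
smooth function vanishing at the points `p z` is divisible. -/
theorem contDiffOn_hadamard {f : E → F} {Q : Set E} (hQ : Convex ℝ Q) (hQ' : (interior Q).Nonempty)
    (hf : ContDiffOn ℝ ∞ f Q) (L : E →L[ℝ] E) (hL : ∀ z ∈ Q, L z ∈ Q) (v : E)  (l : E →L[ℝ] ℝ)
    (hl : ∀ z, z - L z = l z • v) :
    ∃ k : E → F, ContDiffOn ℝ ∞ k Q ∧ ∀ z ∈ Q, f z - f (L z) = l z • k z := by
  have hu := uniqueDiffOn_convex hQ hQ'
  obtain ⟨hd, hf'⟩ := (contDiffOn_infty_iff_fderivWithin hu).1 hf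
  set f' : E → F := fun z ↦ fderivWithin ℝ f Q z v
  have hf'' : ContDiffOn ℝ ∞ f' Q := hf'.clm_apply contDiffOn_const
  -- The quotient is the integral of the derivative of `f` in the direction `v` over the segment
  -- from `L z` to `z`. It is smooth in `z` as a composition operator applied to a path that depends
  -- smoothly on `z`, so there is no differentiation under the integral sign.
  let c : E → C(unitInterval, E) := fun z ↦ constPath E (L z) + rayPath E (z - L z)
  have hc : ∀ z ∈ Q, c z ∈ mapsInto unitInterval Q := fun z hz τ ↦
    hQ.add_smul_sub_mem (hL z hz) hz τ.2
  have hcs : ContDiff ℝ ∞ c := by fun_prop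
  refine ⟨fun z ↦ primitive F (nemytskii unitInterval f' (c z)) 1, ?_, fun z hz ↦ ?_⟩
  · have h1 := (contDiffOn_nemytskii (K := unitInterval) hQ hQ' hf'').comp hcs.contDiffOn hc
    have h2 := (primitive F).contDiff.comp_contDiffOn h1
    exact (ContinuousMap.evalCLM ℝ (1 : unitInterval)).contDiff.comp_contDiffOn h2
  · have h1 := primitive_eq_sub (C := fun τ : ℝ ↦ f (L z + τ • (z - L z)))
      (l z • nemytskii unitInterval f' (c z)) (fun σ ↦ ?_) 1
    · simp only [map_smul, ContinuousMap.smul_apply] at h1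
      rw [h1]; simp
    · rw [ContinuousMap.smul_apply, nemytskii_apply hf''.continuousOn (hc z hz)]
      have h2 : HasDerivAt (fun τ : ℝ ↦ L z + τ • (z - L z)) (z - L z) σ := by
        simpa using ((hasDerivAt_id (σ : ℝ)).smul_const (z - L z)).const_add (L z)
      have h3 := (hd _ (hc z hz σ)).hasFDerivWithinAt.comp_hasDerivWithinAt (σ : ℝ)
        h2.hasDerivWithinAt (s := Icc 0 1) fun τ hτ ↦ hc z hz ⟨τ, hτ⟩
      rw [hl z, map_smul] at h3
      rw [hl z]
      exact h3

end UnitInterval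

section HalfSpace

/-- The closed half-space `{(e, t) | 0 ≤ t}`. -/
def halfSpace (E : Type*) : Set (E × ℝ) := {z | 0 ≤ z.2}

variable {E : Type*} [NormedAddCommGroup E] [NormedSpace ℝ E]

theorem halfSpace_eq_prod : halfSpace E = univ ×ˢ Ici 0 := by ext; simp [halfSpace]

theorem convex_halfSpace : Convex ℝ (halfSpace E) := by
  rw [halfSpace_eq_prod]; exact convex_univ.prod (convex_Ici 0)

theorem isClosed_halfSpace : IsClosed (halfSpace E) := by
  rw [halfSpace_eq_prod]; exact isClosed_univ.prod isClosed_Ici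

theorem uniqueDiffOn_halfSpace : UniqueDiffOn ℝ (halfSpace E) := by
  rw [halfSpace_eq_prod]; exact uniqueDiffOn_univ.prod (uniqueDiffOn_Ici 0)

theorem mk_zero_mem_halfSpace (e : E) : (e, (0 : ℝ)) ∈ halfSpace E := le_refl (0 : ℝ)

end HalfSpace

/-! ### A two-point boundary value problem on a short time interval -/

section BoundaryValueProblem

open ContinuousLinearMap

variable {E W : Type u} [NormedAddCommGroup E] [NormedSpace ℝ E] [NormedAddCommGroup W]
  [NormedSpace ℝ W] [CompleteSpace W]

/-- The primitive whose image under `pr` vanishes at `1`, while its image under `1 - pr` vanishes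
at `0`, for a projection `pr`. -/
def bvpPrimitive (pr : W →L[ℝ] W) : C(unitInterval, W) →L[ℝ] C(unitInterval, W) :=
  primitive W - (constPath W).comp (pr.comp ((ContinuousMap.evalCLM ℝ 1).comp (primitive W)))

/-- The path `τ ↦ (s.2 * τ, U τ)`. -/
def graphPath (E W : Type u) [NormedAddCommGroup E] [NormedSpace ℝ E] [NormedAddCommGroup W]
    [NormedSpace ℝ W] : (E × ℝ) × C(unitInterval, W) →L[ℝ] C(unitInterval, ℝ × W) :=
  (rayPath (ℝ × W)).comp ((inl ℝ ℝ W).comp ((snd ℝ E ℝ).comp (fst ℝ _ _))) +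
    ((inr ℝ ℝ W).compLeftContinuous ℝ unitInterval).comp (snd ℝ _ _)

theorem graphPath_apply (s : E × ℝ) (U : C(unitInterval, W)) (τ : unitInterval) :
    graphPath E W (s, U) τ = (s.2 * τ, U τ) := by
  simp [graphPath, mul_comm]

/-- The integral operator of the boundary value problem. -/
def bvpMap (F : ℝ × W → W) (ι : E →L[ℝ] W) (pr : W →L[ℝ] W)
    (z : (E × ℝ) × C(unitInterval, W)) : C(unitInterval, W) :=
  constPath W (ι z.1.1) + z.1.2 • bvpPrimitive pr (nemytskii unitInterval F (graphPath E W z))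

/-- The derivative of `bvpMap`. -/
def bvpMapDeriv (F : ℝ × W → W) (F' : ℝ × W → ℝ × W →L[ℝ] W) (ι : E →L[ℝ] W) (pr : W →L[ℝ] W)
    (z : (E × ℝ) × C(unitInterval, W)) :
    (E × ℝ) × C(unitInterval, W) →L[ℝ] C(unitInterval, W) :=
  (constPath W).comp (ι.comp ((fst ℝ E ℝ).comp (fst ℝ _ _))) +
    (z.1.2 • (bvpPrimitive pr).comp ((pointwiseBilin unitInterval
      (ContinuousLinearMap.id ℝ (ℝ × W →L[ℝ] W)) (nemytskii unitInterval F' (graphPath E W z))).comp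
        (graphPath E W)) +
      ((snd ℝ E ℝ).comp (fst ℝ _ C(unitInterval, W))).smulRight
        (bvpPrimitive pr (nemytskii unitInterval F (graphPath E W z))))

/-- The integral term of `bvpMap` carries the factor `s.2`, so at time zero its partial derivative
in the path vanishes and the constant path solves the equation. The last clause says that the
linearized equation has only one solution; it allows a derivative of `u` to be identified by
exhibiting a path that solves the linearization. -/
theorem exists_contDiffOn_bvp {F : ℝ × W → W} {ι : E →L[ℝ] W} (pr : W →L[ℝ] W) {a : E} {δ : ℝ}
    (hδ : 0 < δ) (hF : ContDiffOn ℝ ∞ F (Ico 0 δ ×ˢ Metric.ball (ι a) δ)) :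
    ∃ r > 0, r ≤ δ ∧ ∃ u : E × ℝ → C(unitInterval, W),
      ContDiffOn ℝ ∞ u (halfSpace E ∩ Metric.ball (a, 0) r) ∧
      ∀ s ∈ halfSpace E ∩ Metric.ball (a, 0) r,
        (∀ τ : unitInterval, (s.2 * τ, u s τ) ∈ Ico 0 δ ×ˢ Metric.ball (ι a) δ) ∧
        bvpMap F ι pr (s, u s) = u s ∧
        ∀ d V, bvpMapDeriv F (fderivWithin ℝ F (Ico 0 δ ×ˢ Metric.ball (ι a) δ)) ι pr (s, u s)
          (d, V) = V ↔ V = fderivWithin ℝ u (halfSpace E ∩ Metric.ball (a, 0) r) s d := by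
  set Q := Ico 0 δ ×ˢ Metric.ball (ι a) δ with hQdef
  have hQ : Convex ℝ Q := (convex_Ico 0 δ).prod (convex_ball _ _)
  have hQ' : (interior Q).Nonempty := by
    rw [hQdef, interior_prod_eq, interior_Ico, Metric.isOpen_ball.interior_eq]
    exact (nonempty_Ioo.2 hδ).prod (Metric.nonempty_ball.2 hδ)
  have hQu := uniqueDiffOn_convex hQ hQ'
  obtain ⟨hFd, hF'⟩ := (contDiffOn_infty_iff_fderivWithin hQu).1 hF
  set F' := fderivWithin ℝ F Q
  set S : Set (E × ℝ) := univ ×ˢ Ico 0 δ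
  have hS : UniqueDiffOn ℝ S := uniqueDiffOn_univ.prod
    (uniqueDiffOn_convex (convex_Ico 0 δ) (by rw [interior_Ico]; exact nonempty_Ioo.2 hδ))
  set U₀ := constPath W (ι a)
  set 𝒬 := S ×ˢ (univ ∩ Metric.ball U₀ δ) with h𝒬
  have h𝒬u : UniqueDiffOn ℝ 𝒬 := hS.prod (uniqueDiffOn_univ.inter Metric.isOpen_ball)
  have hg : MapsTo (graphPath E W) 𝒬 (mapsInto unitInterval Q) := by
    rintro ⟨s, U⟩ ⟨hs, -, hU⟩ τ
    rw [graphPath_apply]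
    refine ⟨⟨mul_nonneg hs.2.1 τ.2.1, (mul_le_of_le_one_right hs.2.1 τ.2.2).trans_lt hs.2.2⟩, ?_⟩
    exact (ContinuousMap.dist_apply_le_dist τ).trans_lt hU
  have hN : ContDiffOn ℝ ∞ (fun z ↦ nemytskii unitInterval F (graphPath E W z)) 𝒬 :=
    (contDiffOn_nemytskii hQ hQ' hF).comp (graphPath E W).contDiff.contDiffOn hg
  have hΦ : ContDiffOn ℝ ∞ (bvpMap F ι pr) 𝒬 := by
    have hN' : ContDiffOn ℝ ∞
        (fun z ↦ bvpPrimitive pr (nemytskii unitInterval F (graphPath E W z))) 𝒬 :=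
      (bvpPrimitive pr).contDiff.comp_contDiffOn hN
    have hx : ContDiffOn ℝ ∞ (fun z : (E × ℝ) × C(unitInterval, W) ↦ z.1.2) 𝒬 :=
      (contDiff_snd.comp contDiff_fst).contDiffOn
    refine ContDiffOn.add ?_ (hx.smul hN')
    exact ((constPath W).contDiff.comp (ι.contDiff.comp (contDiff_fst.comp contDiff_fst))).contDiffOn
  have hΦ' : ∀ z ∈ 𝒬, HasFDerivWithinAt (bvpMap F ι pr) (bvpMapDeriv F F' ι pr z) 𝒬 z := by
    intro z hz
    have h1 := (hasFDerivWithinAt_nemytskii (K := unitInterval) hQ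
      (fun x hx ↦ (hFd x hx).hasFDerivWithinAt) hF'.continuousOn (hg hz)).comp z
        (graphPath E W).hasFDerivWithinAt hg
    have h2 := (bvpPrimitive pr).hasFDerivAt.comp_hasFDerivWithinAt z h1
    have h3 := ((snd ℝ E ℝ).comp (fst ℝ _ C(unitInterval, W))).hasFDerivWithinAt (s := 𝒬) (x := z)
    have h4 := ((constPath W).comp (ι.comp ((fst ℝ E ℝ).comp
      (fst ℝ _ C(unitInterval, W))))).hasFDerivWithinAt (s := 𝒬) (x := z)
    exact h4.add (h3.smul h2)
  have hfd : ∀ z ∈ 𝒬, fderivWithin ℝ (bvpMap F ι pr) 𝒬 z = bvpMapDeriv F F' ι pr z :=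
    fun z hz ↦ (hΦ' z hz).fderivWithin (h𝒬u z hz)
  have hs₀ : (a, (0 : ℝ)) ∈ S := ⟨mem_univ _, le_rfl, hδ⟩
  have hz₀ : ((a, (0 : ℝ)), U₀) ∈ 𝒬 := ⟨hs₀, mem_univ _, Metric.mem_ball_self hδ⟩
  obtain ⟨r, hr, r₁, hr₁, u, hr₁δ, hu, -, h⟩ := exists_contDiffOn_fixedPoint hS uniqueDiffOn_univ
    convex_univ isClosed_univ hs₀ (mem_univ U₀) hδ hΦ (fun _ _ _ _ ↦ mem_univ _)
    (by simp [bvpMap, U₀]) (by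
      rw [hfd _ hz₀]
      ext V : 1
      simp [bvpMapDeriv])
  have hsub : halfSpace E ∩ Metric.ball (a, 0) (min r δ) ⊆ S ∩ Metric.ball (a, 0) r := by
    rintro s ⟨hs, hsb⟩
    refine ⟨⟨mem_univ _, hs, ?_⟩, Metric.ball_subset_ball (min_le_left _ _) hsb⟩
    have h1 : dist s.2 0 ≤ dist s (a, 0) := (le_max_right _ _)
    have h2 := Metric.ball_subset_ball (min_le_right _ _) hsb
    rw [Metric.mem_ball] at h2
    rw [Real.dist_0_eq_abs] at h1
    linarith [le_abs_self s.2]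
  -- Radius at most `δ` keeps the time coordinate in `[0, δ)`, so the parameter set can be described
  -- with the half-space alone.
  refine ⟨min r δ, lt_min hr hδ, min_le_right _ _, u, hu.mono hsub, fun s hs ↦ ?_⟩
  obtain ⟨hus, hfix, -, hbd⟩ := h s (hsub hs)
  have hmem : ∀ s ∈ halfSpace E ∩ Metric.ball (a, 0) (min r δ), (s, u s) ∈ 𝒬 := fun s hs ↦
    ⟨(hsub hs).1, mem_univ _, Metric.ball_subset_ball hr₁δ (h s (hsub hs)).1.2⟩
  refine ⟨fun τ ↦ ?_, hfix, fun d V ↦ ?_⟩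
  · rw [← graphPath_apply]
    exact hg (hmem s hs) τ
  set T := halfSpace E ∩ Metric.ball (a, 0) (min r δ)
  have hTu : UniqueDiffOn ℝ T := uniqueDiffOn_halfSpace.inter Metric.isOpen_ball
  have hus' := ((hu.mono hsub).differentiableOn (by simp) s hs).hasFDerivWithinAt
  have hcomp : HasFDerivWithinAt (fun s ↦ bvpMap F ι pr (s, u s)) ((bvpMapDeriv F F' ι pr (s, u s)).comp
      ((ContinuousLinearMap.id ℝ _).prod (fderivWithin ℝ u T s))) T s :=
    HasFDerivWithinAt.comp (f := fun s ↦ (s, u s)) s (hΦ' _ (hmem s hs))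
      ((hasFDerivWithinAt_id s T).prodMk hus') hmem
  have hDu : bvpMapDeriv F F' ι pr (s, u s) (d, fderivWithin ℝ u T s d) = fderivWithin ℝ u T s d := by
    have h1 := hcomp.congr (fun s hs ↦ ((h s (hsub hs)).2.1).symm) hfix.symm
    have h2 := (hTu s hs).eq h1 hus'
    exact congrArg (fun A ↦ A d) h2
  constructor
  · intro hV
    have h1 := hbd (u s) hus
    rw [hfd _ (hmem s hs)] at h1
    -- The difference of two solutions of the linearized equation is fixed by an operator of norm at
    -- most `1/2`.
    have h2 : ((bvpMapDeriv F F' ι pr (s, u s)).comp (inr ℝ _ _)) (V - fderivWithin ℝ u T s d) =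
        V - fderivWithin ℝ u T s d := by
      conv_rhs => rw [← hV, ← hDu, ← map_sub]
      simp
    have h3 := ((bvpMapDeriv F F' ι pr (s, u s)).comp (inr ℝ (E × ℝ) C(unitInterval, W))).le_opNorm
      (V - fderivWithin ℝ u T s d)
    rw [h2] at h3
    have h4 := norm_nonneg (V - fderivWithin ℝ u T s d)
    exact sub_eq_zero.1 (norm_eq_zero.1 (by nlinarith))
  · rintro rfl
    exact hDu

/-- `exists_contDiffOn_bvp` with pointwise descriptions of the operators. -/
theorem exists_contDiffOn_path {F : ℝ × W → W} {ι : E →L[ℝ] W} (pr : W →L[ℝ] W) {a : E} {δ : ℝ}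
    (hδ : 0 < δ) (hF : ContDiffOn ℝ ∞ F (Ico 0 δ ×ˢ Metric.ball (ι a) δ)) :
    ∃ r > 0, ∃ u : E × ℝ → C(unitInterval, W),
      ContDiffOn ℝ ∞ u (halfSpace E ∩ Metric.ball (a, 0) r) ∧
      ∀ s ∈ halfSpace E ∩ Metric.ball (a, 0) r,
        (∀ τ : unitInterval, (s.2 * τ, u s τ) ∈ Ico 0 δ ×ˢ Metric.ball (ι a) δ) ∧
        ∃ N : C(unitInterval, W), (∀ τ : unitInterval, N τ = F (s.2 * τ, u s τ)) ∧
          (∀ τ, u s τ = ι s.1 + s.2 • (primitive W N τ - pr (primitive W N 1))) ∧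
          ∀ d V, ∃ M : C(unitInterval, W),
            (∀ τ : unitInterval, M τ = fderivWithin ℝ F (Ico 0 δ ×ˢ Metric.ball (ι a) δ)
              (s.2 * τ, u s τ) (d.2 * τ, V τ)) ∧
            ((∀ τ, V τ = ι d.1 + (s.2 • (primitive W M τ - pr (primitive W M 1)) +
                d.2 • (primitive W N τ - pr (primitive W N 1)))) ↔
              V = fderivWithin ℝ u (halfSpace E ∩ Metric.ball (a, 0) r) s d) := by
  obtain ⟨r, hr, -, u, hu, h⟩ := exists_contDiffOn_bvp pr hδ hF
  refine ⟨r, hr, u, hu, fun s hs ↦ ?_⟩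
  obtain ⟨hsQ, hfix, hlin⟩ := h s hs
  have hQu : UniqueDiffOn ℝ (Ico 0 δ ×ˢ Metric.ball (ι a) δ) :=
    (uniqueDiffOn_convex (convex_Ico 0 δ) (by rw [interior_Ico]; exact nonempty_Ioo.2 hδ)).prod
      Metric.isOpen_ball.uniqueDiffOn
  have hF' := ((contDiffOn_infty_iff_fderivWithin hQu).1 hF).2
  have hgQ : graphPath E W (s, u s) ∈
      mapsInto unitInterval (Ico 0 δ ×ˢ Metric.ball (ι a) δ) := fun τ ↦ by
    rw [graphPath_apply]; exact hsQ τ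
  refine ⟨hsQ, nemytskii unitInterval F (graphPath E W (s, u s)), fun τ ↦ ?_, fun τ ↦ ?_,
    fun d V ↦ ⟨pointwiseBilin unitInterval (ContinuousLinearMap.id ℝ (ℝ × W →L[ℝ] W))
      (nemytskii unitInterval (fderivWithin ℝ F (Ico 0 δ ×ˢ Metric.ball (ι a) δ))
        (graphPath E W (s, u s)))
      (graphPath E W (d, V)), fun τ ↦ ?_, ?_⟩⟩
  · rw [nemytskii_apply hF.continuousOn hgQ, graphPath_apply]
  · conv_lhs => rw [← hfix]
    rfl
  · rw [pointwiseBilin_apply, nemytskii_apply hF'.continuousOn hgQ, graphPath_apply,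
      graphPath_apply]
    rfl
  · rw [← hlin d V, ContinuousMap.ext_iff]
    exact forall_congr' fun τ ↦ eq_comm

end BoundaryValueProblem

/-! ### The Cauchy problem for a Hamilton–Jacobi equation, by characteristics -/

section HamiltonJacobi

open ContinuousLinearMap

theorem hasDerivWithinAt_comp_projIcc {W : Type u} [NormedAddCommGroup W] [NormedSpace ℝ W]
    [CompleteSpace W] {U g : C(unitInterval, W)} {c : W} (h : ∀ τ, U τ = c + primitive W g τ)
    (τ : unitInterval) :
    HasDerivWithinAt (fun σ : ℝ ↦ U (projIcc 0 1 zero_le_one σ)) (g τ) (Icc 0 1) τ := by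
  have h1 := ((hasDerivAt_primitiveAt g τ).const_add c).hasDerivWithinAt (s := Icc 0 1)
  rw [projIcc_val] at h1
  refine h1.congr (fun σ hσ ↦ ?_) ?_
  · rw [h, primitive_apply, projIcc_of_mem zero_le_one hσ]
  · rw [h, primitive_apply, projIcc_val]

/-- The vector representing a linear form. -/
def rieszVector (E : Type*) [NormedAddCommGroup E] [InnerProductSpace ℝ E] [CompleteSpace E] :
    (E →L[ℝ] ℝ) →L[ℝ] E :=
  LinearMap.mkContinuous
    { toFun := (InnerProductSpace.toDual ℝ E).symm
      map_add' := fun l m ↦ map_add _ l m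
      map_smul' := fun r l ↦ by simp } 1 fun l ↦ by simp

theorem inner_rieszVector {E : Type*} [NormedAddCommGroup E] [InnerProductSpace ℝ E]
    [CompleteSpace E] (l : E →L[ℝ] ℝ) (v : E) : inner ℝ (rieszVector E l) v = l v :=
  InnerProductSpace.toDual_symm_apply

variable {E : Type} [NormedAddCommGroup E] [InnerProductSpace ℝ E] [CompleteSpace E]

/-- Local solution of the Cauchy problem `∂w/∂t = f (t, y, ∂w/∂y, w)`, `w = 0` at `t = 0`, for `f`
independent of its last argument, together with a submersion `b` which is constant along the
characteristics. -/
theorem exists_hamiltonJacobi {f : ℝ × (E × E × ℝ) → ℝ} {a : E} {δ : ℝ} (hδ : 0 < δ)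
    (hf : ContDiffOn ℝ ∞ f (Ico 0 δ ×ˢ Metric.ball (a, 0, 0) δ))
    (hfz : ∀ z ∈ Ico 0 δ ×ˢ Metric.ball (a, 0, 0) δ,
      fderivWithin ℝ f (Ico 0 δ ×ˢ Metric.ball (a, 0, 0) δ) z (0, 0, 0, 1) = 0) :
    ∃ r > 0, ∃ (w : E × ℝ → ℝ) (b p : E × ℝ → E),
      ContDiffOn ℝ ∞ w (halfSpace E ∩ Metric.ball (a, 0) r) ∧
      ContDiffOn ℝ ∞ b (halfSpace E ∩ Metric.ball (a, 0) r) ∧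
      ContDiffOn ℝ ∞ p (halfSpace E ∩ Metric.ball (a, 0) r) ∧
      ∀ s ∈ halfSpace E ∩ Metric.ball (a, 0) r,
        (s.2, s.1, p s, w s) ∈ Ico 0 δ ×ˢ Metric.ball (a, (0 : E), (0 : ℝ)) δ ∧
        (s.2 = 0 → w s = 0 ∧ b s = s.1) ∧
        (∀ d, fderivWithin ℝ w (halfSpace E ∩ Metric.ball (a, 0) r) s d =
          inner ℝ (p s) d.1 + d.2 * f (s.2, s.1, p s, w s)) ∧
        ∀ v, (∀ q, fderivWithin ℝ f (Ico 0 δ ×ˢ Metric.ball (a, 0, 0) δ) (s.2, s.1, p s, w s)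
            (0, 0, q, 0) = - inner ℝ v q) →
          fderivWithin ℝ b (halfSpace E ∩ Metric.ball (a, 0) r) s (v, 1) = 0 := by
  set Q := Ico 0 δ ×ˢ Metric.ball (a, (0 : E), (0 : ℝ)) δ with hQdef
  have hQ : Convex ℝ Q := (convex_Ico 0 δ).prod (convex_ball _ _)
  have hQ' : (interior Q).Nonempty := by
    rw [hQdef, interior_prod_eq, interior_Ico, Metric.isOpen_ball.interior_eq]
    exact (nonempty_Ioo.2 hδ).prod (Metric.nonempty_ball.2 hδ)
  have hQu := uniqueDiffOn_convex hQ hQ'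
  obtain ⟨hfd, hf'⟩ := (contDiffOn_infty_iff_fderivWithin hQu).1 hf
  set f' := fderivWithin ℝ f Q
  set ey : E →L[ℝ] ℝ × (E × E × ℝ) := (inr ℝ ℝ _).comp (inl ℝ E _)
  set ep : E →L[ℝ] ℝ × (E × E × ℝ) := (inr ℝ ℝ _).comp ((inr ℝ E _).comp (inl ℝ E ℝ))
  set gy : ℝ × (E × E × ℝ) → E := fun z ↦ rieszVector E ((f' z).comp ey) with hgy
  set gp : ℝ × (E × E × ℝ) → E := fun z ↦ rieszVector E ((f' z).comp ep) with hgp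
  have hgy_s : ContDiffOn ℝ ∞ gy Q :=
    (rieszVector E).contDiff.comp_contDiffOn (hf'.clm_comp contDiffOn_const)
  have hgp_s : ContDiffOn ℝ ∞ gp Q :=
    (rieszVector E).contDiff.comp_contDiffOn (hf'.clm_comp contDiffOn_const)
  have hf'_apply : ∀ z ∈ Q, ∀ (l : ℝ) (v q : E) (ζ : ℝ), f' z (l, v, q, ζ) =
      l * f' z (1, 0, 0, 0) + inner ℝ (gy z) v + inner ℝ (gp z) q := by
    intro z hz l v q ζ
    have h1 : ((l, v, q, ζ) : ℝ × (E × E × ℝ)) = l • (1, 0, 0, 0) + ey v + ep q + ζ • (0, 0, 0, 1) := by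
      simp [ey, ep]
    rw [h1, map_add, map_add, map_add, map_smul, map_smul, hfz z hz, hgy, hgp, inner_rieszVector,
      inner_rieszVector]
    simp
  -- The characteristic system `y' = -f_p`, `p' = f_y`, `w' = f - ⟨p, f_p⟩`; the equation for `p`
  -- has no further term because `f` does not depend on its last argument.
  set F : ℝ × (E × E × ℝ) → E × E × ℝ := fun z ↦ (-gp z, gy z, f z - inner ℝ z.2.2.1 (gp z)) with hFdef
  have hp : ContDiff ℝ ∞ (fun z : ℝ × (E × E × ℝ) ↦ z.2.2.1) := by fun_prop
  have hF : ContDiffOn ℝ ∞ F Q :=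
    hgp_s.neg.prodMk (hgy_s.prodMk (hf.sub (hp.contDiffOn.inner ℝ hgp_s)))
  set gp' := fderivWithin ℝ gp Q
  have hF'_apply : ∀ z ∈ Q, ∀ d, fderivWithin ℝ F Q z d = (-gp' z d, fderivWithin ℝ gy Q z d,
      f' z d - (inner ℝ z.2.2.1 (gp' z d) + inner ℝ d.2.2.1 (gp z))) := by
    intro z hz d
    have h1 := (hgp_s.differentiableOn (by simp) z hz).hasFDerivWithinAt
    have h2 := (hgy_s.differentiableOn (by simp) z hz).hasFDerivWithinAt
    have h3 := (hfd z hz).hasFDerivWithinAt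
    have h4 : HasFDerivWithinAt (fun z : ℝ × (E × E × ℝ) ↦ z.2.2.1)
        ((fst ℝ E ℝ).comp ((snd ℝ E _).comp (snd ℝ ℝ _))) Q z :=
      ((fst ℝ E ℝ).comp ((snd ℝ E _).comp (snd ℝ ℝ _))).hasFDerivWithinAt
    have h5 := h1.neg.prodMk (h2.prodMk (h3.sub (h4.inner ℝ h1)))
    have h6 : fderivWithin ℝ F Q z = _ := h5.fderivWithin (hQu z hz)
    rw [h6]
    rfl
  set ι : E →L[ℝ] E × E × ℝ := inl ℝ E (E × ℝ)
  -- With this projection the position is prescribed at `τ = 1`, while momentum and value vanish at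
  -- `τ = 0`.
  set pr : E × E × ℝ →L[ℝ] E × E × ℝ := ι.comp (fst ℝ E (E × ℝ))
  have hιa : ι a = (a, 0, 0) := rfl
  obtain ⟨r, hr, u, hu, h⟩ := exists_contDiffOn_path (ι := ι) pr hδ (by rw [hιa]; exact hF)
  rw [hιa, ← hQdef] at h
  set T := halfSpace E ∩ Metric.ball (a, 0) r
  have hTu : UniqueDiffOn ℝ T := uniqueDiffOn_halfSpace.inter Metric.isOpen_ball
  -- The solution `w` is the value at the end of the characteristic, `b` (from `A₂`) is its starting
  -- position, and `p` (from `A₃`) is its final momentum.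
  set A₁ : C(unitInterval, E × E × ℝ) →L[ℝ] ℝ :=
    (snd ℝ E ℝ).comp ((snd ℝ E _).comp (ContinuousMap.evalCLM ℝ 1))
  set A₂ : C(unitInterval, E × E × ℝ) →L[ℝ] E := (fst ℝ E _).comp (ContinuousMap.evalCLM ℝ 0)
  set A₃ : C(unitInterval, E × E × ℝ) →L[ℝ] E :=
    (fst ℝ E ℝ).comp ((snd ℝ E _).comp (ContinuousMap.evalCLM ℝ 1))
  refine ⟨r, hr, fun s ↦ A₁ (u s), fun s ↦ A₂ (u s), fun s ↦ A₃ (u s),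
    A₁.contDiff.comp_contDiffOn hu, A₂.contDiff.comp_contDiffOn hu, A₃.contDiff.comp_contDiffOn hu,
    fun s hs ↦ ?_⟩
  obtain ⟨hsQ, N, hN, hUN, hlin⟩ := h s hs
  set U := u s
  have hU : ∀ τ, U τ = (ι s.1 - s.2 • pr (primitive _ N 1)) + primitive _ (s.2 • N) τ := by
    intro τ
    rw [hUN, map_smul, ContinuousMap.smul_apply, smul_sub]
    abel
  have hprim0 : ∀ g : C(unitInterval, E × E × ℝ), primitive _ g 0 = 0 := fun g ↦
    intervalIntegral.integral_same
  have hU1 : (U 1).1 = s.1 := by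
    rw [hU 1]
    simp [ι, pr]
  have hU0 : (U 0).2 = 0 := by
    rw [hU 0, hprim0]
    simp [ι, pr]
  have hU1' : U 1 = (s.1, A₃ U, A₁ U) := by
    rw [← hU1]; rfl
  have hUd := hasDerivWithinAt_comp_projIcc hU
  have hcurve : ∀ τ : unitInterval, HasDerivWithinAt
      (fun σ : ℝ ↦ (s.2 * σ, U (projIcc 0 1 zero_le_one σ))) (s.2, s.2 • N τ) (Icc 0 1) τ := by
    intro τ
    have h1 : HasDerivWithinAt (fun σ : ℝ ↦ s.2 * σ) s.2 (Icc 0 1) τ := by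
      simpa using (hasDerivWithinAt_id (τ : ℝ) (Icc 0 1)).const_mul s.2
    exact h1.prodMk (hUd τ)
  have hcurveQ : MapsTo (fun σ : ℝ ↦ (s.2 * σ, U (projIcc 0 1 zero_le_one σ))) (Icc 0 1) Q := by
    intro σ hσ
    have := hsQ ⟨σ, hσ⟩
    simpa only [projIcc_of_mem zero_le_one hσ] using this
  have hcomp : ∀ {G : Type} [NormedAddCommGroup G] [NormedSpace ℝ G] {k : ℝ × (E × E × ℝ) → G}
      (hk : DifferentiableOn ℝ k Q) (τ : unitInterval), HasDerivWithinAt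
      (fun σ : ℝ ↦ k (s.2 * σ, U (projIcc 0 1 zero_le_one σ)))
      (fderivWithin ℝ k Q (s.2 * τ, U τ) (s.2, s.2 • N τ)) (Icc 0 1) τ := by
    intro G _ _ k hk τ
    have h1 := (hk _ (hsQ τ)).hasFDerivWithinAt
    refine HasFDerivWithinAt.comp_hasDerivWithinAt (t := Q)
      (f := fun σ : ℝ ↦ (s.2 * σ, U (projIcc 0 1 zero_le_one σ))) (τ : ℝ) ?_ (hcurve τ) hcurveQ
    rw [projIcc_val]
    exact h1
  have hDA : ∀ {G : Type} [NormedAddCommGroup G] [NormedSpace ℝ G]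
      (A : C(unitInterval, E × E × ℝ) →L[ℝ] G) (d : E × ℝ),
      fderivWithin ℝ (fun s ↦ A (u s)) T s d = A (fderivWithin ℝ u T s d) := by
    intro G _ _ A d
    have h1 := A.hasFDerivAt.comp_hasFDerivWithinAt s
      ((hu.differentiableOn (by simp) s hs).hasFDerivWithinAt)
    have h2 : fderivWithin ℝ (A ∘ u) T s = _ := h1.fderivWithin (hTu s hs)
    exact congrArg (fun B ↦ B d) h2
  refine ⟨?_, fun hs0 ↦ ⟨?_, ?_⟩, fun d ↦ ?_, fun v hv ↦ ?_⟩
  · have := hsQ 1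
    rwa [hU1', Icc.coe_one, mul_one] at this
  · have h1 := congrArg (fun x : E × E × ℝ ↦ x.2.2) (hU 1)
    rw [hs0] at h1
    change (U 1).2.2 = 0
    simpa [ι] using h1
  · have h1 := congrArg (fun x : E × E × ℝ ↦ x.1) (hU 0)
    rw [hs0, hprim0] at h1
    change (U 0).1 = s.1
    simpa [ι] using h1
  · rw [hDA A₁ d]
    set V := fderivWithin ℝ u T s d
    obtain ⟨M, hM, hV⟩ := hlin d V
    have hVeq : ∀ τ, V τ = (ι d.1 - s.2 • pr (primitive _ M 1) - d.2 • pr (primitive _ N 1)) +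
        primitive _ (s.2 • M + d.2 • N) τ := by
      intro τ
      rw [hV.2 rfl τ, map_add, map_smul, map_smul]
      simp only [ContinuousMap.add_apply, ContinuousMap.smul_apply, smul_sub]
      abel
    have hV1 : (V 1).1 = d.1 := by
      rw [hVeq 1]
      simp [ι, pr]
    have hV0 : (V 0).2 = 0 := by
      rw [hVeq 0, hprim0]
      simp [ι, pr]
    have hVd := hasDerivWithinAt_comp_projIcc hVeq
    -- `V` is the variation of the characteristic in the direction `d`. The contact form `dw - ⟨p,
    -- dy⟩ - f dt`, evaluated on this variation (whose time component is `σ d.2`), is conserved. It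
    -- vanishes at `σ = 0` by the initial conditions, and at `σ = 1` it yields the formula for `dw`.
    set R : ℝ → ℝ := fun σ ↦ (V (projIcc 0 1 zero_le_one σ)).2.2 -
      inner ℝ (U (projIcc 0 1 zero_le_one σ)).2.1 (V (projIcc 0 1 zero_le_one σ)).1 -
      d.2 * (σ * f (s.2 * σ, U (projIcc 0 1 zero_le_one σ)))
    have hR : ∀ τ : unitInterval, HasDerivWithinAt R 0 (Icc 0 1) τ := by
      intro τ
      have k1 := (((snd ℝ E ℝ).comp (snd ℝ E _)).hasFDerivAt.comp_hasDerivWithinAt (τ : ℝ) (hVd τ))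
      have k2 := ((fst ℝ E (E × ℝ)).hasFDerivAt.comp_hasDerivWithinAt (τ : ℝ) (hVd τ))
      have k3 := (((fst ℝ E ℝ).comp (snd ℝ E _)).hasFDerivAt.comp_hasDerivWithinAt (τ : ℝ) (hUd τ))
      have k4 := ((hasDerivWithinAt_id (τ : ℝ) (Icc 0 1)).mul (hcomp hfd τ)).const_mul d.2
      have k5 := (k1.sub (k3.inner ℝ k2)).sub k4
      refine k5.congr_deriv ?_
      have e1 := hM τ
      rw [hF'_apply _ (hsQ τ)] at e1
      have e2 := hN τ
      have e3 := hf'_apply _ (hsQ τ) (d.2 * τ) (V τ).1 (V τ).2.1 (V τ).2.2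
      have e4 := hf'_apply _ (hsQ τ) s.2 (s.2 • N τ).1 (s.2 • N τ).2.1 (s.2 • N τ).2.2
      change f' _ (d.2 * τ, V τ) = _ at e3
      change f' _ (s.2, s.2 • N τ) = _ at e4
      rw [e3] at e1
      rw [e4]
      simp only [ContinuousMap.add_apply, ContinuousMap.smul_apply, e1, e2, hFdef,
        projIcc_val, ContinuousLinearMap.comp_apply, ContinuousLinearMap.coe_fst',
        ContinuousLinearMap.coe_snd', Prod.smul_fst, Prod.smul_snd, Prod.fst_add, Prod.snd_add,
        Function.comp_apply, inner_add_right, inner_smul_right, inner_neg_right, inner_smul_left,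
        smul_eq_mul, smul_neg, real_inner_comm (gp _) (gy _), id]
      rw [real_inner_comm (gp (s.2 * (τ : ℝ), U τ)) (V τ).2.1, conj_trivial]
      ring
    have hR01 : R 1 = R 0 := by
      have := primitive_eq_sub (C := R) 0 (fun σ ↦ hR σ) 1
      rw [map_zero] at this
      exact (sub_eq_zero.1 this.symm)
    have hp0 : projIcc (0 : ℝ) 1 zero_le_one 0 = 0 := projIcc_left _
    have hp1 : projIcc (0 : ℝ) 1 zero_le_one 1 = 1 := projIcc_right _
    simp only [R, hp0, hp1, hV0, hU0, hV1, hU1'] at hR01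
    simp at hR01
    change (V 1).2.2 = _
    linarith
  · rw [hDA A₂ (v, 1)]
    -- Moving the endpoint along its own characteristic only reparametrizes the path, so the
    -- variation should be `τ` times the velocity. It solves the linearized equation, hence is the
    -- derivative of `u`, and it vanishes at `τ = 0`, so the starting point does not move.
    set V : C(unitInterval, E × E × ℝ) := ⟨fun τ ↦ (τ : ℝ) • N τ, by fun_prop⟩
    obtain ⟨M, hM, hV⟩ := hlin (v, 1) V
    have hVd : ∀ τ : unitInterval, HasDerivWithinAt
        (fun σ : ℝ ↦ σ • F (s.2 * σ, U (projIcc 0 1 zero_le_one σ)))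
        ((s.2 • M + N) τ) (Icc 0 1) τ := by
      intro τ
      refine ((hasDerivWithinAt_id (τ : ℝ) (Icc 0 1)).smul
        (hcomp (hF.differentiableOn (by simp)) τ)).congr_deriv ?_
      rw [projIcc_val, ContinuousMap.add_apply, ContinuousMap.smul_apply, hM, ← hN, one_smul]
      congr 1
      simp only [id]
      rw [← ContinuousLinearMap.map_smul, ← ContinuousLinearMap.map_smul]
      congr 1
      simp only [V, ContinuousMap.coe_mk, Prod.smul_mk, smul_eq_mul, smul_smul, mul_one, mul_comm]
    have hprim : ∀ τ, primitive _ (s.2 • M + N) τ = V τ := by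
      intro τ
      rw [primitive_eq_sub _ hVd τ, projIcc_val, ← hN]
      simp [V]
    -- The hypothesis on `v` says that it is the characteristic velocity `-f_p` at the endpoint,
    -- which matches the end condition on the position.
    have hvN : v = (N 1).1 := by
      refine ext_inner_right ℝ fun q ↦ ?_
      have h1 := hv q
      have h2 := hf'_apply _ (hsQ 1) 0 0 q 0
      rw [hN 1]
      rw [hU1', Icc.coe_one, mul_one] at h2 ⊢
      rw [h1] at h2
      simp only [hFdef, inner_neg_left]
      simp at h2
      linarith
    have key := hV.1 fun τ ↦ ?_
    · rw [← key]
      change (V 0).1 = 0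
      simp [V]
    · have h1 := hprim τ
      have h2 := congrArg pr (hprim 1)
      rw [map_add, map_smul] at h1 h2
      simp only [ContinuousMap.add_apply, ContinuousMap.smul_apply, map_add, map_smul] at h1 h2
      have h3 : pr (V 1) = ι v := by
        rw [hvN]
        simp [V, pr]
      rw [h3] at h2
      rw [← h1, ← h2, one_smul, smul_sub]
      abel

end HamiltonJacobi

/-! ### The eikonal equation near a boundary point of the half-space -/

section Eikonal

open ContinuousLinearMap

/-- A germ at `(a, 0)` of a smooth symmetric bilinear form on the half-space, of the form
`dt² + k` with `k` a positive definite form in the directions of `E` at boundary points. -/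
structure IsBoundaryMetric {E : Type*} [NormedAddCommGroup E] [NormedSpace ℝ E]
    (γ : E × ℝ → (E × ℝ) →L[ℝ] (E × ℝ) →L[ℝ] ℝ) (a : E) : Prop where
  smooth : ∀ᶠ z in 𝓝[halfSpace E] (a, 0), ContDiffWithinAt ℝ ∞ γ (halfSpace E) z
  symm : ∀ᶠ z in 𝓝[halfSpace E] (a, 0), ∀ v w, γ z v w = γ z w v
  boundary : ∀ᶠ z in 𝓝[halfSpace E] (a, 0), z.2 = 0 →
    ∀ v w, γ z v w = v.2 * w.2 + γ z (v.1, 0) (w.1, 0)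
  pos : ∀ v : E, v ≠ 0 → 0 < γ (a, 0) (v, 0) (v, 0)

/-- `w` and `b` are smooth at `z`, have the boundary values `0` and `z.1`, and there is a vector
annihilated by the differential of `b` which is dual, up to the natural factor, to the covector
`dt + t dw`. -/
def IsNormalAt {E : Type*} [NormedAddCommGroup E] [NormedSpace ℝ E]
    (γ : E × ℝ → (E × ℝ) →L[ℝ] (E × ℝ) →L[ℝ] ℝ) (w : E × ℝ → ℝ) (b : E × ℝ → E)
    (z : E × ℝ) : Prop :=
  ContDiffWithinAt ℝ ∞ w (halfSpace E) z ∧ ContDiffWithinAt ℝ ∞ b (halfSpace E) z ∧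
  (z.2 = 0 → w z = 0 ∧ b z = z.1) ∧
  ∃ T : E × ℝ, T.2 = 1 ∧ fderivWithin ℝ b (halfSpace E) z T = 0 ∧
    ∀ d, γ z T d = (1 + z.2 * fderivWithin ℝ w (halfSpace E) z T) *
      (d.2 + z.2 * fderivWithin ℝ w (halfSpace E) z d)

theorem eventually_halfSpace_iff {E : Type*} [NormedAddCommGroup E] [NormedSpace ℝ E] {a : E}
    {p : E × ℝ → Prop} : (∀ᶠ z in 𝓝[halfSpace E] (a, 0), p z) ↔
      ∃ r > 0, ∀ z ∈ halfSpace E ∩ Metric.ball (a, 0) r, p z := by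
  rw [Filter.Eventually, Metric.mem_nhdsWithin_iff]
  exact exists_congr fun r ↦ and_congr_right fun _ ↦
    ⟨fun h z hz ↦ h ⟨hz.2, hz.1⟩, fun h z hz ↦ h z ⟨hz.2, hz.1⟩⟩

set_option maxSynthPendingDepth 3

variable {E : Type} [NormedAddCommGroup E] [InnerProductSpace ℝ E] [FiniteDimensional ℝ E]
  {γ : E × ℝ → (E × ℝ) →L[ℝ] (E × ℝ) →L[ℝ] ℝ} {a : E}

/-- The block form at the boundary, together with positivity on `E`, gives `γ (v, v) > 0` for `v ≠
0`, so `γ` is injective as a map to the dual; a dimension count finishes. -/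
theorem IsBoundaryMetric.exists_equiv (h : IsBoundaryMetric γ a) :
    ∃ e : (E × ℝ) ≃L[ℝ] ((E × ℝ) →L[ℝ] ℝ), (e : (E × ℝ) →L[ℝ] (E × ℝ) →L[ℝ] ℝ) = γ (a, 0) := by
  have hb := h.boundary.self_of_nhdsWithin (mk_zero_mem_halfSpace a) rfl
  have hinj : Function.Injective (γ (a, 0)) := by
    refine (injective_iff_map_eq_zero _).2 fun v hv ↦ ?_
    have h1 := hb v v
    rw [hv, zero_apply] at h1
    have h2 : v.1 = 0 := by
      by_contra hne
      have := h.pos v.1 hne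
      nlinarith [mul_self_nonneg v.2]
    rw [h2] at h1
    simp only [Prod.mk_zero_zero, map_zero, add_zero] at h1
    exact Prod.ext h2 (mul_self_eq_zero.1 h1.symm)
  have hdim : Module.finrank ℝ (E × ℝ) = Module.finrank ℝ ((E × ℝ) →L[ℝ] ℝ) := by
    rw [← (LinearMap.toContinuousLinearMap : ((E × ℝ) →ₗ[ℝ] ℝ) ≃ₗ[ℝ] _).finrank_eq]
    exact (Subspace.dual_finrank_eq (K := ℝ) (V := E × ℝ)).symm
  refine ⟨(LinearEquiv.ofInjectiveOfFinrankEq (γ (a, 0) : (E × ℝ) →ₗ[ℝ] _) hinj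
    hdim).toContinuousLinearEquiv, ?_⟩
  exact ContinuousLinearMap.ext fun v ↦ rfl

/-- The inverse metric near the boundary point `a`. -/
theorem IsBoundaryMetric.exists_inverse (h : IsBoundaryMetric γ a) :
    ∃ G : E × ℝ → ((E × ℝ) →L[ℝ] ℝ) →L[ℝ] (E × ℝ), ∀ᶠ z in 𝓝[halfSpace E] (a, 0),
      ContDiffWithinAt ℝ ∞ G (halfSpace E) z ∧ (∀ α, γ z (G z α) = α) ∧ ∀ v, G z (γ z v) = v := by
  obtain ⟨e, he⟩ := h.exists_equiv
  have hcont : ContinuousWithinAt γ (halfSpace E) (a, 0) :=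
    (h.smooth.self_of_nhdsWithin (mk_zero_mem_halfSpace a)).continuousWithinAt
  have hmem := hcont.eventually (by rw [← he]; exact e.nhds)
  refine ⟨fun z ↦ (γ z).inverse, ?_⟩
  filter_upwards [hmem, h.smooth] with z ⟨e', he'⟩ hz
  refine ⟨?_, fun α ↦ ?_, fun v ↦ ?_⟩
  · have h1 := contDiffAt_map_inverse (n := ∞) e'
    rw [he'] at h1
    exact h1.comp_contDiffWithinAt z hz
  · rw [← he', inverse_equiv]; simp
  · rw [← he', inverse_equiv]; simp

/-- The covector `c dt + t ⟨p, dy⟩`. -/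
def scaledCovector (c t : ℝ) (p : E) : (E × ℝ) →L[ℝ] ℝ :=
  c • snd ℝ E ℝ + t • (innerSL ℝ p).comp (fst ℝ E ℝ)

theorem scaledCovector_apply (c t : ℝ) (p : E) (d : E × ℝ) :
    scaledCovector c t p d = c * d.2 + t * inner ℝ p d.1 := rfl

theorem mk_mem_halfSpace_inter_ball {a : E} {δ : ℝ} {z : ℝ × (E × E × ℝ)}
    (hz : z ∈ Ico 0 δ ×ˢ Metric.ball (a, (0 : E), (0 : ℝ)) δ) :
    (z.2.1, z.1) ∈ halfSpace E ∩ Metric.ball (a, 0) δ := by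
  obtain ⟨t, y, q, ζ⟩ := z
  obtain ⟨ht, hw⟩ := hz
  refine ⟨ht.1, ?_⟩
  rw [← ball_prod_same] at hw ⊢
  refine ⟨hw.1, ?_⟩
  rw [Metric.mem_ball, Real.dist_0_eq_abs]
  exact (abs_of_nonneg ht.1).trans_lt ht.2

/-- `G` is the inverse of the metric `γ` on a half-ball. -/
structure IsInverseMetricOn (γ : E × ℝ → (E × ℝ) →L[ℝ] (E × ℝ) →L[ℝ] ℝ)
    (G : E × ℝ → ((E × ℝ) →L[ℝ] ℝ) →L[ℝ] (E × ℝ)) (s : Set (E × ℝ)) : Prop where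
  smooth : ∀ z ∈ s, ContDiffWithinAt ℝ ∞ G (halfSpace E) z
  right_inv : ∀ z ∈ s, ∀ α, γ z (G z α) = α
  left_inv : ∀ z ∈ s, ∀ v, G z (γ z v) = v
  symm : ∀ z ∈ s, ∀ v w, γ z v w = γ z w v
  boundary : ∀ z ∈ s, z.2 = 0 → ∀ v w, γ z v w = v.2 * w.2 + γ z (v.1, 0) (w.1, 0)

theorem IsInverseMetricOn.apply_comm {G : E × ℝ → ((E × ℝ) →L[ℝ] ℝ) →L[ℝ] (E × ℝ)}
    {s : Set (E × ℝ)} (h : IsInverseMetricOn γ G s) {z : E × ℝ} (hz : z ∈ s)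
    (α β : (E × ℝ) →L[ℝ] ℝ) : α (G z β) = β (G z α) := by
  have h1 := h.symm z hz (G z α) (G z β)
  rwa [h.right_inv z hz, h.right_inv z hz] at h1

/-- The absence of mixed terms at the boundary makes `∂/∂t` the unit normal there. This is what
makes the eikonal equation compatible with `w = 0` and solvable after division by `t`. -/
theorem IsInverseMetricOn.apply_snd {G : E × ℝ → ((E × ℝ) →L[ℝ] ℝ) →L[ℝ] (E × ℝ)}
    {s : Set (E × ℝ)} (h : IsInverseMetricOn γ G s) {z : E × ℝ} (hz : z ∈ s) (hz0 : z.2 = 0) :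
    G z (snd ℝ E ℝ) = (0, 1) := by
  have h1 : γ z (0, 1) = snd ℝ E ℝ := ContinuousLinearMap.ext fun v ↦ by
    have h0 : ((0 : E), (0 : ℝ)) = 0 := rfl
    rw [h.boundary z hz hz0 (0, 1) v, h0, map_zero]
    simp
  rw [← h1, h.left_inv z hz]

theorem IsBoundaryMetric.exists_isInverseMetricOn (h : IsBoundaryMetric γ a) :
    ∃ G, ∃ r > 0, IsInverseMetricOn γ G (halfSpace E ∩ Metric.ball (a, 0) r) := by
  obtain ⟨G, hG⟩ := h.exists_inverse
  obtain ⟨r, hr, hall⟩ := eventually_halfSpace_iff.1 (hG.and (h.symm.and h.boundary))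
  exact ⟨G, r, hr, fun z hz ↦ (hall z hz).1.1, fun z hz ↦ (hall z hz).1.2.1,
    fun z hz ↦ (hall z hz).1.2.2, fun z hz ↦ (hall z hz).2.1, fun z hz ↦ (hall z hz).2.2⟩

theorem IsInverseMetricOn.contDiffOn_comp {G : E × ℝ → ((E × ℝ) →L[ℝ] ℝ) →L[ℝ] (E × ℝ)} {r : ℝ}
    (h : IsInverseMetricOn γ G (halfSpace E ∩ Metric.ball (a, 0) r)) :
    ContDiffOn ℝ ∞ (fun z : ℝ × (E × E × ℝ) ↦ G (z.2.1, z.1))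
      (Ico 0 r ×ˢ Metric.ball (a, (0 : E), (0 : ℝ)) r) := by
  have h1 : ContDiffOn ℝ ∞ G (halfSpace E ∩ Metric.ball (a, 0) r) := fun z hz ↦
    (h.smooth z hz).mono inter_subset_left
  refine h1.comp (f := fun z : ℝ × (E × E × ℝ) ↦ (z.2.1, z.1)) ?_
    fun z hz ↦ mk_mem_halfSpace_inter_ball hz
  exact ContDiff.contDiffOn (by fun_prop)

/-- The eikonal equation solved for the normal derivative. -/
theorem IsInverseMetricOn.exists_hamiltonian {G : E × ℝ → ((E × ℝ) →L[ℝ] ℝ) →L[ℝ] (E × ℝ)}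
    {r : ℝ} (hr : 0 < r) (hall : IsInverseMetricOn γ G (halfSpace E ∩ Metric.ball (a, 0) r)) :
    ∃ δ > 0, δ ≤ r ∧ ∃ f : ℝ × (E × E × ℝ) → ℝ,
      ContDiffOn ℝ ∞ f (Ico 0 δ ×ˢ Metric.ball (a, 0, 0) δ) ∧
      ∀ z ∈ Ico 0 δ ×ˢ Metric.ball (a, (0 : E), (0 : ℝ)) δ,
        fderivWithin ℝ f (Ico 0 δ ×ˢ Metric.ball (a, 0, 0) δ) z (0, 0, 0, 1) = 0 ∧
        scaledCovector (1 + z.1 * f z) z.1 z.2.2.1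
          (G (z.2.1, z.1) (scaledCovector (1 + z.1 * f z) z.1 z.2.2.1)) = 1 := by
  set m : ℝ × (E × E × ℝ) →L[ℝ] E × ℝ := ((fst ℝ E _).comp (snd ℝ ℝ _)).prod (fst ℝ ℝ _)
  set dt : (E × ℝ) →L[ℝ] ℝ := snd ℝ E ℝ
  set p : ℝ × (E × E × ℝ) → (E × ℝ) →L[ℝ] ℝ := fun z ↦ (innerSL ℝ z.2.2.1).comp (fst ℝ E ℝ)
  have hp : ContDiff ℝ ∞ p := by
    have h1 : ContDiff ℝ ∞ fun z : ℝ × (E × E × ℝ) ↦ innerSL ℝ z.2.2.1 :=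
      (innerSL ℝ).contDiff.comp (by fun_prop)
    exact h1.clm_comp contDiff_const
  set Q := Ico 0 r ×ˢ Metric.ball (a, (0 : E), (0 : ℝ)) r
  have hm : ∀ z ∈ Q, m z ∈ halfSpace E ∩ Metric.ball (a, 0) r :=
    fun z hz ↦ mk_mem_halfSpace_inter_ball hz
  have hGm : ContDiffOn ℝ ∞ (fun z ↦ G (m z)) Q := hall.contDiffOn_comp
  set c₀ : ℝ × (E × E × ℝ) → ℝ := fun z ↦ dt (G (m z) dt)
  set c₁ : ℝ × (E × E × ℝ) → ℝ := fun z ↦ dt (G (m z) (p z))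
  set c₂ : ℝ × (E × E × ℝ) → ℝ := fun z ↦ p z (G (m z) (p z))
  have hc₀ : ContDiffOn ℝ ∞ c₀ Q := dt.contDiff.comp_contDiffOn (hGm.clm_apply contDiffOn_const)
  have hGp : ContDiffOn ℝ ∞ (fun z ↦ G (m z) (p z)) Q := hGm.clm_apply hp.contDiffOn
  have hc₁ : ContDiffOn ℝ ∞ c₁ Q := dt.contDiff.comp_contDiffOn hGp
  have hc₂ : ContDiffOn ℝ ∞ c₂ Q := hp.contDiffOn.clm_apply hGp
  -- With `A = 1 + t f` the eikonal equation reads `c₀ A² + 2 t c₁ A + t² c₂ = 1`; this is a quarter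
  -- of its discriminant.
  set disc : ℝ × (E × E × ℝ) → ℝ := fun z ↦ z.1 ^ 2 * c₁ z ^ 2 + c₀ z * (1 - z.1 ^ 2 * c₂ z)
  have ht : ContDiffOn ℝ ∞ (fun z : ℝ × (E × E × ℝ) ↦ z.1) Q := contDiff_fst.contDiffOn
  have hdisc : ContDiffOn ℝ ∞ disc Q :=
    ((ht.pow 2).mul (hc₁.pow 2)).add (hc₀.mul (contDiffOn_const.sub ((ht.pow 2).mul hc₂)))
  have hc₀_zero : ∀ z ∈ Q, z.1 = 0 → c₀ z = 1 := by
    intro z hz hz0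
    exact congrArg Prod.snd (hall.apply_snd (hm z hz) hz0)
  have hdisc_zero : ∀ z ∈ Q, z.1 = 0 → disc z = 1 := by
    intro z hz hz0
    simp [disc, hz0, hc₀_zero z hz hz0]
  have hz₀ : ((0 : ℝ), (a, (0 : E), (0 : ℝ))) ∈ Q := ⟨⟨le_rfl, hr⟩, Metric.mem_ball_self hr⟩
  have hev : ∀ᶠ z in 𝓝[Q] ((0 : ℝ), (a, (0 : E), (0 : ℝ))), 0 < c₀ z ∧ 0 < disc z :=
    ((hc₀.continuousOn _ hz₀).eventually_const_lt (by rw [hc₀_zero _ hz₀ rfl]; exact one_pos)).and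
      ((hdisc.continuousOn _ hz₀).eventually_const_lt
        (by rw [hdisc_zero _ hz₀ rfl]; exact one_pos))
  obtain ⟨η, hη, hball⟩ := Metric.mem_nhdsWithin_iff.1 hev
  set δ := min r η
  have hδ : 0 < δ := lt_min hr hη
  set Q' := Ico 0 δ ×ˢ Metric.ball (a, (0 : E), (0 : ℝ)) δ with hQ'
  have hQQ : Q' ⊆ Q := prod_mono (Ico_subset_Ico_right (min_le_left _ _))
    (Metric.ball_subset_ball (min_le_left _ _))
  have hpos : ∀ z ∈ Q', 0 < c₀ z ∧ 0 < disc z := by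
    intro z hz
    refine hball ⟨?_, hQQ hz⟩
    rw [← ball_prod_same]
    refine ⟨?_, Metric.ball_subset_ball (min_le_right _ _) hz.2⟩
    rw [Metric.mem_ball, Real.dist_0_eq_abs, abs_of_nonneg hz.1.1]
    exact hz.1.2.trans_le (min_le_right _ _)
  have hconv : Convex ℝ Q' := (convex_Ico 0 δ).prod (convex_ball _ _)
  have hint : (interior Q').Nonempty := by
    rw [hQ', interior_prod_eq, interior_Ico, Metric.isOpen_ball.interior_eq]
    exact (nonempty_Ioo.2 hδ).prod (Metric.nonempty_ball.2 hδ)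
  -- At `t = 0` the roots are `±1`; the sign is chosen so that `A = 1` there and `(A - 1) / t`
  -- extends smoothly.
  set A : ℝ × (E × E × ℝ) → ℝ := fun z ↦ (-(z.1 * c₁ z) + √(disc z)) / c₀ z
  have hA : ContDiffOn ℝ ∞ A Q' :=
    (((ht.mul hc₁).neg.mono hQQ).add ((hdisc.mono hQQ).sqrt fun z hz ↦ (hpos z hz).2.ne')).div
      (hc₀.mono hQQ) fun z hz ↦ (hpos z hz).1.ne'
  have hA_zero : ∀ z ∈ Q', z.1 = 0 → A z = 1 := by
    intro z hz hz0
    simp [A, hz0, hc₀_zero z (hQQ hz) hz0, hdisc_zero z (hQQ hz) hz0]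
  obtain ⟨k, hk, hkA⟩ := contDiffOn_hadamard hconv hint hA ((inr ℝ ℝ _).comp (snd ℝ ℝ _))
    (fun z hz ↦ ⟨⟨le_rfl, hδ⟩, hz.2⟩) (1, 0) (fst ℝ ℝ _) (fun z ↦ by ext <;> simp)
  -- Hadamard's quotient is not known to be independent of the last variable at `t = 0`, so that
  -- variable is set to zero before `k` is evaluated. `A` does not notice this.
  set q₀ : ℝ × (E × E × ℝ) →L[ℝ] ℝ × (E × E × ℝ) := (fst ℝ ℝ _).prod
    (((fst ℝ E _).comp (snd ℝ ℝ _)).prod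
      (((fst ℝ E ℝ).comp ((snd ℝ E _).comp (snd ℝ ℝ _))).prod 0))
  have hq₀ : MapsTo q₀ Q' Q' := by
    rintro ⟨t, y, q, ζ⟩ ⟨ht, hw⟩
    rw [← ball_prod_same, ← ball_prod_same] at hw
    refine ⟨ht, ?_⟩
    rw [← ball_prod_same, ← ball_prod_same]
    exact ⟨hw.1, hw.2.1, Metric.mem_ball_self hδ⟩
  refine ⟨δ, hδ, min_le_left _ _, fun z ↦ k (q₀ z), hk.comp q₀.contDiff.contDiffOn hq₀, fun z hz ↦ ⟨?_, ?_⟩⟩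
  · have h1 := (hk.differentiableOn (by simp) _ (hq₀ hz)).hasFDerivWithinAt.comp z
      q₀.hasFDerivWithinAt hq₀
    have h2 : fderivWithin ℝ (fun z ↦ k (q₀ z)) Q' z = _ :=
      h1.fderivWithin (uniqueDiffOn_convex hconv hint z hz)
    rw [h2]
    have h3 : q₀ (0, 0, 0, 1) = 0 := by simp [q₀]
    rw [ContinuousLinearMap.comp_apply, h3, map_zero]
  · have h1 := hkA _ (hq₀ hz)
    rw [hA_zero ((inr ℝ ℝ (E × E × ℝ)).comp (snd ℝ ℝ _) (q₀ z)) ⟨⟨le_rfl, hδ⟩, (hq₀ hz).2⟩ rfl] at h1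
    have h2 : 1 + z.1 * k (q₀ z) = A z := by
      have h3 : A (q₀ z) = A z := rfl
      have h4 : fst ℝ ℝ (E × E × ℝ) (q₀ z) = z.1 := rfl
      rw [h3, h4, smul_eq_mul] at h1
      linarith
    rw [h2]
    have hS : scaledCovector (A z) z.1 z.2.2.1 = A z • dt + z.1 • p z := rfl
    have hmz : (z.2.1, z.1) = m z := rfl
    have hcross : p z (G (m z) dt) = c₁ z := hall.apply_comm (hm z (hQQ hz)) _ _
    obtain ⟨hpos₀, hposd⟩ := hpos z hz
    have hsq := Real.sq_sqrt hposd.le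
    rw [hS, hmz]
    simp only [map_add, map_smul, add_apply, FunLike.coe_smul, Pi.smul_apply, smul_eq_mul, hcross]
    change A z * (A z * c₀ z + z.1 * c₁ z) + z.1 * (A z * c₁ z + z.1 * c₂ z) = 1
    have hAc : A z * c₀ z = -(z.1 * c₁ z) + √(disc z) := div_mul_cancel₀ _ hpos₀.ne'
    have hfin : c₀ z * (A z * (A z * c₀ z + z.1 * c₁ z) +
        z.1 * (A z * c₁ z + z.1 * c₂ z)) = c₀ z * 1 := by
      have h6 : c₀ z * (A z * (A z * c₀ z + z.1 * c₁ z) +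
        z.1 * (A z * c₁ z + z.1 * c₂ z)) = (A z * c₀ z) ^ 2 +
          2 * (z.1 * c₁ z) * (A z * c₀ z) + c₀ z * (z.1 ^ 2 * c₂ z) := by ring
      rw [h6, hAc]
      have h7 : disc z = z.1 ^ 2 * c₁ z ^ 2 + c₀ z * (1 - z.1 ^ 2 * c₂ z) := rfl
      nlinarith
    exact mul_left_cancel₀ hpos₀.ne' hfin

/-- The derivative of the Hamiltonian in the momentum is, up to sign, the slope of the vector dual
to the covector `dt + t dw`. -/
theorem IsInverseMetricOn.fderivWithin_momentum {G : E × ℝ → ((E × ℝ) →L[ℝ] ℝ) →L[ℝ] (E × ℝ)}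
    {r δ : ℝ} (hδ : 0 < δ) (hδr : δ ≤ r)
    (hall : IsInverseMetricOn γ G (halfSpace E ∩ Metric.ball (a, 0) r))
    {f : ℝ × (E × E × ℝ) → ℝ} (hf : ContDiffOn ℝ ∞ f (Ico 0 δ ×ˢ Metric.ball (a, 0, 0) δ))
    (hN : ∀ z ∈ Ico 0 δ ×ˢ Metric.ball (a, (0 : E), (0 : ℝ)) δ,
      scaledCovector (1 + z.1 * f z) z.1 z.2.2.1
          (G (z.2.1, z.1) (scaledCovector (1 + z.1 * f z) z.1 z.2.2.1)) = 1)
    {z : ℝ × (E × E × ℝ)} (hz : z ∈ Ico 0 δ ×ˢ Metric.ball (a, (0 : E), (0 : ℝ)) δ) (q : E) :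
    fderivWithin ℝ f (Ico 0 δ ×ˢ Metric.ball (a, 0, 0) δ) z (0, 0, q, 0) *
      (G (z.2.1, z.1) (scaledCovector (1 + z.1 * f z) z.1 z.2.2.1)).2 +
      inner ℝ q (G (z.2.1, z.1) (scaledCovector (1 + z.1 * f z) z.1 z.2.2.1)).1 = 0 := by
  set Q := Ico 0 δ ×ˢ Metric.ball (a, (0 : E), (0 : ℝ)) δ with hQ
  have hQu : UniqueDiffOn ℝ Q :=
    (uniqueDiffOn_convex (convex_Ico 0 δ) (by rw [interior_Ico]; exact nonempty_Ioo.2 hδ)).prod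
      Metric.isOpen_ball.uniqueDiffOn
  set α : ℝ × (E × E × ℝ) → (E × ℝ) →L[ℝ] ℝ := fun z ↦ scaledCovector (1 + z.1 * f z) z.1 z.2.2.1
  set X : ℝ × (E × E × ℝ) → E × ℝ := fun z ↦ G (z.2.1, z.1) (α z)
  have hsub : Q ⊆ Ico 0 r ×ˢ Metric.ball (a, (0 : E), (0 : ℝ)) r := prod_mono
    (Ico_subset_Ico_right hδr) (Metric.ball_subset_ball hδr)
  have hpos : ∀ z ∈ Q, 0 < z.1 → fderivWithin ℝ f Q z (0, 0, q, 0) * (X z).2 +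
      inner ℝ q (X z).1 = 0 := by
    -- Differentiate the eikonal equation along the line `z + ε q` in the momentum variable.
    -- Symmetry of the inverse metric makes the two terms of the product rule equal, and the common
    -- factor `t` is cancelled.
    intro z hz hz1
    set c : ℝ → ℝ × (E × E × ℝ) := fun ε ↦ z + ε • (0, 0, q, 0) with hc
    have hc0 : c 0 = z := by simp [c]
    have hcd : HasDerivAt c (0, 0, q, 0) 0 := by
      have h1 := ((hasDerivAt_id (0 : ℝ)).smul_const ((0 : ℝ), (0 : E), q, (0 : ℝ))).const_add z
      rw [one_smul] at h1
      exact h1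
    have hcQ : ∀ᶠ ε in 𝓝 (0 : ℝ), c ε ∈ Q := by
      have h1 : ContinuousAt (fun ε ↦ (c ε).2) 0 := (continuous_snd.continuousAt).comp hcd.continuousAt
      have h2 := h1.eventually_mem (Metric.isOpen_ball.mem_nhds (by rw [hc0]; exact hz.2))
      filter_upwards [h2] with ε hε
      refine ⟨?_, hε⟩
      simpa [c] using hz.1
    set D := fderivWithin ℝ f Q z (0, 0, q, 0)
    have hfc : HasDerivAt (fun ε ↦ f (c ε)) D 0 := by
      have h1 := (hf.differentiableOn (by simp) z hz).hasFDerivWithinAt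
      rw [← hc0] at h1
      have h2 := h1.comp_hasDerivWithinAt 0 (hcd.hasDerivWithinAt (s := c ⁻¹' Q)) fun _ h ↦ h
      rw [hc0] at h2
      exact h2.hasDerivAt hcQ
    have hαc : HasDerivAt (fun ε ↦ α (c ε)) (scaledCovector (z.1 * D) z.1 q) 0 := by
      have h1 : HasDerivAt (fun ε : ℝ ↦ innerSL ℝ (z.2.2.1 + ε • q)) (innerSL ℝ q) 0 := by
        have h2 : HasDerivAt (fun ε : ℝ ↦ z.2.2.1 + ε • q) q 0 := by
          simpa using ((hasDerivAt_id (0 : ℝ)).smul_const q).const_add z.2.2.1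
        exact (innerSL ℝ).hasFDerivAt.comp_hasDerivAt 0 h2
      have h3 := (h1.clm_comp (hasDerivAt_const (0 : ℝ) (fst ℝ E ℝ))).const_smul z.1
      have h4 := ((hfc.const_mul z.1).const_add 1).smul_const (snd ℝ E ℝ)
      have h5 := h4.add h3
      have h6 : (fun ε ↦ α (c ε)) = (fun ε ↦ (1 + z.1 * f (c ε)) • snd ℝ E ℝ) +
          z.1 • fun ε : ℝ ↦ (innerSL ℝ (z.2.2.1 + ε • q)).comp (fst ℝ E ℝ) := by
        funext ε
        simp [α, scaledCovector, c]
      rw [h6]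
      refine h5.congr_deriv ?_
      simp [scaledCovector]
    have hG1 : HasDerivAt (fun ε ↦ α (c ε) (G (z.2.1, z.1) (α (c ε))))
        (scaledCovector (z.1 * D) z.1 q (X z) + α z (G (z.2.1, z.1) (scaledCovector (z.1 * D) z.1 q)))
        0 := by
      have h1 := (G (z.2.1, z.1)).hasFDerivAt.comp_hasDerivAt 0 hαc
      have h2 := hαc.clm_apply h1
      simpa only [Function.comp_apply, hc0] using h2
    have hG2 : HasDerivAt (fun ε ↦ α (c ε) (G (z.2.1, z.1) (α (c ε)))) 0 0 := by
      refine (hasDerivAt_const (0 : ℝ) (1 : ℝ)).congr_of_eventuallyEq ?_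
      filter_upwards [hcQ] with ε hε
      have h1 := hN _ hε
      have h2 : ((c ε).2.1, (c ε).1) = (z.2.1, z.1) := by simp [c]
      rwa [h2] at h1
    have h1 := hG1.unique hG2
    rw [hall.apply_comm (mk_mem_halfSpace_inter_ball (hsub hz)) (α z)] at h1
    change scaledCovector (z.1 * D) z.1 q (X z) + scaledCovector (z.1 * D) z.1 q (X z) = 0 at h1
    rw [scaledCovector_apply] at h1
    have h2 : z.1 * (D * (X z).2 + inner ℝ q (X z).1) = 0 := by linarith
    exact (mul_eq_zero.1 h2).resolve_left hz1.ne'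
  rcases hz.1.1.eq_or_lt with h0 | h0
  swap
  · exact hpos z hz h0
  -- At `t = 0` the factor cannot be cancelled; the identity extends there by continuity from `t >
  -- 0`.
  have hαs : ContDiffOn ℝ ∞ α Q := by
    have h1 : ContDiff ℝ ∞ fun z : ℝ × (E × E × ℝ) ↦ innerSL ℝ z.2.2.1 :=
      (innerSL ℝ).contDiff.comp (by fun_prop)
    exact ((contDiffOn_const.add (contDiff_fst.contDiffOn.mul hf)).smul contDiffOn_const).add
      (contDiff_fst.contDiffOn.smul (h1.clm_comp contDiff_const).contDiffOn)
  have hXs : ContDiffOn ℝ ∞ X Q := (hall.contDiffOn_comp.mono hsub).clm_apply hαs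
  have hf' := ((contDiffOn_infty_iff_fderivWithin hQu).1 hf).2
  have hcont : ContinuousOn (fun z ↦ fderivWithin ℝ f Q z (0, 0, q, 0) * (X z).2 +
      inner ℝ q (X z).1) Q :=
    ((hf'.continuousOn.clm_apply continuousOn_const).mul hXs.continuousOn.snd).add
      (continuousOn_const.inner hXs.continuousOn.fst)
  have hlim : Tendsto (fun t : ℝ ↦ (t, z.2)) (𝓝[>] 0) (𝓝[Q] z) := by
    refine tendsto_nhdsWithin_iff.2 ⟨?_, ?_⟩
    · have h1 : Tendsto (fun t : ℝ ↦ (t, z.2)) (𝓝 0) (𝓝 (0, z.2)) :=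
        (continuous_id.prodMk continuous_const).tendsto 0
      have h2 : ((0 : ℝ), z.2) = z := by rw [h0]
      rw [h2] at h1
      exact h1.mono_left nhdsWithin_le_nhds
    · filter_upwards [Ioo_mem_nhdsGT hδ] with t ht using ⟨⟨ht.1.le, ht.2⟩, hz.2⟩
  have hlim' := (hcont z hz).tendsto.comp hlim
  refine tendsto_nhds_unique (hlim'.congr' ?_) tendsto_const_nhds
  filter_upwards [Ioo_mem_nhdsGT hδ] with t ht
  exact hpos (t, z.2) ⟨⟨ht.1.le, ht.2⟩, hz.2⟩ ht.1

/-- Local existence of a normal form near a boundary point. -/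
theorem IsBoundaryMetric.exists_isNormalAt (h : IsBoundaryMetric γ a) :
    ∃ w b, ∀ᶠ z in 𝓝[halfSpace E] (a, 0), IsNormalAt γ w b z := by
  obtain ⟨G, r, hr, hall⟩ := h.exists_isInverseMetricOn
  obtain ⟨δ, hδ, hδr, f, hf, hfz⟩ := hall.exists_hamiltonian hr
  obtain ⟨r', hr', w, b, p, hw, hb, hp, hs⟩ := exists_hamiltonJacobi hδ hf fun z hz ↦ (hfz z hz).1
  refine ⟨w, b, eventually_halfSpace_iff.2 ⟨r', hr', fun s hsT ↦ ?_⟩⟩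
  obtain ⟨hQ, hbd, hdw, hdb⟩ := hs s hsT
  have hnhds : Metric.ball (a, (0 : ℝ)) r' ∈ 𝓝 s := Metric.isOpen_ball.mem_nhds hsT.2
  have hin : halfSpace E ∩ Metric.ball (a, (0 : ℝ)) r' ∈ 𝓝[halfSpace E] s :=
    inter_mem_nhdsWithin _ hnhds
  rw [fderivWithin_inter hnhds] at hdw hdb
  set z : ℝ × (E × E × ℝ) := (s.2, s.1, p s, w s)
  set α := scaledCovector (1 + z.1 * f z) z.1 z.2.2.1
  have hzs : (z.2.1, z.1) = s := rfl
  have hα : ∀ d, α d = d.2 + s.2 * fderivWithin ℝ w (halfSpace E) s d := by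
    intro d
    rw [hdw d, scaledCovector_apply]
    simp only [z]
    ring
  have hsr : s ∈ halfSpace E ∩ Metric.ball (a, 0) r := by
    have := mk_mem_halfSpace_inter_ball hQ
    exact ⟨this.1, Metric.ball_subset_ball hδr this.2⟩
  set X := G s α
  have hX1 : α X = 1 := (hfz z hQ).2
  have hmom : ∀ q, fderivWithin ℝ f (Ico 0 δ ×ˢ Metric.ball (a, 0, 0) δ) z (0, 0, q, 0) * X.2 +
      inner ℝ q X.1 = 0 :=
    fun q ↦ hall.fderivWithin_momentum hδ hδr hf (fun z hz ↦ (hfz z hz).2) hQ q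
  -- If the gradient were tangent to the level of `t`, the momentum identity with `q = X.1` would
  -- force `X = 0`, contradicting `α X = 1`.
  have hX2 : X.2 ≠ 0 := by
    intro h0
    have h1 := hmom X.1
    rw [h0, mul_zero, zero_add, inner_self_eq_zero] at h1
    have h2 : X = 0 := Prod.ext h1 h0
    rw [h2, map_zero] at hX1
    exact zero_ne_one hX1
  have hT : ((X.2)⁻¹ • X.1, (1 : ℝ)) = (X.2)⁻¹ • X := by
    ext
    · rfl
    · simp [hX2]
  refine ⟨(hw s hsT).mono_of_mem_nhdsWithin hin, (hb s hsT).mono_of_mem_nhdsWithin hin, hbd,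
    ((X.2)⁻¹ • X.1, 1), rfl, hdb _ fun q ↦ ?_, fun d ↦ ?_⟩
  · have h1 := hmom q
    rw [inner_smul_left, conj_trivial, real_inner_comm]
    field_simp
    linarith
  · have h1 := hα ((X.2)⁻¹ • X.1, 1)
    simp only at h1
    rw [← hα d, ← h1, hT, map_smul, map_smul, hX1, smul_apply, hall.right_inv s hsr]
    simp

end Eikonal

/-! ### Uniqueness for a transport equation transverse to the boundary -/

section Transport

open scoped NNReal

/-- A Picard–Lindelöf solution staying in the ball on which the vector field is controlled. -/
theorem IsPicardLindelof.exists_solution_mem_closedBall {E : Type*} [NormedAddCommGroup E]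
    [NormedSpace ℝ E] [CompleteSpace E] {f : ℝ → E → E} {tmin tmax : ℝ} {t₀ : Icc tmin tmax}
    {x₀ : E} {a L K : ℝ≥0} (hf : IsPicardLindelof f t₀ x₀ a 0 L K) :
    ∃ α : ℝ → E, α t₀ = x₀ ∧ (∀ t, α t ∈ Metric.closedBall x₀ a) ∧
      ∀ t ∈ Icc tmin tmax, HasDerivWithinAt α (f t (α t)) (Icc tmin tmax) t := by
  have hx : x₀ ∈ Metric.closedBall x₀ ((0 : ℝ≥0) : ℝ) := Metric.mem_closedBall_self le_rfl
  obtain ⟨α, hα⟩ := ODE.FunSpace.exists_isFixedPt_next hf hx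
  refine ⟨α.compProj, by rw [ODE.FunSpace.compProj_val, ← hα, ODE.FunSpace.next_apply₀],
    fun t ↦ α.compProj_mem_closedBall hf.mul_max_le, fun t ht ↦ ?_⟩
  apply ODE.hasDerivWithinAt_picard_Icc t₀.2 hf.continuousOn_uncurry
    α.continuous_compProj.continuousOn (fun _ ht' ↦ α.compProj_mem_closedBall hf.mul_max_le)
    x₀ ht |>.congr_of_mem _ ht
  intro t' ht'
  nth_rw 1 [← hα]
  rw [ODE.FunSpace.compProj_of_mem ht', ODE.FunSpace.next_apply]

variable {E F : Type*} [NormedAddCommGroup E] [NormedSpace ℝ E] [CompleteSpace E]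
  [NormedAddCommGroup F] [NormedSpace ℝ F]

/-- A function which vanishes on the boundary and is constant along a vector field transverse to
the boundary vanishes near the boundary. -/
theorem eventually_eq_zero_of_transport {a : E} {v : E × ℝ → E} {w : E × ℝ → F}
    (hv : ContDiffWithinAt ℝ 1 v (halfSpace E) (a, 0))
    (hw : ∀ᶠ z in 𝓝[halfSpace E] (a, 0), DifferentiableWithinAt ℝ w (halfSpace E) z ∧
      (z.2 = 0 → w z = 0) ∧ (0 < z.2 → fderivWithin ℝ w (halfSpace E) z (v z, 1) = 0)) :
    ∀ᶠ z in 𝓝[halfSpace E] (a, 0), w z = 0 := by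
  obtain ⟨K, t, ht, hK⟩ := hv.exists_lipschitzOnWith convex_halfSpace
  have hbd : ∀ᶠ z in 𝓝[halfSpace E] (a, 0), ‖v z‖ < ‖v (a, 0)‖ + 1 :=
    hv.continuousWithinAt.norm.eventually_lt_const (lt_add_one _)
  obtain ⟨r, hr, hall⟩ := eventually_halfSpace_iff.1
    (hw.and (hbd.and (eventually_mem_set.2 ht)))
  set M := ‖v (a, 0)‖ + 1
  have hM : 0 < M := by positivity
  set ρ := r / 3
  have hρ : 0 < ρ := by positivity
  have hmem : ∀ e t, dist e a ≤ 2 * ρ → 0 ≤ t → t < ρ →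
      (e, t) ∈ halfSpace E ∩ Metric.ball (a, 0) r := by
    intro e t he h0 h1
    refine ⟨h0, ?_⟩
    rw [← ball_prod_same]
    refine ⟨?_, ?_⟩
    · simp only [Metric.mem_ball]
      exact he.trans_lt (by simp only [ρ]; linarith)
    · rw [Metric.mem_ball, Real.dist_0_eq_abs]
      change |t| < r
      rw [abs_of_nonneg h0]
      exact h1.trans (by simp only [ρ]; linarith)
  -- The integral curve is run backwards from `(e₁, t₁)` to time zero. Its speed is at most `M` and
  -- `t₁ < ρ / M`, so it stays within `ρ` of `e₁`, hence within `2ρ < r` of `a`.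
  refine eventually_halfSpace_iff.2 ⟨min ρ (ρ / M), lt_min hρ (by positivity), ?_⟩
  rintro ⟨e₁, t₁⟩ ⟨h0, hz⟩
  rw [← ball_prod_same] at hz
  have ht₀ : 0 ≤ t₁ := h0
  have he₁ : dist e₁ a < ρ := (Metric.mem_ball.1 hz.1).trans_le (min_le_left _ _)
  have ht₁ : t₁ < min ρ (ρ / M) := by
    have := hz.2
    rw [Metric.mem_ball, Real.dist_0_eq_abs] at this
    exact (le_abs_self _).trans_lt this
  have hball : ∀ e ∈ Metric.closedBall e₁ ρ, ∀ t ∈ Icc 0 t₁,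
      (e, t) ∈ halfSpace E ∩ Metric.ball (a, 0) r := by
    intro e he t ht
    refine hmem e t ?_ ht.1 (ht.2.trans_lt (ht₁.trans_le (min_le_left _ _)))
    have := dist_triangle e e₁ a
    rw [Metric.mem_closedBall] at he
    linarith
  have hPL : IsPicardLindelof (fun t e ↦ v (e, t)) (⟨t₁, ht₀, le_rfl⟩ : Icc 0 t₁) e₁
      ⟨ρ, hρ.le⟩ 0 ⟨M, hM.le⟩ K := by
    refine ⟨fun t ht ↦ LipschitzOnWith.of_dist_le_mul fun e he e' he' ↦ ?_, fun e he ↦ ?_,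
      fun t ht e he ↦ (hall _ (hball e he t ht)).2.1.le, ?_⟩
    · have h1 := hK.dist_le_mul _ (hall _ (hball e he t ht)).2.2 _ (hall _ (hball e' he' t ht)).2.2
      simpa using h1
    · refine hK.continuousOn.comp (Continuous.continuousOn (by fun_prop))
        fun t ht ↦ (hall _ (hball e he t ht)).2.2
    · have h1 : t₁ * M ≤ ρ := by
        rw [← le_div_iff₀ hM]
        exact (ht₁.trans_le (min_le_right _ _)).le
      change M * max (t₁ - t₁) (t₁ - 0) ≤ ρ - 0
      rw [sub_self, sub_zero, sub_zero, max_eq_right ht₀]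
      linarith
  obtain ⟨α, hα₁, hαball, hα⟩ := hPL.exists_solution_mem_closedBall
  simp only at hα₁
  rcases ht₀.eq_or_lt with rfl | hpos
  · exact (hall _ (hball e₁ (Metric.mem_closedBall_self hρ.le) 0 ⟨le_rfl, le_rfl⟩)).1.2.1 rfl
  set φ : ℝ → F := fun t ↦ w (α t, t)
  have hcurve : MapsTo (fun t ↦ (α t, t)) (Icc 0 t₁) (halfSpace E) := fun t ht ↦ ht.1
  have hφ : ∀ t ∈ Icc 0 t₁, HasDerivWithinAt φ
      (fderivWithin ℝ w (halfSpace E) (α t, t) (v (α t, t), 1)) (Icc 0 t₁) t := by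
    intro t ht
    exact ((hall _ (hball _ (hαball t) t ht)).1.1.hasFDerivWithinAt).comp_hasDerivWithinAt
      (f := fun t ↦ (α t, t)) t ((hα t ht).prodMk (hasDerivWithinAt_id t _)) hcurve
  have hcont : ContinuousOn φ (Icc 0 t₁) := fun t ht ↦ (hφ t ht).continuousWithinAt
  -- The transport equation is assumed only at positive times, so constancy is obtained on `(0, t₁]`
  -- and compared with the boundary value by continuity.
  have hconst : ∀ s ∈ Ioo 0 t₁, φ s = φ t₁ := by
    intro s hs
    refine (constant_of_has_deriv_right_zero (hcont.mono (Icc_subset_Icc_left hs.1.le))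
      (fun t ht ↦ ?_) t₁ ⟨hs.2.le, le_rfl⟩).symm
    have ht' : t ∈ Icc 0 t₁ := ⟨hs.1.le.trans ht.1, ht.2.le⟩
    have h1 := hφ t ht'
    rw [(hall _ (hball _ (hαball t) t ht')).1.2.2 (hs.1.trans_le ht.1)] at h1
    exact h1.mono_of_mem_nhdsWithin (Icc_mem_nhdsGE_of_mem ⟨ht'.1, ht.2⟩)
  have hzero : φ 0 = 0 :=
    (hall _ (hball _ (hαball 0) 0 ⟨le_rfl, ht₀⟩)).1.2.1 rfl
  have hlim : Tendsto φ (𝓝[>] 0) (𝓝 0) := by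
    rw [← hzero]
    exact (hcont 0 ⟨le_rfl, ht₀⟩).mono_of_mem_nhdsWithin
      (mem_of_superset (Ioo_mem_nhdsGT hpos) Ioo_subset_Icc_self)
  have hlim' : Tendsto φ (𝓝[>] 0) (𝓝 (φ t₁)) := by
    refine tendsto_const_nhds.congr' ?_
    filter_upwards [Ioo_mem_nhdsGT hpos] with s hs using (hconst s hs).symm
  have h1 := tendsto_nhds_unique hlim' hlim
  simp only [φ, hα₁] at h1
  exact h1

end Transport

/-! ### Uniqueness of the normal form and invertibility of the coordinate change -/

section NormalUnique

open ContinuousLinearMap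

set_option maxSynthPendingDepth 3

variable {E : Type} [NormedAddCommGroup E] [InnerProductSpace ℝ E] [FiniteDimensional ℝ E]
  {γ : E × ℝ → (E × ℝ) →L[ℝ] (E × ℝ) →L[ℝ] ℝ} {a : E}

/-- The covector `dt + t dw`. -/
def normalCovector (w : E × ℝ → ℝ) (z : E × ℝ) : (E × ℝ) →L[ℝ] ℝ :=
  snd ℝ E ℝ + z.2 • fderivWithin ℝ w (halfSpace E) z

theorem normalCovector_apply (w : E × ℝ → ℝ) (z d : E × ℝ) :
    normalCovector w z d = d.2 + z.2 * fderivWithin ℝ w (halfSpace E) z d := rfl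

theorem contDiffWithinAt_normalCovector {w : E × ℝ → ℝ} {z : E × ℝ} (hz : z ∈ halfSpace E)
    (hw : ContDiffWithinAt ℝ ∞ w (halfSpace E) z) :
    ContDiffWithinAt ℝ ∞ (normalCovector w) (halfSpace E) z := by
  have h1 : ContDiffWithinAt ℝ ∞ (fderivWithin ℝ w (halfSpace E)) (halfSpace E) z :=
    hw.fderivWithin_right uniqueDiffOn_halfSpace (by simp) hz
  exact contDiffWithinAt_const.add (contDiffWithinAt_snd.smul h1)

/-- The vector dual to `dt + t dw` is a unit vector, and is proportional to the vector annihilated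
by `db`. -/
theorem IsNormalAt.inverse_normalCovector {w : E × ℝ → ℝ} {b : E × ℝ → E} {z : E × ℝ}
    {G : E × ℝ → ((E × ℝ) →L[ℝ] ℝ) →L[ℝ] (E × ℝ)} {s : Set (E × ℝ)}
    (hG : IsInverseMetricOn γ G s) (hz : z ∈ s) (h : IsNormalAt γ w b z) :
    normalCovector w z (G z (normalCovector w z)) = 1 ∧
      (G z (normalCovector w z)).2 ≠ 0 ∧
      fderivWithin ℝ b (halfSpace E) z (G z (normalCovector w z)) = 0 := by
  obtain ⟨-, -, -, T, hT, hbT, hγ⟩ := h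
  set α := normalCovector w z with hα
  have h1 : γ z T = α T • α := by
    refine ContinuousLinearMap.ext fun d ↦ ?_
    rw [hγ d, smul_apply, smul_eq_mul, hα, normalCovector_apply, normalCovector_apply, hT]
  have h2 : T = α T • G z α := by
    rw [← map_smul, ← h1, hG.left_inv z hz]
  have h3 : α T * (G z α).2 = 1 := by
    rw [← hT]
    exact (congrArg Prod.snd h2).symm
  have hne : α T ≠ 0 := left_ne_zero_of_mul_eq_one h3
  refine ⟨?_, right_ne_zero_of_mul_eq_one h3, ?_⟩
  · have h4 : α T = α T * α (G z α) := by
      nth_rw 1 [h2]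
      rw [map_smul, smul_eq_mul]
    exact (mul_right_inj' hne).1 (by rw [← h4, mul_one])
  · rw [h2, map_smul] at hbT
    exact (smul_eq_zero.1 hbT).resolve_left hne

theorem normalCovector_of_snd_eq_zero (w : E × ℝ → ℝ) {z : E × ℝ} (hz : z.2 = 0) :
    normalCovector w z = snd ℝ E ℝ := by
  rw [normalCovector, hz, zero_smul, add_zero]

theorem contDiffWithinAt_div_snd {s : Set (E × ℝ)} {z : E × ℝ} {V : E × ℝ → E × ℝ}
    (hV : ContDiffWithinAt ℝ ∞ V s z) (h0 : (V z).2 ≠ 0) :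
    ContDiffWithinAt ℝ 1 (fun z ↦ ((V z).2)⁻¹ • (V z).1) s z :=
  (((contDiff_snd.contDiffAt.comp_contDiffWithinAt z hV).inv h0).smul
    (contDiff_fst.contDiffAt.comp_contDiffWithinAt z hV)).of_le (by simp)

theorem mk_inv_smul_eq {V : E × ℝ} (h0 : V.2 ≠ 0) : ((V.2)⁻¹ • V.1, (1 : ℝ)) = (V.2)⁻¹ • V :=
  Prod.ext rfl (by simp [h0])

/-- Both covectors `α₁`, `α₂` have length one, so `α₁ - α₂ = t (dw₁ - dw₂)` annihilates the vector
dual to `α₁ + α₂`, which is transverse to the boundary. Hence `w₁ - w₂` is transported from its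
boundary value zero. Once `w₁ = w₂`, both `b₁` and `b₂` are constant along the same gradient. -/
theorem IsBoundaryMetric.isNormalAt_unique (h : IsBoundaryMetric γ a) {w₁ w₂ : E × ℝ → ℝ}
    {b₁ b₂ : E × ℝ → E} (h₁ : ∀ᶠ z in 𝓝[halfSpace E] (a, 0), IsNormalAt γ w₁ b₁ z)
    (h₂ : ∀ᶠ z in 𝓝[halfSpace E] (a, 0), IsNormalAt γ w₂ b₂ z) :
    ∀ᶠ z in 𝓝[halfSpace E] (a, 0), w₁ z = w₂ z ∧ b₁ z = b₂ z := by
  obtain ⟨G, r, hr, hG⟩ := h.exists_isInverseMetricOn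
  have hball : ∀ᶠ z in 𝓝[halfSpace E] (a, 0), z ∈ halfSpace E ∩ Metric.ball (a, 0) r :=
    eventually_halfSpace_iff.2 ⟨r, hr, fun z hz ↦ hz⟩
  have ha : (a, (0 : ℝ)) ∈ halfSpace E := mk_zero_mem_halfSpace a
  have haG := hball.self_of_nhdsWithin ha
  have hX : ∀ {w : E × ℝ → ℝ} {b : E × ℝ → E}, (∀ᶠ z in 𝓝[halfSpace E] (a, 0), IsNormalAt γ w b z) →
      ContDiffWithinAt ℝ ∞ (fun z ↦ G z (normalCovector w z)) (halfSpace E) (a, 0) ∧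
      (G (a, 0) (normalCovector w (a, 0))).2 = 1 := by
    intro w b hw
    refine ⟨(hG.smooth _ haG).clm_apply
      (contDiffWithinAt_normalCovector ha (hw.self_of_nhdsWithin ha).1), ?_⟩
    rw [normalCovector_of_snd_eq_zero w rfl, hG.apply_snd haG rfl]
  have hw : ∀ᶠ z in 𝓝[halfSpace E] (a, 0), w₁ z = w₂ z := by
    have hV := (hX h₁).1.add (hX h₂).1
    have hV0 : (G (a, 0) (normalCovector w₁ (a, 0)) + G (a, 0) (normalCovector w₂ (a, 0))).2 ≠ 0 := by
      rw [Prod.snd_add, (hX h₁).2, (hX h₂).2]; norm_num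
    have hne := (continuous_snd.continuousAt.comp_continuousWithinAt
      hV.continuousWithinAt).eventually_ne hV0
    have hmain := eventually_eq_zero_of_transport (w := w₁ - w₂) (contDiffWithinAt_div_snd hV hV0) ?_
    · exact hmain.mono fun z hz ↦ sub_eq_zero.1 hz
    filter_upwards [h₁, h₂, hne, hball] with z hz₁ hz₂ hz0 hz
    have hd₁ := hz₁.1.differentiableWithinAt (by simp)
    have hd₂ := hz₂.1.differentiableWithinAt (by simp)
    refine ⟨hd₁.sub hd₂, fun h0 ↦ ?_, fun hpos ↦ ?_⟩
    · rw [Pi.sub_apply, (hz₁.2.2.1 h0).1, (hz₂.2.2.1 h0).1, sub_zero]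
    rw [mk_inv_smul_eq hz0, map_smul, fderivWithin_sub (uniqueDiffOn_halfSpace z hz.1) hd₁ hd₂]
    have e₁ := (hz₁.inverse_normalCovector hG hz).1
    have e₂ := (hz₂.inverse_normalCovector hG hz).1
    have e₃ := hG.apply_comm hz (normalCovector w₁ z) (normalCovector w₂ z)
    -- The identity `(α₁ - α₂)(α₁ + α₂) = α₁² - α₂²` for the symmetric inverse metric.
    have e₄ : (normalCovector w₁ z - normalCovector w₂ z)
        (G z (normalCovector w₁ z) + G z (normalCovector w₂ z)) = 0 := by
      rw [sub_apply, map_add, map_add]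
      linarith
    have e₅ : normalCovector w₁ z - normalCovector w₂ z = z.2 •
        (fderivWithin ℝ w₁ (halfSpace E) z - fderivWithin ℝ w₂ (halfSpace E) z) := by
      rw [normalCovector, normalCovector, smul_sub]; abel
    rw [e₅, smul_apply, smul_eq_mul] at e₄
    have e₆ := (mul_eq_zero.1 e₄).resolve_left hpos.ne'
    exact (congrArg _ e₆).trans (smul_zero _)
  have hb : ∀ᶠ z in 𝓝[halfSpace E] (a, 0), b₁ z = b₂ z := by
    have hV := (hX h₁).1
    have hV0 : (G (a, 0) (normalCovector w₁ (a, 0))).2 ≠ 0 := by rw [(hX h₁).2]; norm_num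
    have hne := (continuous_snd.continuousAt.comp_continuousWithinAt
      hV.continuousWithinAt).eventually_ne hV0
    have hmain := eventually_eq_zero_of_transport (w := b₁ - b₂) (contDiffWithinAt_div_snd hV hV0) ?_
    · exact hmain.mono fun z hz ↦ sub_eq_zero.1 hz
    filter_upwards [h₁, h₂, hne, hball, eventually_eventually_nhdsWithin.2 hw] with z hz₁ hz₂ hz0 hz hww
    have hd₁ := hz₁.2.1.differentiableWithinAt (by simp)
    have hd₂ := hz₂.2.1.differentiableWithinAt (by simp)
    refine ⟨hd₁.sub hd₂, fun h0 ↦ ?_, fun hpos ↦ ?_⟩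
    · rw [Pi.sub_apply, (hz₁.2.2.1 h0).2, (hz₂.2.2.1 h0).2, sub_self]
    rw [mk_inv_smul_eq hz0, map_smul, fderivWithin_sub (uniqueDiffOn_halfSpace z hz.1) hd₁ hd₂]
    have e₀ : normalCovector w₁ z = normalCovector w₂ z := by
      rw [normalCovector, normalCovector, Filter.EventuallyEq.fderivWithin_eq hww
        (hww.self_of_nhdsWithin hz.1)]
    have e₁ := (hz₁.inverse_normalCovector hG hz).2.2
    have e₂ := (hz₂.inverse_normalCovector hG hz).2.2
    simp only [sub_apply, e₁]
    rw [e₀, e₂, sub_zero, smul_zero]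
  exact hw.and hb

/-- At the boundary the differential of `b` is the projection to `E`. -/
theorem IsNormalAt.fderivWithin_boundary (h : IsBoundaryMetric γ a) {w : E × ℝ → ℝ}
    {b : E × ℝ → E} (hz : ∀ᶠ z in 𝓝[halfSpace E] (a, 0), IsNormalAt γ w b z) :
    fderivWithin ℝ b (halfSpace E) (a, 0) = fst ℝ E ℝ := by
  obtain ⟨G, r, hr, hG⟩ := h.exists_isInverseMetricOn
  have ha : (a, (0 : ℝ)) ∈ halfSpace E := mk_zero_mem_halfSpace a
  have haG : (a, (0 : ℝ)) ∈ halfSpace E ∩ Metric.ball (a, 0) r := ⟨ha, Metric.mem_ball_self hr⟩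
  have h0 := hz.self_of_nhdsWithin ha
  have h1 := (h0.inverse_normalCovector hG haG).2.2
  rw [normalCovector_of_snd_eq_zero w rfl, hG.apply_snd haG rfl] at h1
  have hd := (h0.2.1.differentiableWithinAt (by simp)).hasFDerivWithinAt
  have hι : HasFDerivWithinAt (fun e : E ↦ (e, (0 : ℝ))) (inl ℝ E ℝ) univ a :=
    (hasFDerivAt_prodMk_left a (0 : ℝ)).hasFDerivWithinAt
  have hcomp := hd.comp a hι fun e _ ↦ mk_zero_mem_halfSpace e
  obtain ⟨ρ, hρ, hall⟩ := eventually_halfSpace_iff.1 hz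
  have hev : (b ∘ fun e : E ↦ (e, (0 : ℝ))) =ᶠ[𝓝 a] id := by
    filter_upwards [Metric.ball_mem_nhds a hρ] with e he
    refine ((hall (e, 0) ⟨mk_zero_mem_halfSpace e, ?_⟩).2.2.1 rfl).2
    rw [← ball_prod_same]
    exact ⟨he, Metric.mem_ball_self hρ⟩
  have h2 := ((hasFDerivWithinAt_univ.1 hcomp).congr_of_eventuallyEq hev.symm).unique (hasFDerivAt_id a)
  refine ContinuousLinearMap.ext fun d ↦ ?_
  have h3 : d = (d.1, (0 : ℝ)) + d.2 • ((0 : E), (1 : ℝ)) := Prod.ext (by simp) (by simp)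
  have h4 := DFunLike.congr_fun h2 d.1
  simp only [comp_apply, inl_apply, id_apply] at h4
  rw [h3, map_add, map_smul, h1, h4]
  simp

/-- The coordinate change `(y, t) ↦ (b, t exp w)` is invertible near the boundary. -/
theorem IsBoundaryMetric.exists_local_inverse (h : IsBoundaryMetric γ a) {w : E × ℝ → ℝ}
    {b : E × ℝ → E} (hz : ∀ᶠ z in 𝓝[halfSpace E] (a, 0), IsNormalAt γ w b z) :
    ∃ Ξ : E × ℝ → E × ℝ, (∀ᶠ c in 𝓝[halfSpace E] (a, 0), ContDiffWithinAt ℝ ∞ Ξ (halfSpace E) c ∧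
        Ξ c ∈ halfSpace E ∧ b (Ξ c) = c.1 ∧ (Ξ c).2 * Real.exp (w (Ξ c)) = c.2) ∧ Ξ (a, 0) = (a, 0) ∧
      ∀ᶠ z in 𝓝[halfSpace E] (a, 0), Ξ (b z, z.2 * Real.exp (w z)) = z := by
  have ha : (a, (0 : ℝ)) ∈ halfSpace E := mk_zero_mem_halfSpace a
  obtain ⟨ρ, hρ, hall⟩ := eventually_halfSpace_iff.1 hz
  -- A fixed point `z` of `Φ (c, ·)` is a preimage of `c` under the coordinate change. The second
  -- component is nonnegative automatically, so the half-space is preserved. At the base point the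
  -- derivative in `z` vanishes because `db` is the projection and `c.2 = 0`.
  set Φ : (E × ℝ) × (E × ℝ) → E × ℝ := fun q ↦
    (q.1.1 - (b q.2 - q.2.1), q.1.2 * Real.exp (-w q.2)) with hΦdef
  set D := halfSpace E ∩ Metric.ball (a, (0 : ℝ)) ρ
  have hbw : ContDiffOn ℝ ∞ w D ∧ ContDiffOn ℝ ∞ b D :=
    ⟨fun z hz ↦ (hall z hz).1.mono inter_subset_left, fun z hz ↦ (hall z hz).2.1.mono inter_subset_left⟩
  have h2 : MapsTo (Prod.snd : (E × ℝ) × (E × ℝ) → E × ℝ) (halfSpace E ×ˢ D) D := fun q hq ↦ hq.2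
  have hΦ : ContDiffOn ℝ ∞ Φ (halfSpace E ×ˢ D) := by
    have hw' := hbw.1.comp contDiffOn_snd h2
    have hb' := hbw.2.comp contDiffOn_snd h2
    have e1 : ContDiffOn ℝ ∞ (fun q : (E × ℝ) × (E × ℝ) ↦ q.1.1) (halfSpace E ×ˢ D) :=
      ContDiff.contDiffOn (by fun_prop)
    have e2 : ContDiffOn ℝ ∞ (fun q : (E × ℝ) × (E × ℝ) ↦ q.1.2) (halfSpace E ×ˢ D) :=
      ContDiff.contDiffOn (by fun_prop)
    have e3 : ContDiffOn ℝ ∞ (fun q : (E × ℝ) × (E × ℝ) ↦ q.2.1) (halfSpace E ×ˢ D) :=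
      ContDiff.contDiffOn (by fun_prop)
    exact (e1.sub (hb'.sub e3)).prodMk (e2.mul hw'.neg.exp)
  have hmaps : ∀ s ∈ halfSpace E, ∀ v ∈ D, Φ (s, v) ∈ halfSpace E := fun s hs v _ ↦
    mul_nonneg hs (Real.exp_pos _).le
  have haD : (a, (0 : ℝ)) ∈ D := ⟨ha, Metric.mem_ball_self hρ⟩
  have hb0 : b (a, 0) = a := ((hall _ haD).2.2.1 rfl).2
  have hw0 : w (a, 0) = 0 := ((hall _ haD).2.2.1 rfl).1
  have h0 : Φ ((a, 0), (a, 0)) = (a, 0) := by simp [hΦdef, hb0]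
  have hud : UniqueDiffOn ℝ D := uniqueDiffOn_halfSpace.inter Metric.isOpen_ball
  have hd : (fderivWithin ℝ Φ (halfSpace E ×ˢ D) ((a, 0), (a, 0))).comp
      (inr ℝ (E × ℝ) (E × ℝ)) = 0 := by
    have hΦ' := ((hΦ ((a, 0), (a, 0)) ⟨ha, haD⟩).differentiableWithinAt (by simp)).hasFDerivWithinAt
    have h3 := hΦ'.comp (a, (0 : ℝ)) (f := fun z : E × ℝ ↦ ((a, (0 : ℝ)), z)) (s := D)
      (hasFDerivAt_prodMk_right _ _).hasFDerivWithinAt fun z hz ↦ ⟨ha, hz⟩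
    refine (hud _ haD).eq h3 ?_
    have hdb := ((hall _ haD).2.1.differentiableWithinAt (by simp)).hasFDerivWithinAt
    rw [IsNormalAt.fderivWithin_boundary h hz] at hdb
    have h4 := (((hasFDerivWithinAt_const a (a, (0 : ℝ)) D).sub
      ((hdb.mono inter_subset_left).sub hasFDerivWithinAt_fst)).prodMk
      (hasFDerivWithinAt_const (0 : ℝ) (a, (0 : ℝ)) D))
    have h5 : ((0 : E × ℝ →L[ℝ] E) - (fst ℝ E ℝ - fst ℝ E ℝ)).prod (0 : E × ℝ →L[ℝ] ℝ) = 0 := by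
      ext <;> simp
    rw [h5] at h4
    refine h4.congr_of_eventuallyEq (Eventually.of_forall fun z ↦ ?_) ?_
    · simp [hΦdef]
    · simp [hΦdef]
  obtain ⟨r, hr, r₁, hr₁, u, hr₁ρ, hu, hu0, hfix⟩ := exists_contDiffOn_fixedPoint
    uniqueDiffOn_halfSpace uniqueDiffOn_halfSpace convex_halfSpace isClosed_halfSpace ha ha hρ
    hΦ hmaps h0 hd
  refine ⟨u, eventually_halfSpace_iff.2 ⟨r, hr, fun c hc ↦ ?_⟩, hu0, ?_⟩
  · obtain ⟨hm, hf, -⟩ := hfix c hc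
    have hf1 := congrArg Prod.fst hf
    have hf2 := congrArg Prod.snd hf
    simp only [hΦdef] at hf1 hf2
    refine ⟨(hu c hc).mono_of_mem_nhdsWithin ?_, hm.1, ?_, ?_⟩
    · exact inter_mem_nhdsWithin _ (Metric.isOpen_ball.mem_nhds hc.2)
    · have h3 : c.1 - b (u c) = 0 := by
        have : c.1 - b (u c) = (c.1 - (b (u c) - (u c).1)) - (u c).1 := by abel
        rw [this, hf1, sub_self]
      exact (sub_eq_zero.1 h3).symm
    · have h3 : (u c).2 * Real.exp (w (u c)) = c.2 * Real.exp (-w (u c)) * Real.exp (w (u c)) :=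
        congrArg (· * Real.exp (w (u c))) hf2.symm
      rw [h3, mul_assoc, ← Real.exp_add]
      simp
  · have hcw : ContinuousWithinAt w (halfSpace E) (a, 0) := (hall _ haD).1.continuousWithinAt
    have hcb : ContinuousWithinAt b (halfSpace E) (a, 0) := (hall _ haD).2.1.continuousWithinAt
    have hc : ContinuousWithinAt (fun z : E × ℝ ↦ (b z, z.2 * Real.exp (w z))) (halfSpace E) (a, 0) :=
      hcb.prodMk (continuous_snd.continuousWithinAt.mul hcw.rexp)
    have hmem : ∀ᶠ z in 𝓝[halfSpace E] (a, 0),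
        (b z, z.2 * Real.exp (w z)) ∈ Metric.ball (a, (0 : ℝ)) r := by
      refine hc.eventually (Metric.isOpen_ball.mem_nhds ?_)
      simp only [hb0, zero_mul]
      exact Metric.mem_ball_self hr
    have hr₁' : ∀ᶠ z in 𝓝[halfSpace E] (a, 0), z ∈ halfSpace E ∩ Metric.ball (a, (0 : ℝ)) r₁ :=
      eventually_halfSpace_iff.2 ⟨r₁, hr₁, fun z hz ↦ hz⟩
    filter_upwards [hmem, hr₁'] with z hz₁ hz₂
    have hs : (b z, z.2 * Real.exp (w z)) ∈ halfSpace E ∩ Metric.ball (a, (0 : ℝ)) r :=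
      ⟨mul_nonneg hz₂.1 (Real.exp_pos _).le, hz₁⟩
    refine ((hfix _ hs).2.2.1 z hz₂ ?_).symm
    simp only [hΦdef]
    refine Prod.ext (by simp) ?_
    simp only
    rw [mul_assoc, ← Real.exp_add]
    simp

end NormalUnique

/-! ### Half-space coordinates on the collar -/

namespace ProductDecomposition

variable {n : ℕ} {X : Type*} [TopologicalSpace X]
  [ChartedSpace (EuclideanHalfSpace (n + 1)) X] [IsManifold (𝓡∂ (n + 1)) ∞ X]
  [ChartedSpace (EuclideanSpace ℝ (Fin n)) (BoundaryOf n X)]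
  [IsManifold (𝓡 n) ∞ (BoundaryOf n X)]

/-- The parametrization of a neighbourhood of a boundary point by the half-space. -/
def localParam (P : ProductDecomposition n X) (q₀ : BoundaryOf n X) :
    EuclideanSpace ℝ (Fin n) × ℝ → X :=
  fun z ↦ P.param ((extChartAt (𝓡 n) q₀).symm z.1, z.2)

/-- The half-space coordinates near a boundary point. -/
def localCoord (P : ProductDecomposition n X) (q₀ : BoundaryOf n X) :
    X → EuclideanSpace ℝ (Fin n) × ℝ :=
  fun p ↦ (extChartAt (𝓡 n) q₀ (P.y p), P.x p)

variable (P : ProductDecomposition n X) (q₀ : BoundaryOf n X)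

/-- The part of the half-space on which `localParam` is a diffeomorphism onto its image. -/
def localCollar : Set (EuclideanSpace ℝ (Fin n) × ℝ) :=
  {z | z.1 ∈ (extChartAt (𝓡 n) q₀).target ∧ 0 ≤ z.2 ∧
    z.2 < P.width ((extChartAt (𝓡 n) q₀).symm z.1)}

theorem localCollar_subset : P.localCollar q₀ ⊆ halfSpace (EuclideanSpace ℝ (Fin n)) :=
  fun _ hz ↦ hz.2.1

theorem localCollar_mem_nhdsWithin {z : EuclideanSpace ℝ (Fin n) × ℝ} (hz : z ∈ P.localCollar q₀) :
    P.localCollar q₀ ∈ 𝓝[halfSpace (EuclideanSpace ℝ (Fin n))] z := by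
  have h1 : (extChartAt (𝓡 n) q₀).target ∈ 𝓝 z.1 := (isOpen_extChartAt_target q₀).mem_nhds hz.1
  have h2 : ContinuousAt (extChartAt (𝓡 n) q₀).symm z.1 := continuousAt_extChartAt_symm'' hz.1
  have h3 : ContinuousAt (fun z : EuclideanSpace ℝ (Fin n) × ℝ ↦
      P.width ((extChartAt (𝓡 n) q₀).symm z.1)) z :=
    P.continuous_width.continuousAt.comp (h2.comp continuousAt_fst)
  have h4 := continuousAt_snd.eventually_lt h3 hz.2.2
  filter_upwards [mem_nhdsWithin_of_mem_nhds (continuousAt_fst.preimage_mem_nhds h1),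
    mem_nhdsWithin_of_mem_nhds h4, self_mem_nhdsWithin] with z' e1 e2 e3 using ⟨e1, e3, e2⟩

theorem mk_zero_mem_localCollar : (extChartAt (𝓡 n) q₀ q₀, (0 : ℝ)) ∈ P.localCollar q₀ :=
  ⟨mem_extChartAt_target q₀, le_rfl, P.width_pos _⟩

variable {P q₀} {z : EuclideanSpace ℝ (Fin n) × ℝ}

theorem localParam_mem_domain (hz : z ∈ P.localCollar q₀) : P.localParam q₀ z ∈ P.domain :=
  P.mapsTo_param _ _ hz.2.1 hz.2.2

theorem y_localParam (hz : z ∈ P.localCollar q₀) :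
    P.y (P.localParam q₀ z) = (extChartAt (𝓡 n) q₀).symm z.1 :=
  P.y_param _ _ hz.2.1 hz.2.2

theorem x_localParam (hz : z ∈ P.localCollar q₀) : P.x (P.localParam q₀ z) = z.2 :=
  P.x_param _ _ hz.2.1 hz.2.2

theorem localCoord_localParam (hz : z ∈ P.localCollar q₀) :
    P.localCoord q₀ (P.localParam q₀ z) = z :=
  Prod.ext (by rw [localCoord, y_localParam hz]; exact (extChartAt (𝓡 n) q₀).right_inv hz.1)
    (x_localParam hz)

theorem localParam_localCoord {p : X} (hp : p ∈ P.domain) (hy : P.y p ∈ (extChartAt (𝓡 n) q₀).source) :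
    P.localParam q₀ (P.localCoord q₀ p) = p := by
  rw [localParam, localCoord, (extChartAt (𝓡 n) q₀).left_inv hy, P.param_coord p hp]

theorem localCoord_mem_localCollar {p : X} (hp : p ∈ P.domain)
    (hy : P.y p ∈ (extChartAt (𝓡 n) q₀).source) : P.localCoord q₀ p ∈ P.localCollar q₀ :=
  ⟨(extChartAt (𝓡 n) q₀).map_source hy, (P.mapsTo_coord p hp).1, by
    simp only [localCoord, (extChartAt (𝓡 n) q₀).left_inv hy]
    exact (P.mapsTo_coord p hp).2⟩

theorem contMDiffWithinAt_localParam (hz : z ∈ P.localCollar q₀) :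
    ContMDiffWithinAt 𝓘(ℝ, EuclideanSpace ℝ (Fin n) × ℝ) (𝓡∂ (n + 1)) ∞ (P.localParam q₀)
      (halfSpace (EuclideanSpace ℝ (Fin n))) z := by
  have h1 : ContMDiffWithinAt 𝓘(ℝ, EuclideanSpace ℝ (Fin n) × ℝ) ((𝓡 n).prod 𝓘(ℝ, ℝ)) ∞
      (fun z : EuclideanSpace ℝ (Fin n) × ℝ ↦ ((extChartAt (𝓡 n) q₀).symm z.1, z.2))
      (P.localCollar q₀) z := by
    refine ContMDiffWithinAt.prodMk ?_ contDiff_snd.contMDiff.contMDiffAt.contMDiffWithinAt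
    have h2 := (contMDiffOn_extChartAt_symm (I := 𝓡 n) (n := ∞) q₀) z.1 hz.1
    exact h2.comp z contDiff_fst.contMDiff.contMDiffAt.contMDiffWithinAt fun z hz ↦ hz.1
  have h3 := P.smooth_param ((extChartAt (𝓡 n) q₀).symm z.1, z.2) hz.2
  exact (h3.comp z h1 fun z hz ↦ hz.2).mono_of_mem_nhdsWithin (P.localCollar_mem_nhdsWithin q₀ hz)

theorem contMDiffAt_localCoord {p : X} (hp : p ∈ P.domain)
    (hy : P.y p ∈ (extChartAt (𝓡 n) q₀).source) :
    ContMDiffAt (𝓡∂ (n + 1)) 𝓘(ℝ, EuclideanSpace ℝ (Fin n) × ℝ) ∞ (P.localCoord q₀) p := by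
  have hd := P.isOpen_domain.mem_nhds hp
  rw [extChartAt_source] at hy
  have h1 : ContMDiffAt (𝓡∂ (n + 1)) 𝓘(ℝ, EuclideanSpace ℝ (Fin n)) ∞
      (fun p ↦ extChartAt (𝓡 n) q₀ (P.y p)) p :=
    (contMDiffAt_extChartAt' hy).comp p (P.smooth_y.contMDiffAt hd)
  exact h1.prodMk_space (P.smooth_x.contMDiffAt hd)

theorem y_mem_source_of_mem_localCollar (hz : z ∈ P.localCollar q₀) :
    P.y (P.localParam q₀ z) ∈ (extChartAt (𝓡 n) q₀).source := by
  rw [y_localParam hz]; exact (extChartAt (𝓡 n) q₀).map_target hz.1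

theorem eventually_nhds_localParam (hz : z ∈ P.localCollar q₀) :
    ∀ᶠ p in 𝓝 (P.localParam q₀ z), p ∈ P.domain ∧ P.y p ∈ (extChartAt (𝓡 n) q₀).source := by
  have hd := P.isOpen_domain.mem_nhds (localParam_mem_domain hz)
  exact (eventually_mem_set.2 hd).and ((P.smooth_y.contMDiffAt hd).continuousAt.eventually
    ((isOpen_extChartAt_source q₀).mem_nhds (y_mem_source_of_mem_localCollar hz)))

/-- The differential of `localParam`. -/
def localFrame (P : ProductDecomposition n X) (q₀ : BoundaryOf n X)
    (z : EuclideanSpace ℝ (Fin n) × ℝ) :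
    (EuclideanSpace ℝ (Fin n) × ℝ) →L[ℝ] TangentSpace (𝓡∂ (n + 1)) (P.localParam q₀ z) :=
  mfderivWithin 𝓘(ℝ, EuclideanSpace ℝ (Fin n) × ℝ) (𝓡∂ (n + 1)) (P.localParam q₀)
    (halfSpace (EuclideanSpace ℝ (Fin n))) z

/-- The differential of `localCoord`. -/
def localCoframe (P : ProductDecomposition n X) (q₀ : BoundaryOf n X) (p : X) :
    TangentSpace (𝓡∂ (n + 1)) p →L[ℝ] (EuclideanSpace ℝ (Fin n) × ℝ) :=
  mfderiv (𝓡∂ (n + 1)) 𝓘(ℝ, EuclideanSpace ℝ (Fin n) × ℝ) (P.localCoord q₀) p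

theorem hasMFDerivWithinAt_localParam (hz : z ∈ P.localCollar q₀) :
    HasMFDerivWithinAt 𝓘(ℝ, EuclideanSpace ℝ (Fin n) × ℝ) (𝓡∂ (n + 1)) (P.localParam q₀)
      (halfSpace (EuclideanSpace ℝ (Fin n))) z (P.localFrame q₀ z) :=
  ((contMDiffWithinAt_localParam hz).mdifferentiableWithinAt (by simp)).hasMFDerivWithinAt

theorem hasMFDerivAt_localCoord {p : X} (hp : p ∈ P.domain)
    (hy : P.y p ∈ (extChartAt (𝓡 n) q₀).source) :
    HasMFDerivAt (𝓡∂ (n + 1)) 𝓘(ℝ, EuclideanSpace ℝ (Fin n) × ℝ) (P.localCoord q₀) p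
      (P.localCoframe q₀ p) :=
  ((contMDiffAt_localCoord hp hy).mdifferentiableAt (by simp)).hasMFDerivAt

theorem uniqueMDiffWithinAt_halfSpace {E : Type*} [NormedAddCommGroup E] [NormedSpace ℝ E]
    {z : E × ℝ} (hz : z ∈ halfSpace E) : UniqueMDiffWithinAt 𝓘(ℝ, E × ℝ) (halfSpace E) z :=
  uniqueMDiffWithinAt_iff_uniqueDiffWithinAt.2 (uniqueDiffOn_halfSpace z hz)

theorem localCoframe_localFrame (hz : z ∈ P.localCollar q₀) (v : EuclideanSpace ℝ (Fin n) × ℝ) :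
    P.localCoframe q₀ (P.localParam q₀ z) (P.localFrame q₀ z v) = v := by
  have h1 := (hasMFDerivAt_localCoord (localParam_mem_domain hz)
    (y_mem_source_of_mem_localCollar hz)).comp_hasMFDerivWithinAt z
    (hasMFDerivWithinAt_localParam hz)
  have h2 := (hasMFDerivWithinAt_id (I := 𝓘(ℝ, EuclideanSpace ℝ (Fin n) × ℝ))
    (s := halfSpace (EuclideanSpace ℝ (Fin n))) z).congr_of_eventuallyEq
    (f₁ := P.localCoord q₀ ∘ P.localParam q₀)
    (by filter_upwards [P.localCollar_mem_nhdsWithin q₀ hz] with z' hz'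
        using localCoord_localParam hz') (localCoord_localParam hz)
  exact DFunLike.congr_fun ((uniqueMDiffWithinAt_halfSpace (localCollar_subset P q₀ hz)).eq h1 h2) v

/-- `localParam` is differentiable only within the half-space. The chain rule is applied within the
preimage of the half-space under `localCoord`, which is a full neighbourhood in `X`, so the result
is an honest derivative there. -/
theorem localFrame_localCoframe (hz : z ∈ P.localCollar q₀)
    (v : TangentSpace (𝓡∂ (n + 1)) (P.localParam q₀ z)) :
    P.localFrame q₀ z (P.localCoframe q₀ (P.localParam q₀ z) v) = v := by
  have hp := localCoord_localParam hz
  have hev := eventually_nhds_localParam hz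
  have h0 := hasMFDerivWithinAt_localParam hz
  have h1 : HasMFDerivAt (𝓡∂ (n + 1)) (𝓡∂ (n + 1)) (P.localParam q₀ ∘ P.localCoord q₀)
      (P.localParam q₀ z) ((P.localFrame q₀ z).comp (P.localCoframe q₀ (P.localParam q₀ z))) := by
    refine HasMFDerivWithinAt.hasMFDerivAt (s := {p | P.localCoord q₀ p ∈
      halfSpace (EuclideanSpace ℝ (Fin n))}) ?_ ?_
    · refine HasMFDerivWithinAt.comp _ (u := halfSpace (EuclideanSpace ℝ (Fin n))) ?_
        (hasMFDerivAt_localCoord (localParam_mem_domain hz)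
        (y_mem_source_of_mem_localCollar hz)).hasMFDerivWithinAt fun p hp ↦ hp
      rw [hp]
      exact h0
    · filter_upwards [hev] with p hp
      exact P.localCollar_subset q₀ (localCoord_mem_localCollar hp.1 hp.2)
  have h2 : HasMFDerivAt (𝓡∂ (n + 1)) (𝓡∂ (n + 1)) (P.localParam q₀ ∘ P.localCoord q₀)
      (P.localParam q₀ z) (ContinuousLinearMap.id ℝ _) := by
    refine (hasMFDerivAt_id _).congr_of_eventuallyEq ?_
    filter_upwards [hev] with p hp using localParam_localCoord hp.1 hp.2
  exact DFunLike.congr_fun (hasMFDerivAt_unique h1 h2) v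

end ProductDecomposition

/-- The tangent map of `f` is smooth and is composed with the constant section `v`. -/
theorem contMDiffOn_mfderivWithin_apply {n : ℕ} {X : Type*} [TopologicalSpace X]
    [ChartedSpace (EuclideanHalfSpace (n + 1)) X] [IsManifold (𝓡∂ (n + 1)) ∞ X]
    {E : Type*} [NormedAddCommGroup E] [NormedSpace ℝ E] {f : E → X} {s : Set E}
    (hf : ContMDiffOn 𝓘(ℝ, E) (𝓡∂ (n + 1)) ∞ f s) (hs : UniqueDiffOn ℝ s) (v : E) :
    ContMDiffOn 𝓘(ℝ, E) (𝓡∂ (n + 1)).tangent ∞ (fun z ↦ TotalSpace.mk' (EuclideanSpace ℝ (Fin (n + 1)))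
      (E := TangentSpace (M := X) (𝓡∂ (n + 1))) (f z) (mfderivWithin 𝓘(ℝ, E) (𝓡∂ (n + 1)) f s z v)) s := by
  have h1 := hf.contMDiffOn_tangentMapWithin (m := ∞) (by simp) hs.uniqueMDiffOn
  have h2 : ContMDiffOn 𝓘(ℝ, E) 𝓘(ℝ, E).tangent ∞
      (fun z : E ↦ (⟨z, v⟩ : TangentBundle 𝓘(ℝ, E) E)) s := fun z _ ↦
    contMDiffWithinAt_vectorSpace_iff_contDiffWithinAt.2 contDiffWithinAt_const
  exact h1.comp h2 fun z hz ↦ hz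

/-! ### The metric and normal pairs, between the half-space and `X` -/

namespace ProductDecomposition

variable {n : ℕ} {X : Type*} [TopologicalSpace X]
  [ChartedSpace (EuclideanHalfSpace (n + 1)) X] [IsManifold (𝓡∂ (n + 1)) ∞ X]
  [ChartedSpace (EuclideanSpace ℝ (Fin n)) (BoundaryOf n X)]
  [IsManifold (𝓡 n) ∞ (BoundaryOf n X)]
  {P : ProductDecomposition n X} {q₀ : BoundaryOf n X} {z : EuclideanSpace ℝ (Fin n) × ℝ}
  {h : TwoTensorField n X}

open ContinuousLinearMap

theorem dx_eq_localCoframe {p : X} (hp : p ∈ P.domain) (hy : P.y p ∈ (extChartAt (𝓡 n) q₀).source)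
    (v : TangentSpace (𝓡∂ (n + 1)) p) : P.dx p v = (P.localCoframe q₀ p v).2 := by
  have h1 := ((snd ℝ (EuclideanSpace ℝ (Fin n)) ℝ).hasMFDerivAt
    (x := P.localCoord q₀ p)).comp p (hasMFDerivAt_localCoord hp hy)
  exact DFunLike.congr_fun h1.mfderiv v

theorem dx_localFrame (hz : z ∈ P.localCollar q₀) (v : EuclideanSpace ℝ (Fin n) × ℝ) :
    P.dx (P.localParam q₀ z) (P.localFrame q₀ z v) = v.2 := by
  rw [dx_eq_localCoframe (localParam_mem_domain hz) (y_mem_source_of_mem_localCollar hz),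
    localCoframe_localFrame hz]

theorem dy_localFrame (hz : z ∈ P.localCollar q₀) {v : EuclideanSpace ℝ (Fin n) × ℝ}
    (hv : v.1 = 0) : P.dy (P.localParam q₀ z) (P.localFrame q₀ z v) = 0 := by
  have hy : HasMFDerivAt (𝓡∂ (n + 1)) (𝓡 n) P.y (P.localParam q₀ z) (P.dy (P.localParam q₀ z)) :=
    ((P.smooth_y.contMDiffAt (P.isOpen_domain.mem_nhds
      (localParam_mem_domain hz))).mdifferentiableAt (by simp)).hasMFDerivAt
  have h1 := hy.comp_hasMFDerivWithinAt z (hasMFDerivWithinAt_localParam hz)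
  have h2 := ((contMDiffWithinAt_extChartAt_symm_target (I := 𝓡 n) (n := ∞) q₀
    hz.1).contMDiffAt ((isOpen_extChartAt_target q₀).mem_nhds hz.1)).mdifferentiableAt
    (by simp) |>.hasMFDerivAt
  have h3 := (h2.comp z ((fst ℝ (EuclideanSpace ℝ (Fin n)) ℝ).hasMFDerivAt
    (x := z))).hasMFDerivWithinAt (s := halfSpace (EuclideanSpace ℝ (Fin n)))
  have h4 := h3.congr_of_eventuallyEq (f₁ := P.y ∘ P.localParam q₀)
    (by filter_upwards [P.localCollar_mem_nhdsWithin q₀ hz] with z' hz' using y_localParam hz')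
    (y_localParam hz)
  have h5 := DFunLike.congr_fun
    ((uniqueMDiffWithinAt_halfSpace (localCollar_subset P q₀ hz)).eq h1 h4) v
  refine h5.trans ?_
  change mfderiv 𝓘(ℝ, EuclideanSpace ℝ (Fin n)) (𝓡 n) (extChartAt (𝓡 n) q₀).symm z.1 v.1 = 0
  rw [hv]
  exact ContinuousLinearMap.map_zero _

/-- The bilinear form `dx² + h` in half-space coordinates. -/
def localMetric (P : ProductDecomposition n X) (h : TwoTensorField n X) (q₀ : BoundaryOf n X)
    (z : EuclideanSpace ℝ (Fin n) × ℝ) :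
    (EuclideanSpace ℝ (Fin n) × ℝ) →L[ℝ] (EuclideanSpace ℝ (Fin n) × ℝ) →L[ℝ] ℝ :=
  let k : EuclideanSpace ℝ (Fin (n + 1)) →L[ℝ] EuclideanSpace ℝ (Fin (n + 1)) →L[ℝ] ℝ :=
    h (P.localParam q₀ z)
  let e : EuclideanSpace ℝ (Fin n) × ℝ →L[ℝ] EuclideanSpace ℝ (Fin (n + 1)) := P.localFrame q₀ z
  (ContinuousLinearMap.mul ℝ ℝ).bilinearComp (snd ℝ _ ℝ) (snd ℝ _ ℝ) + k.bilinearComp e e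

theorem localMetric_apply (v w : EuclideanSpace ℝ (Fin n) × ℝ) :
    P.localMetric h q₀ z v w =
      v.2 * w.2 + h (P.localParam q₀ z) (P.localFrame q₀ z v) (P.localFrame q₀ z w) := rfl

theorem contDiffWithinAt_localMetric (hh : h.IsSmoothSymmOn P.domain) (hz : z ∈ P.localCollar q₀) :
    ContDiffWithinAt ℝ ∞ (P.localMetric h q₀) (halfSpace (EuclideanSpace ℝ (Fin n))) z := by
  obtain ⟨t, ht, hzt, hsub⟩ := mem_nhdsWithin.1 (P.localCollar_mem_nhdsWithin q₀ hz)
  set s := halfSpace (EuclideanSpace ℝ (Fin n)) ∩ t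
  have hs : UniqueDiffOn ℝ s := uniqueDiffOn_halfSpace.inter ht
  have hsc : s ⊆ P.localCollar q₀ := fun z hz ↦ hsub ⟨hz.2, hz.1⟩
  have hΨ : ContMDiffOn 𝓘(ℝ, EuclideanSpace ℝ (Fin n) × ℝ) (𝓡∂ (n + 1)) ∞ (P.localParam q₀) s :=
    fun z hz ↦ (contMDiffWithinAt_localParam (hsc hz)).mono inter_subset_left
  have hframe : ∀ v, ContMDiffOn 𝓘(ℝ, EuclideanSpace ℝ (Fin n) × ℝ) (𝓡∂ (n + 1)).tangent ∞
      (fun z ↦ TotalSpace.mk' (EuclideanSpace ℝ (Fin (n + 1)))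
      (E := TangentSpace (M := X) (𝓡∂ (n + 1))) (P.localParam q₀ z) (P.localFrame q₀ z v)) s := by
    intro v
    refine (contMDiffOn_mfderivWithin_apply hΨ hs v).congr fun z hz ↦ ?_
    rw [localFrame, ← mfderivWithin_inter (ht.mem_nhds hz.2)]
    rfl
  have hsec := hh.smooth.comp hΨ fun z hz ↦ localParam_mem_domain (hsc hz)
  have hmain : ContDiffOn ℝ ∞ (P.localMetric h q₀) s := by
    -- In finite dimension a form is smooth once its values on fixed vectors are; these are the
    -- section `h` evaluated on two smooth vector fields along `localParam`.
    refine contDiffOn_clm_apply.2 fun v ↦ contDiffOn_clm_apply.2 fun w ↦ ?_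
    simp only [localMetric_apply]
    refine contDiffOn_const.add (contMDiffOn_iff_contDiffOn.1 ?_)
    intro z hz
    have h1 := ContMDiffWithinAt.clm_bundle_apply₂ (F₁ := EuclideanSpace ℝ (Fin (n + 1)))
      (F₂ := EuclideanSpace ℝ (Fin (n + 1))) (F₃ := ℝ) (E₁ := TangentSpace (M := X) (𝓡∂ (n + 1)))
      (E₂ := TangentSpace (M := X) (𝓡∂ (n + 1))) (E₃ := fun _ : X ↦ ℝ) (hsec z hz) (hframe v z hz) (hframe w z hz)
    exact (contMDiffWithinAt_totalSpace.1 h1).2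
  exact (hmain z ⟨hz.2.1, hzt⟩).mono_of_mem_nhdsWithin
    (inter_mem_nhdsWithin _ (ht.mem_nhds hzt))

theorem y_eq_of_x_eq_zero {p : X} (hp : p ∈ P.domain) (hx : P.x p = 0) : (P.y p : X) = p := by
  rw [← P.param_zero, ← hx, P.param_coord p hp]

theorem x_boundary (q : BoundaryOf n X) : P.x q = 0 := by
  have h1 := P.x_param q 0 le_rfl (P.width_pos q)
  rwa [P.param_zero] at h1

theorem y_boundary (q : BoundaryOf n X) : P.y q = q := by
  have h1 := P.y_param q 0 le_rfl (P.width_pos q)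
  rwa [P.param_zero] at h1

/-- Independence of `dx` on the boundary gives the block form, since a frame vector and its
projection to the directions of `y` have the same image under `dy`. The projected vectors have `dx =
0`, so `h` is positive on them. -/
theorem isBoundaryMetric_localMetric {g : TwoTensorField n X} (hform : P.HasForm g h)
    (hindep : P.IndependentOfDx h ((𝓡∂ (n + 1)).boundary X)) (q₀ : BoundaryOf n X) :
    IsBoundaryMetric (P.localMetric h q₀) (extChartAt (𝓡 n) q₀ q₀) := by
  have hz₀ := P.mk_zero_mem_localCollar q₀
  have hev : ∀ᶠ z in 𝓝[halfSpace (EuclideanSpace ℝ (Fin n))] (extChartAt (𝓡 n) q₀ q₀, 0),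
      z ∈ P.localCollar q₀ := P.localCollar_mem_nhdsWithin q₀ hz₀
  have hbd : ∀ z ∈ P.localCollar q₀, z.2 = 0 → P.localParam q₀ z ∈ (𝓡∂ (n + 1)).boundary X := by
    intro z hz hz0
    rw [← y_eq_of_x_eq_zero (localParam_mem_domain hz) ((x_localParam hz).trans hz0)]
    exact Subtype.property _
  refine ⟨hev.mono fun z hz ↦ contDiffWithinAt_localMetric hform.smoothSymm hz,
    hev.mono fun z hz v w ↦ ?_, hev.mono fun z hz hz0 v w ↦ ?_, fun v hv ↦ ?_⟩
  · rw [localMetric_apply, localMetric_apply, mul_comm,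
      hform.smoothSymm.symm _ (localParam_mem_domain hz)]
  · rw [localMetric_apply, localMetric_apply, zero_mul, zero_add]
    congr 1
    have key : ∀ v : EuclideanSpace ℝ (Fin n) × ℝ, P.dy _ (P.localFrame q₀ z v) =
        P.dy _ (P.localFrame q₀ z (v.1, 0)) := by
      intro v
      rw [← sub_eq_zero, ← map_sub, ← map_sub]
      exact dy_localFrame hz (by simp)
    exact hindep _ (hbd z hz hz0) _ _ _ _ (key v) (key w)
  · rw [localMetric_apply, zero_mul, zero_add]
    refine hform.pos_boundary _ (hbd _ hz₀ rfl) _ (fun h0 ↦ hv ?_) (dx_localFrame hz₀ _)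
    have h1 := localCoframe_localFrame hz₀ (v, (0 : ℝ))
    rw [h0, map_zero] at h1
    exact (congrArg Prod.fst h1).symm

/-- The differential of a function, as a covector. -/
def scalarDeriv (w : X → ℝ) (p : X) : TangentSpace (𝓡∂ (n + 1)) p →L[ℝ] ℝ :=
  mfderiv (𝓡∂ (n + 1)) 𝓘(ℝ, ℝ) w p

/-- `w` and `Y` are smooth at `p`, have the right boundary values, and there is a vector
annihilated by `dY` which is dual with respect to `dx² + h`, up to the natural factor, to the
covector `dx + x dw`. -/
structure IsNormalPair (P : ProductDecomposition n X) (h : TwoTensorField n X) (w : X → ℝ)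
    (Y : X → BoundaryOf n X) (p : X) : Prop where
  smooth_w : ContMDiffAt (𝓡∂ (n + 1)) 𝓘(ℝ, ℝ) ∞ w p
  smooth_Y : ContMDiffAt (𝓡∂ (n + 1)) (𝓡 n) ∞ Y p
  boundary : P.x p = 0 → w p = 0 ∧ Y p = P.y p
  exists_vector : ∃ T : TangentSpace (𝓡∂ (n + 1)) p, P.dx p T = 1 ∧
    mfderiv (𝓡∂ (n + 1)) (𝓡 n) Y p T = 0 ∧
    ∀ d, P.dx p T * P.dx p d + h p T d =
      (1 + P.x p * scalarDeriv w p T) * (P.dx p d + P.x p * scalarDeriv w p d)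

theorem IsNormalPair.congr {w w' : X → ℝ} {Y Y' : X → BoundaryOf n X} {p : X}
    (hwY : P.IsNormalPair h w Y p) (hw : w' =ᶠ[𝓝 p] w) (hY : Y' =ᶠ[𝓝 p] Y) :
    P.IsNormalPair h w' Y' p := by
  obtain ⟨T, hT, hYT, hd⟩ := hwY.exists_vector
  refine ⟨hwY.smooth_w.congr_of_eventuallyEq hw, hwY.smooth_Y.congr_of_eventuallyEq hY,
    fun hx ↦ by rw [hw.self_of_nhds, hY.self_of_nhds]; exact hwY.boundary hx, T, hT, ?_, ?_⟩
  · have := hY.mfderiv_eq (I := 𝓡∂ (n + 1)) (I' := 𝓡 n)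
    exact (DFunLike.congr_fun this T).trans hYT
  · have : scalarDeriv (n := n) w' p = scalarDeriv w p := hw.mfderiv_eq
    simpa only [this] using hd

/-- Carries local existence from the half-space to `X`: the normal vector is pushed forward by the
frame. -/
theorem isNormalPair_of_isNormalAt {w : EuclideanSpace ℝ (Fin n) × ℝ → ℝ}
    {b : EuclideanSpace ℝ (Fin n) × ℝ → EuclideanSpace ℝ (Fin n)} (hz : z ∈ P.localCollar q₀)
    (hwb : IsNormalAt (P.localMetric h q₀) w b z) (hb : b z ∈ (extChartAt (𝓡 n) q₀).target) :
    P.IsNormalPair h (w ∘ P.localCoord q₀) ((extChartAt (𝓡 n) q₀).symm ∘ b ∘ P.localCoord q₀)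
      (P.localParam q₀ z) := by
  obtain ⟨hw, hb', hbd, T, hT, hbT, hγ⟩ := hwb
  have hp := localParam_mem_domain hz
  have hy := y_mem_source_of_mem_localCollar hz
  have hzz := localCoord_localParam hz
  have hκ := contMDiffAt_localCoord hp hy
  have hdκ := hasMFDerivAt_localCoord hp hy
  set s : Set X := {p | P.localCoord q₀ p ∈ halfSpace (EuclideanSpace ℝ (Fin n))} with hs_def
  have hs : s ∈ 𝓝 (P.localParam q₀ z) := by
    filter_upwards [eventually_nhds_localParam hz] with p hp
    exact P.localCollar_subset q₀ (localCoord_mem_localCollar hp.1 hp.2)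
  -- Smoothness within the half-space becomes smoothness on `X`, because `localCoord` maps a whole
  -- neighbourhood of the point into the half-space.
  have smooth : ∀ {F : Type} [NormedAddCommGroup F] [NormedSpace ℝ F]
      {f : EuclideanSpace ℝ (Fin n) × ℝ → F},
      ContDiffWithinAt ℝ ∞ f (halfSpace (EuclideanSpace ℝ (Fin n))) z →
      ContMDiffAt (𝓡∂ (n + 1)) 𝓘(ℝ, F) ∞ (f ∘ P.localCoord q₀) (P.localParam q₀ z) ∧
      HasMFDerivAt (𝓡∂ (n + 1)) 𝓘(ℝ, F) (f ∘ P.localCoord q₀) (P.localParam q₀ z)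
        ((fderivWithin ℝ f (halfSpace (EuclideanSpace ℝ (Fin n))) z).comp
          (P.localCoframe q₀ (P.localParam q₀ z))) := by
    intro F _ _ f hf
    constructor
    · rw [← hzz] at hf
      exact (hf.contMDiffWithinAt.comp _ hκ.contMDiffWithinAt (s := s) fun p hp ↦ hp).contMDiffAt hs
    · refine HasMFDerivWithinAt.hasMFDerivAt (s := s) ?_ hs
      refine HasMFDerivWithinAt.comp _ (u := halfSpace (EuclideanSpace ℝ (Fin n))) ?_
        hdκ.hasMFDerivWithinAt fun p hp ↦ hp
      rw [hzz]
      exact (hf.differentiableWithinAt (by simp)).hasFDerivWithinAt.hasMFDerivWithinAt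
  have hχ : ContMDiffAt 𝓘(ℝ, EuclideanSpace ℝ (Fin n)) (𝓡 n) ∞ (extChartAt (𝓡 n) q₀).symm (b z) :=
    (contMDiffWithinAt_extChartAt_symm_target q₀ hb).contMDiffAt
      ((isOpen_extChartAt_target q₀).mem_nhds hb)
  have hbz : (b ∘ P.localCoord q₀) (P.localParam q₀ z) = b z := congrArg b hzz
  refine ⟨(smooth hw).1, ?_, fun hx ↦ ?_, P.localFrame q₀ z T, ?_, ?_, fun d ↦ ?_⟩
  · rw [← hbz] at hχ
    exact hχ.comp _ (smooth hb').1
  · have h1 := hbd (by rw [← x_localParam hz]; exact hx)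
    refine ⟨by simp only [Function.comp, hzz]; exact h1.1, ?_⟩
    simp only [Function.comp, hzz]
    rw [h1.2, y_localParam hz]
  · rw [dx_localFrame hz, hT]
  · rw [← hbz] at hχ
    have h1 := (hχ.mdifferentiableAt (by simp)).hasMFDerivAt.comp _ (smooth hb').2
    refine (DFunLike.congr_fun h1.mfderiv _).trans ?_
    change mfderiv 𝓘(ℝ, EuclideanSpace ℝ (Fin n)) (𝓡 n) (extChartAt (𝓡 n) q₀).symm _
      (fderivWithin ℝ b (halfSpace (EuclideanSpace ℝ (Fin n))) z
        (P.localCoframe q₀ (P.localParam q₀ z) (P.localFrame q₀ z T))) = 0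
    rw [localCoframe_localFrame hz, hbT]
    exact ContinuousLinearMap.map_zero _
  · have h1 : ∀ d, scalarDeriv (w ∘ P.localCoord q₀) (P.localParam q₀ z) d =
        fderivWithin ℝ w (halfSpace (EuclideanSpace ℝ (Fin n))) z
          (P.localCoframe q₀ (P.localParam q₀ z) d) :=
      fun d ↦ DFunLike.congr_fun (smooth hw).2.mfderiv d
    have h2 := hγ (P.localCoframe q₀ (P.localParam q₀ z) d)
    rw [localMetric_apply, localFrame_localCoframe hz] at h2
    rw [h1, h1, localCoframe_localFrame hz, dx_localFrame hz, x_localParam hz,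
      dx_eq_localCoframe hp hy]
    exact h2

/-- The converse transfer, through which uniqueness and local invertibility on the half-space become
available on `X`. -/
theorem IsNormalPair.isNormalAt {w : X → ℝ} {Y : X → BoundaryOf n X} (hz : z ∈ P.localCollar q₀)
    (hwY : P.IsNormalPair h w Y (P.localParam q₀ z))
    (hY : Y (P.localParam q₀ z) ∈ (extChartAt (𝓡 n) q₀).source) :
    IsNormalAt (P.localMetric h q₀) (w ∘ P.localParam q₀)
      (extChartAt (𝓡 n) q₀ ∘ Y ∘ P.localParam q₀) z := by
  obtain ⟨hw, hYs, hbd, T, hT, hYT, hd⟩ := hwY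
  have hp := localParam_mem_domain hz
  have hy := y_mem_source_of_mem_localCollar hz
  have hΨ := contMDiffWithinAt_localParam hz
  have hdΨ := hasMFDerivWithinAt_localParam hz
  have hu := uniqueDiffOn_halfSpace z (localCollar_subset P q₀ hz)
  have hχ : ContMDiffAt (𝓡 n) 𝓘(ℝ, EuclideanSpace ℝ (Fin n)) ∞ (extChartAt (𝓡 n) q₀)
      (Y (P.localParam q₀ z)) := by
    rw [extChartAt_source] at hY
    exact contMDiffAt_extChartAt' hY
  have hχY := hχ.comp _ hYs
  have h1 : ∀ d, fderivWithin ℝ (w ∘ P.localParam q₀) (halfSpace (EuclideanSpace ℝ (Fin n))) z d =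
      scalarDeriv w (P.localParam q₀ z) (P.localFrame q₀ z d) := by
    intro d
    have h2 : HasFDerivWithinAt (w ∘ P.localParam q₀)
        ((scalarDeriv w (P.localParam q₀ z)).comp (P.localFrame q₀ z))
        (halfSpace (EuclideanSpace ℝ (Fin n))) z :=
      ((hw.mdifferentiableAt (by simp)).hasMFDerivAt.comp_hasMFDerivWithinAt z
        hdΨ).hasFDerivWithinAt
    rw [h2.fderivWithin hu]
    rfl
  refine ⟨(hw.comp_contMDiffWithinAt z hΨ).contDiffWithinAt,
    (hχY.comp_contMDiffWithinAt z hΨ).contDiffWithinAt, fun hz0 ↦ ?_,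
    P.localCoframe q₀ (P.localParam q₀ z) T, ?_, ?_, fun d ↦ ?_⟩
  · have h2 := hbd ((x_localParam hz).trans hz0)
    refine ⟨h2.1, ?_⟩
    simp only [Function.comp]
    rw [h2.2, y_localParam hz, (extChartAt (𝓡 n) q₀).right_inv hz.1]
  · rw [← dx_eq_localCoframe hp hy, hT]
  · have h2 := ((hχ.mdifferentiableAt (by simp)).hasMFDerivAt.comp _
      (hYs.mdifferentiableAt (by simp)).hasMFDerivAt).comp_hasMFDerivWithinAt z hdΨ
    let χ' : TangentSpace (𝓡 n) (Y (P.localParam q₀ z)) →L[ℝ] EuclideanSpace ℝ (Fin n) :=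
      mfderiv (𝓡 n) 𝓘(ℝ, EuclideanSpace ℝ (Fin n)) (extChartAt (𝓡 n) q₀) (Y (P.localParam q₀ z))
    have h3 : HasFDerivWithinAt (extChartAt (𝓡 n) q₀ ∘ Y ∘ P.localParam q₀)
        ((χ'.comp (mfderiv (𝓡∂ (n + 1)) (𝓡 n) Y (P.localParam q₀ z))).comp (P.localFrame q₀ z))
        (halfSpace (EuclideanSpace ℝ (Fin n))) z := h2.hasFDerivWithinAt
    rw [h3.fderivWithin hu]
    change mfderiv (𝓡 n) 𝓘(ℝ, EuclideanSpace ℝ (Fin n)) (extChartAt (𝓡 n) q₀) _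
      (mfderiv (𝓡∂ (n + 1)) (𝓡 n) Y _ (P.localFrame q₀ z
        (P.localCoframe q₀ (P.localParam q₀ z) T))) = 0
    rw [localFrame_localCoframe hz, hYT, map_zero]
  · have h2 := hd (P.localFrame q₀ z d)
    rw [localMetric_apply, h1, h1, localFrame_localCoframe hz, ← dx_eq_localCoframe hp hy, ← dx_localFrame hz d]
    rw [x_localParam hz] at h2
    exact h2

end ProductDecomposition

/-! ### Existence, uniqueness and invertibility of germs at boundary points -/

namespace ProductDecomposition

variable {n : ℕ} {X : Type*} [TopologicalSpace X]
  [ChartedSpace (EuclideanHalfSpace (n + 1)) X] [IsManifold (𝓡∂ (n + 1)) ∞ X]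
  [ChartedSpace (EuclideanSpace ℝ (Fin n)) (BoundaryOf n X)]
  [IsManifold (𝓡 n) ∞ (BoundaryOf n X)]
  {P : ProductDecomposition n X} {q₀ : BoundaryOf n X}
  {g h : TwoTensorField n X} {w : X → ℝ} {Y : X → BoundaryOf n X}

theorem localParam_mk_zero : P.localParam q₀ (extChartAt (𝓡 n) q₀ q₀, 0) = q₀ := by
  rw [localParam, extChartAt_to_inv, P.param_zero]

theorem localCoord_boundary : P.localCoord q₀ q₀ = (extChartAt (𝓡 n) q₀ q₀, 0) := by
  rw [localCoord, y_boundary, x_boundary]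

theorem eventually_nhds_boundary : ∀ᶠ p in 𝓝 (q₀ : X), p ∈ P.domain ∧
    P.y p ∈ (extChartAt (𝓡 n) q₀).source := by
  have := eventually_nhds_localParam (P.mk_zero_mem_localCollar q₀)
  rwa [localParam_mk_zero] at this

theorem tendsto_localParam : Tendsto (P.localParam q₀)
    (𝓝[halfSpace (EuclideanSpace ℝ (Fin n))] (extChartAt (𝓡 n) q₀ q₀, 0)) (𝓝 (q₀ : X)) := by
  have := (contMDiffWithinAt_localParam (P.mk_zero_mem_localCollar q₀)).continuousWithinAt.tendsto
  rwa [localParam_mk_zero] at this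

theorem tendsto_localCoord : Tendsto (P.localCoord q₀) (𝓝 (q₀ : X))
    (𝓝[halfSpace (EuclideanSpace ℝ (Fin n))] (extChartAt (𝓡 n) q₀ q₀, 0)) := by
  have h1 := (eventually_nhds_boundary (P := P) (q₀ := q₀)).self_of_nhds
  refine tendsto_nhdsWithin_iff.2 ⟨?_, ?_⟩
  · have := (contMDiffAt_localCoord h1.1 h1.2).continuousAt.tendsto
    rwa [localCoord_boundary] at this
  · filter_upwards [eventually_nhds_boundary (P := P) (q₀ := q₀)] with p hp
    exact P.localCollar_subset q₀ (localCoord_mem_localCollar hp.1 hp.2)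

theorem eventually_nhds_of_localParam {Q : X → Prop}
    (hQ : ∀ᶠ z in 𝓝[halfSpace (EuclideanSpace ℝ (Fin n))] (extChartAt (𝓡 n) q₀ q₀, 0),
      Q (P.localParam q₀ z)) : ∀ᶠ p in 𝓝 (q₀ : X), Q p := by
  filter_upwards [tendsto_localCoord.eventually hQ, eventually_nhds_boundary (P := P) (q₀ := q₀)]
    with p h1 h2
  rwa [localParam_localCoord h2.1 h2.2] at h1

theorem eventually_mem_localCollar :
    ∀ᶠ z in 𝓝[halfSpace (EuclideanSpace ℝ (Fin n))] (extChartAt (𝓡 n) q₀ q₀, 0),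
      z ∈ P.localCollar q₀ :=
  P.localCollar_mem_nhdsWithin q₀ (P.mk_zero_mem_localCollar q₀)

theorem exists_isNormalPair (hform : P.HasForm g h)
    (hindep : P.IndependentOfDx h ((𝓡∂ (n + 1)).boundary X)) (q₀ : BoundaryOf n X) :
    ∃ w Y, ∀ᶠ p in 𝓝 (q₀ : X), P.IsNormalPair h w Y p := by
  obtain ⟨w, b, hwb⟩ := (isBoundaryMetric_localMetric hform hindep q₀).exists_isNormalAt
  have h0 := hwb.self_of_nhdsWithin (mk_zero_mem_halfSpace _)
  have hb : ∀ᶠ z in 𝓝[halfSpace (EuclideanSpace ℝ (Fin n))] (extChartAt (𝓡 n) q₀ q₀, 0),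
      b z ∈ (extChartAt (𝓡 n) q₀).target := by
    refine h0.2.1.continuousWithinAt.eventually ?_
    rw [(h0.2.2.1 rfl).2]
    exact extChartAt_target_mem_nhds (I := 𝓡 n) q₀
  refine ⟨w ∘ P.localCoord q₀, (extChartAt (𝓡 n) q₀).symm ∘ b ∘ P.localCoord q₀,
    eventually_nhds_of_localParam (P := P) ?_⟩
  filter_upwards [hwb, hb, eventually_mem_localCollar (P := P)] with z h1 h2 h3
  exact isNormalPair_of_isNormalAt h3 h1 h2

theorem IsNormalPair.boundary_eq (hwY : P.IsNormalPair h w Y (q₀ : X)) :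
    w q₀ = 0 ∧ Y q₀ = q₀ := by
  have := hwY.boundary (x_boundary q₀)
  rwa [y_boundary] at this

theorem eventually_mem_source (hwY : P.IsNormalPair h w Y (q₀ : X)) :
    ∀ᶠ p in 𝓝 (q₀ : X), Y p ∈ (extChartAt (𝓡 n) q₀).source := by
  refine hwY.smooth_Y.continuousAt.eventually ?_
  rw [hwY.boundary_eq.2]
  exact extChartAt_source_mem_nhds q₀

theorem eventually_isNormalAt (hwY : ∀ᶠ p in 𝓝 (q₀ : X), P.IsNormalPair h w Y p) :
    ∀ᶠ z in 𝓝[halfSpace (EuclideanSpace ℝ (Fin n))] (extChartAt (𝓡 n) q₀ q₀, 0),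
      IsNormalAt (P.localMetric h q₀) (w ∘ P.localParam q₀)
        (extChartAt (𝓡 n) q₀ ∘ Y ∘ P.localParam q₀) z := by
  filter_upwards [tendsto_localParam.eventually hwY, eventually_mem_localCollar (P := P),
    tendsto_localParam.eventually (eventually_mem_source hwY.self_of_nhds)] with z h1 h2 h3
  exact h1.isNormalAt h2 h3

/-- Near `q₀` both `Y` and `Y'` take values in one chart, on which equality can be tested in
coordinates. -/
theorem isNormalPair_unique (hform : P.HasForm g h)
    (hindep : P.IndependentOfDx h ((𝓡∂ (n + 1)).boundary X)) {w' : X → ℝ}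
    {Y' : X → BoundaryOf n X} (hwY : ∀ᶠ p in 𝓝 (q₀ : X), P.IsNormalPair h w Y p)
    (hwY' : ∀ᶠ p in 𝓝 (q₀ : X), P.IsNormalPair h w' Y' p) :
    ∀ᶠ p in 𝓝 (q₀ : X), w p = w' p ∧ Y p = Y' p := by
  refine eventually_nhds_of_localParam (P := P) ?_
  filter_upwards [(isBoundaryMetric_localMetric hform hindep q₀).isNormalAt_unique
    (eventually_isNormalAt hwY) (eventually_isNormalAt hwY'),
    tendsto_localParam.eventually (eventually_mem_source hwY.self_of_nhds),
    tendsto_localParam.eventually (eventually_mem_source hwY'.self_of_nhds)] with z h1 h2 h3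
  exact ⟨h1.1, (extChartAt (𝓡 n) q₀).injOn h2 h3 h1.2⟩

/-- The map `p ↦ (Y p, x p exp (w p))` has a smooth inverse near a boundary point. -/
theorem exists_local_inverse (hform : P.HasForm g h)
    (hindep : P.IndependentOfDx h ((𝓡∂ (n + 1)).boundary X))
    (hwY : ∀ᶠ p in 𝓝 (q₀ : X), P.IsNormalPair h w Y p) :
    ∃ Θ : BoundaryOf n X × ℝ → X, Θ (q₀, 0) = q₀ ∧
      (∀ᶠ c in 𝓝[{c : BoundaryOf n X × ℝ | 0 ≤ c.2}] (q₀, 0),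
        ContMDiffWithinAt ((𝓡 n).prod 𝓘(ℝ, ℝ)) (𝓡∂ (n + 1)) ∞ Θ {c | 0 ≤ c.2} c ∧
        Y (Θ c) = c.1 ∧ P.x (Θ c) * Real.exp (w (Θ c)) = c.2) ∧
      ∀ᶠ p in 𝓝 (q₀ : X), Θ (Y p, P.x p * Real.exp (w p)) = p := by
  obtain ⟨Ξ, hΞ, hΞ0, hΞinv⟩ := (isBoundaryMetric_localMetric hform hindep q₀).exists_local_inverse
    (eventually_isNormalAt hwY)
  have hq0 := (eventually_nhds_boundary (P := P) (q₀ := q₀)).self_of_nhds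
  set H := halfSpace (EuclideanSpace ℝ (Fin n))
  set a := extChartAt (𝓡 n) q₀ q₀
  set μ : BoundaryOf n X × ℝ → EuclideanSpace ℝ (Fin n) × ℝ :=
    fun c ↦ (extChartAt (𝓡 n) q₀ c.1, c.2) with hμ
  have ha : (a, (0 : ℝ)) ∈ H := mk_zero_mem_halfSpace a
  have hμt : Tendsto μ (𝓝[{c : BoundaryOf n X × ℝ | 0 ≤ c.2}] (q₀, 0)) (𝓝[H] (a, 0)) := by
    refine tendsto_nhdsWithin_iff.2 ⟨?_, ?_⟩
    · have h1 : ContinuousAt μ (q₀, 0) :=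
        ((continuousAt_extChartAt (I := 𝓡 n) q₀).comp (f := Prod.fst)
          (x := (q₀, (0 : ℝ))) continuousAt_fst).prodMk continuousAt_snd
      exact h1.tendsto.mono_left nhdsWithin_le_nhds
    · filter_upwards [self_mem_nhdsWithin] with c hc using hc
  have hΞt : Tendsto Ξ (𝓝[H] (a, 0)) (𝓝[H] (a, 0)) := by
    refine tendsto_nhdsWithin_iff.2 ⟨?_, hΞ.mono fun c hc ↦ hc.2.1⟩
    have := (hΞ.self_of_nhdsWithin ha).1.continuousWithinAt.tendsto
    rwa [hΞ0] at this
  have hsrc : ∀ᶠ c in 𝓝[{c : BoundaryOf n X × ℝ | 0 ≤ c.2}] (q₀, 0),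
      c.1 ∈ (extChartAt (𝓡 n) q₀).source :=
    (continuousAt_fst (p := (q₀, (0 : ℝ)))).continuousWithinAt.eventually
      (extChartAt_source_mem_nhds q₀)
  refine ⟨P.localParam q₀ ∘ Ξ ∘ μ, ?_, ?_, ?_⟩
  · simp only [Function.comp, hμ]
    rw [hΞ0, localParam_mk_zero]
  · filter_upwards [hμt.eventually hΞ, eventually_eventually_nhdsWithin.2 (hμt.eventually hΞ), hsrc,
      (hΞt.comp hμt).eventually (eventually_mem_localCollar (P := P)),
      ((tendsto_localParam (P := P)).comp (hΞt.comp hμt)).eventually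
        (eventually_mem_source hwY.self_of_nhds), self_mem_nhdsWithin] with c h1 h2 h3 h4 h5 h6
    refine ⟨?_, ?_, ?_⟩
    · have e1 : ContMDiffWithinAt ((𝓡 n).prod 𝓘(ℝ, ℝ)) 𝓘(ℝ, EuclideanSpace ℝ (Fin n) × ℝ) ∞ μ
          {c | 0 ≤ c.2} c := by
        rw [extChartAt_source] at h3
        exact ((contMDiffAt_extChartAt' h3).comp c contMDiffAt_fst).contMDiffWithinAt.prodMk_space
          contMDiffWithinAt_snd
      have e2 := h1.1.contMDiffWithinAt.comp c e1 fun c hc ↦ hc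
      exact ((contMDiffWithinAt_localParam h4).comp' c e2).mono_of_mem_nhdsWithin
        (inter_mem self_mem_nhdsWithin (h2.mono fun c hc ↦ hc.2.1))
    · exact (extChartAt (𝓡 n) q₀).injOn h5 h3 h1.2.2.1
    · have e1 := h1.2.2.2
      have e2 := x_localParam h4
      simp only [Function.comp] at e2 ⊢
      rw [e2]
      exact e1
  · filter_upwards [tendsto_localCoord.eventually hΞinv, eventually_nhds_boundary (P := P) (q₀ := q₀)]
      with p h1 h2
    have e1 := localParam_localCoord h2.1 h2.2
    simp only [Function.comp] at h1
    rw [e1] at h1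
    exact (congrArg (P.localParam q₀) h1).trans e1

end ProductDecomposition

/-! ### From germs to a neighbourhood of the whole boundary -/

/-- A continuous choice of positive numbers below locally constant bounds, which is constant on
compact spaces. -/
theorem exists_continuous_pos_of_local_const {B : Type*} [TopologicalSpace B] [NormalSpace B]
    [ParacompactSpace B] {t : B → Set ℝ} (hpos : ∀ q, ∀ ε ∈ t q, 0 < ε)
    (hmono : ∀ q, ∀ ε ∈ t q, ∀ δ, 0 < δ → δ ≤ ε → δ ∈ t q)
    (hloc : ∀ q, ∃ ε, ∀ᶠ q' in 𝓝 q, ε ∈ t q') :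
    ∃ f : B → ℝ, Continuous f ∧ (∀ q, f q ∈ t q) ∧
      (CompactSpace B → ∃ ε, 0 < ε ∧ ∀ q, f q = ε) := by
  have hconv : ∀ q, Convex ℝ (t q) := by
    refine fun q ↦ OrdConnected.convex ⟨fun a ha b hb c hc ↦ ?_⟩
    exact hmono q b hb c ((hpos q a ha).trans_le hc.1) hc.2
  obtain ⟨f, hf⟩ := exists_continuous_forall_mem_convex_of_local_const hconv hloc
  by_cases hB : CompactSpace B
  · rcases isEmpty_or_nonempty B with h | h
    · exact ⟨f, f.continuous, hf, fun _ ↦ ⟨1, one_pos, fun q ↦ h.elim q⟩⟩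
    -- The minimum of the selected function is positive and, the sets being closed downwards among
    -- positive numbers, admissible everywhere.
    · obtain ⟨q₀, -, hq₀⟩ := isCompact_univ.exists_isMinOn univ_nonempty f.continuous.continuousOn
      exact ⟨fun _ ↦ f q₀, continuous_const, fun q ↦ hmono q _ (hf q) _ (hpos _ _ (hf q₀))
        (hq₀ (mem_univ q)), fun _ ↦ ⟨f q₀, hpos _ _ (hf q₀), fun _ ↦ rfl⟩⟩
  · exact ⟨f, f.continuous, hf, fun h ↦ absurd h hB⟩

/-- A metrizable topology is given by a distance function. -/
theorem exists_continuous_metric (B : Type*) [TopologicalSpace B]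
    [TopologicalSpace.MetrizableSpace B] :
    ∃ d : B → B → ℝ, Continuous (fun b : B × B ↦ d b.1 b.2) ∧ (∀ b, d b b = 0) ∧
      (∀ b c, d b c = d c b) ∧ (∀ a b c, d a c ≤ d a b + d b c) ∧
      ∀ q, ∀ s ∈ 𝓝 q, ∃ ρ > 0, ∀ b, d b q < ρ → b ∈ s := by
  let _ := TopologicalSpace.metrizableSpaceMetric B
  exact ⟨dist, continuous_dist, dist_self, dist_comm, dist_triangle,
    fun q s hs ↦ Metric.mem_nhds_iff.1 hs⟩

namespace ProductDecomposition

variable {n : ℕ} {X : Type*} [TopologicalSpace X]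
  [ChartedSpace (EuclideanHalfSpace (n + 1)) X] [IsManifold (𝓡∂ (n + 1)) ∞ X]
  [ChartedSpace (EuclideanSpace ℝ (Fin n)) (BoundaryOf n X)]
  [IsManifold (𝓡 n) ∞ (BoundaryOf n X)]
  {P : ProductDecomposition n X} {g h : TwoTensorField n X} {w : X → ℝ} {Y : X → BoundaryOf n X}

/-- At `p` the local solution with index `i (y p)` is used, where `i` is an arbitrary, typically
discontinuous choice of a member of a shrunken locally finite cover. Near a boundary point only
finitely many indices occur, and by uniqueness their germs there coincide. -/
theorem exists_global_isNormalPair [T2Space (BoundaryOf n X)] [ParacompactSpace (BoundaryOf n X)]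
    (hform : P.HasForm g h) (hindep : P.IndependentOfDx h ((𝓡∂ (n + 1)).boundary X)) :
    ∃ w Y, ∀ q : BoundaryOf n X, ∀ᶠ p in 𝓝 (q : X), P.IsNormalPair h w Y p := by
  choose w Y hwY using fun q : BoundaryOf n X ↦ exists_isNormalPair hform hindep q
  obtain ⟨u, huo, huU, huf, huV⟩ := precise_refinement
    (fun q : BoundaryOf n X ↦ {b : BoundaryOf n X | ∀ᶠ p in 𝓝 (b : X), P.IsNormalPair h (w q) (Y q) p})
    (fun q ↦ isOpen_setOfPred_eventually_nhds.preimage continuous_subtype_val)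
    (eq_univ_of_forall fun q ↦ mem_iUnion.2 ⟨q, hwY q⟩)
  obtain ⟨s, hsU, -, hsu⟩ := exists_iUnion_eq_closure_subset huo huf.point_finite huU
  have hcov : ∀ b, ∃ j, b ∈ s j := fun b ↦ mem_iUnion.1 (hsU ▸ mem_univ b)
  choose i hi using hcov
  have hfin : LocallyFinite fun j ↦ closure (s j) := huf.subset hsu
  refine ⟨fun p ↦ w (i (P.y p)) p, fun p ↦ Y (i (P.y p)) p, fun q ↦ ?_⟩
  have hq : (q : X) ∈ P.domain := P.boundary_subset_domain q.2
  have hy : ContinuousAt P.y q :=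
    (P.smooth_y.contMDiffAt (P.isOpen_domain.mem_nhds hq)).continuousAt
  -- By local finiteness the union of the closures that miss `q` stays away from `q`.
  have hnear : ∀ᶠ p in 𝓝 (q : X), q ∈ closure (s (i (P.y p))) := by
    have h1 : ∀ᶠ b in 𝓝 (P.y q), q ∈ closure (s (i b)) := by
      rw [y_boundary]
      filter_upwards [hfin.iInter_compl_mem_nhds (fun _ ↦ isClosed_closure) q] with b hb
      by_contra hne
      exact mem_iInter₂.1 hb _ hne (subset_closure (hi b))
    exact hy.eventually h1
  have heq : ∀ᶠ p in 𝓝 (q : X), ∀ j ∈ {j | q ∈ closure (s j)},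
      w j p = w (i q) p ∧ Y j p = Y (i q) p := by
    refine (eventually_all_finite (hfin.point_finite q)).2 fun j hj ↦ ?_
    exact isNormalPair_unique hform hindep (huV _ (hsu _ hj))
      (huV _ (hsu _ (subset_closure (hi q))))
  have hall : ∀ᶠ p in 𝓝 (q : X), w (i (P.y p)) p = w (i q) p ∧ Y (i (P.y p)) p = Y (i q) p := by
    filter_upwards [hnear, heq] with p h1 h2 using h2 _ h1
  have hN : ∀ᶠ p in 𝓝 (q : X), P.IsNormalPair h (w (i q)) (Y (i q)) p :=
    huV _ (hsu _ (subset_closure (hi q)))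
  filter_upwards [hN, eventually_eventually_nhds.2 hall] with p h1 h2
  exact h1.congr (h2.mono fun _ h ↦ h.1) (h2.mono fun _ h ↦ h.2)

theorem x_boundary_mem (P : ProductDecomposition n X) {p : X}
    (hp : p ∈ (𝓡∂ (n + 1)).boundary X) : P.x p = 0 := x_boundary (P := P) ⟨p, hp⟩

/-- Continuity of `param` at `(q, 0)`: boxes in the collar coordinates form a neighbourhood base at
boundary points. -/
theorem exists_pos_forall_mem_of_mem_nhds {d : BoundaryOf n X → BoundaryOf n X → ℝ}
    (hd : ∀ q, ∀ s ∈ 𝓝 q, ∃ ρ > 0, ∀ b, d b q < ρ → b ∈ s) (P : ProductDecomposition n X)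
    (q : BoundaryOf n X) {s : Set X} (hs : s ∈ 𝓝 (q : X)) :
    ∃ ρ > 0, ∀ p ∈ P.domain, d (P.y p) q < ρ → P.x p < ρ → p ∈ s := by
  have h1 := (P.smooth_param (q, 0) ⟨le_rfl, P.width_pos q⟩).continuousWithinAt
  rw [← P.param_zero] at hs
  obtain ⟨t, ht, hts⟩ := mem_nhdsWithin_iff_exists_mem_nhds_inter.1 (h1.preimage_mem_nhdsWithin hs)
  obtain ⟨u, hu, v, hv, huv⟩ := mem_nhds_prod_iff.1 ht
  obtain ⟨ρ₁, hρ₁, h₁⟩ := hd q u hu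
  obtain ⟨ρ₂, hρ₂, h₂⟩ := Metric.mem_nhds_iff.1 hv
  refine ⟨min ρ₁ ρ₂, lt_min hρ₁ hρ₂, fun p hp hy hx ↦ ?_⟩
  have h3 := P.mapsTo_coord p hp
  have h4 : (P.y p, P.x p) ∈ t := huv ⟨h₁ _ (hy.trans_le (min_le_left _ _)), h₂ (by
    rw [Metric.mem_ball, Real.dist_0_eq_abs, abs_of_nonneg h3.1]
    exact hx.trans_le (min_le_right _ _))⟩
  have h5 := hts ⟨h4, h3⟩
  rwa [mem_preimage, P.param_coord p hp] at h5

/-- A map which is injective near every boundary point, and on the boundary, is injective near the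
boundary. -/
theorem exists_isOpen_injOn [TopologicalSpace.MetrizableSpace (BoundaryOf n X)]
    [ParacompactSpace (BoundaryOf n X)] (P : ProductDecomposition n X)
    {φ : X → ℝ} {O : Set X} (hO : IsOpen O) (hOP : O ⊆ P.domain)
    (hbO : (𝓡∂ (n + 1)).boundary X ⊆ O) (hY : ContinuousOn Y O)
    (hYb : ∀ q : BoundaryOf n X, Y q = q)
    (hinj : ∀ q : BoundaryOf n X, ∃ Θ : BoundaryOf n X × ℝ → X, ∀ᶠ p in 𝓝 (q : X),
      Θ (Y p, φ p) = p) :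
    ∃ U ⊆ O, IsOpen U ∧ (𝓡∂ (n + 1)).boundary X ⊆ U ∧ InjOn (fun p ↦ (Y p, φ p)) U := by
  obtain ⟨d, hdc, hd0, hds, hdt, hdn⟩ := exists_continuous_metric (BoundaryOf n X)
  -- `R q` is a size of box around `q` on which the map is injective, chosen continuously. A box of
  -- size `ρ` around `q` contains the boxes of size `ρ / 2` around nearby points, which gives
  -- locally constant bounds.
  obtain ⟨R, hRc, hR, -⟩ := exists_continuous_pos_of_local_const (B := BoundaryOf n X)
    (t := fun q ↦ {ρ | 0 < ρ ∧ InjOn (fun p ↦ (Y p, φ p))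
      {p | p ∈ P.domain ∧ d (P.y p) q < ρ ∧ P.x p < ρ}}) (fun q ε h ↦ h.1)
    (fun q ε h δ h0 hle ↦ by
      refine ⟨h0, h.2.mono ?_⟩
      exact fun p hp ↦ ⟨hp.1, hp.2.1.trans_le hle, hp.2.2.trans_le hle⟩) (fun q ↦ by
      obtain ⟨Θ, hΘ⟩ := hinj q
      obtain ⟨ρ, hρ, hall⟩ := exists_pos_forall_mem_of_mem_nhds hdn P q hΘ
      have hΘinj : InjOn (fun p ↦ (Y p, φ p)) {p | p ∈ P.domain ∧ d (P.y p) q < ρ ∧ P.x p < ρ} := by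
        intro p hp p' hp' heq
        have e1 : Θ (Y p, φ p) = p := hall p hp.1 hp.2.1 hp.2.2
        have e2 : Θ (Y p', φ p') = p' := hall p' hp'.1 hp'.2.1 hp'.2.2
        rw [← e1, ← e2]
        exact congrArg Θ heq
      have hc : Continuous fun b ↦ d b q := hdc.comp (continuous_id.prodMk continuous_const)
      refine ⟨ρ / 2, (hc.continuousAt.eventually_lt continuousAt_const
        (by rw [hd0]; positivity : d q q < ρ / 2)).mono fun q' hq' ↦ ⟨by positivity,
          hΘinj.mono ?_⟩⟩
      rintro p ⟨hp, hyp, hxp⟩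
      exact ⟨hp, (hdt _ q' _).trans_lt (by linarith), hxp.trans (by linarith)⟩)
  have hyc : ContinuousOn P.y O := P.smooth_y.continuousOn.mono hOP
  have hxc : ContinuousOn P.x O := P.smooth_x.continuousOn.mono hOP
  refine ⟨{p | p ∈ O ∧ P.x p < R (P.y p) ∧ 2 * d (Y p) (P.y p) < R (P.y p)}, fun p hp ↦ hp.1, ?_,
    fun p hp ↦ ?_, ?_⟩
  · have hRy : ContinuousOn (fun p ↦ R (P.y p)) O := hRc.comp_continuousOn hyc
    have hdY : ContinuousOn (fun p ↦ 2 * d (Y p) (P.y p)) O :=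
      continuousOn_const.mul (hdc.comp_continuousOn (hY.prodMk hyc))
    rw [isOpen_iff_mem_nhds]
    rintro p ⟨h1, h2, h3⟩
    have hp := hO.mem_nhds h1
    filter_upwards [hp, (hxc.continuousAt hp).eventually_lt (hRy.continuousAt hp) h2,
      (hdY.continuousAt hp).eventually_lt (hRy.continuousAt hp) h3] with p' e1 e2 e3
      using ⟨e1, e2, e3⟩
  · have e1 := P.x_boundary_mem hp
    have e2 : Y p = P.y p := (hYb ⟨p, hp⟩).trans (y_boundary ⟨p, hp⟩).symm
    refine ⟨hbO hp, ?_, ?_⟩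
    · rw [e1]; exact (hR _).1
    · rw [e2, hd0, mul_zero]; exact (hR _).1
  -- If `Y p = Y p'`, then `y p` and `y p'` are each within half of the larger radius of this common
  -- value, so both points lie in one box of injectivity, centred at `y p`.
  · have key : ∀ p p' : X, p ∈ O → p' ∈ O → P.x p < R (P.y p) →
        2 * d (Y p) (P.y p) < R (P.y p) → P.x p' < R (P.y p') → 2 * d (Y p') (P.y p') < R (P.y p') →
        (Y p, φ p) = (Y p', φ p') → R (P.y p') ≤ R (P.y p) → p = p' := by
      intro p p' hp hp' h1 h2 h1' h2' heq hle
      refine (hR (P.y p)).2 ⟨hOP hp, by rw [hd0]; exact (hR _).1, h1⟩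
        ⟨hOP hp', ?_, h1'.trans_le hle⟩ heq
      have e1 : Y p = Y p' := congrArg Prod.fst heq
      have e2 := hdt (P.y p') (Y p') (P.y p)
      have e3 := hds (P.y p') (Y p')
      rw [← e1] at h2' e2 e3
      linarith
    rintro p ⟨hp, h1, h2⟩ p' ⟨hp', h1', h2'⟩ heq
    rcases le_total (R (P.y p')) (R (P.y p)) with hle | hle
    · exact key p p' hp hp' h1 h2 h1' h2' heq hle
    · exact (key p' p hp' hp h1' h2' h1 h2 heq.symm hle).symm

/-- The product decomposition with coordinates `x exp w` and `Y`. -/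
theorem exists_productDecomposition [TopologicalSpace.MetrizableSpace (BoundaryOf n X)]
    [ParacompactSpace (BoundaryOf n X)] (hform : P.HasForm g h)
    (hindep : P.IndependentOfDx h ((𝓡∂ (n + 1)).boundary X))
    (hwY : ∀ q : BoundaryOf n X, ∀ᶠ p in 𝓝 (q : X), P.IsNormalPair h w Y p) :
    ∃ P' : ProductDecomposition n X, P'.x = (fun p ↦ P.x p * Real.exp (w p)) ∧ P'.y = Y ∧
      P'.domain ⊆ P.domain ∧ (∀ p ∈ P'.domain, P.IsNormalPair h w Y p) ∧
      (CompactSpace (BoundaryOf n X) → ∃ ε : ℝ, 0 < ε ∧ ∀ q, P'.width q = ε) := by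
  classical
  set O : Set X := {p | ∀ᶠ p' in 𝓝 p, p' ∈ P.domain ∧ P.IsNormalPair h w Y p'} with hOdef
  have hO : IsOpen O := isOpen_setOfPred_eventually_nhds
  have hOself : ∀ p ∈ O, p ∈ P.domain ∧ P.IsNormalPair h w Y p := fun p hp ↦
    (hp : ∀ᶠ p' in 𝓝 p, p' ∈ P.domain ∧ P.IsNormalPair h w Y p').self_of_nhds
  have hYO : ContMDiffOn (𝓡∂ (n + 1)) (𝓡 n) ∞ Y O := fun p hp ↦
    (hOself p hp).2.smooth_Y.contMDiffWithinAt
  have hwO : ContMDiffOn (𝓡∂ (n + 1)) 𝓘(ℝ, ℝ) ∞ w O := fun p hp ↦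
    (hOself p hp).2.smooth_w.contMDiffWithinAt
  have hbO : (𝓡∂ (n + 1)).boundary X ⊆ O := fun p hp ↦
    (eventually_mem_set.2 (P.isOpen_domain.mem_nhds (P.boundary_subset_domain hp))).and
      (hwY ⟨p, hp⟩)
  have hbd : ∀ q : BoundaryOf n X, w q = 0 ∧ Y q = q := fun q ↦ (hwY q).self_of_nhds.boundary_eq
  choose Θ hΘ0 hΘ hΘinv using fun q : BoundaryOf n X ↦ exists_local_inverse hform hindep (hwY q)
  obtain ⟨U, hUO, hU, hbU, hinj⟩ := exists_isOpen_injOn P (φ := fun p ↦ P.x p * Real.exp (w p)) hO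
    (fun p hp ↦ (hOself p hp).1) hbO hYO.continuousOn (fun q ↦ (hbd q).2)
    (fun q ↦ ⟨Θ q, hΘinv q⟩)
  set Φ : X → BoundaryOf n X × ℝ := fun p ↦ (Y p, P.x p * Real.exp (w p)) with hΦ
  -- A set-theoretic global inverse, with an arbitrary value off the image. Injectivity on `U`
  -- forces it to agree with the smooth local inverses `Θ q` near the boundary.
  obtain ⟨r, hr⟩ : ∃ r : BoundaryOf n X × ℝ → X, ∀ p ∈ U, r (Φ p) = p := by
    refine ⟨fun c ↦ if hc : ∃ p ∈ U, Φ p = c then hc.choose else c.1, fun p hp ↦ ?_⟩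
    have hc : ∃ p' ∈ U, Φ p' = Φ p := ⟨p, hp, rfl⟩
    simp only [dif_pos hc]
    exact hinj hc.choose_spec.1 hp hc.choose_spec.2
  set H : Set (BoundaryOf n X × ℝ) := {c | 0 ≤ c.2} with hH
  have hgood : ∀ q : BoundaryOf n X, ∀ᶠ c in 𝓝[H] (q, 0),
      ContMDiffWithinAt ((𝓡 n).prod 𝓘(ℝ, ℝ)) (𝓡∂ (n + 1)) ∞ r H c ∧ r c ∈ U ∧ Φ (r c) = c := by
    intro q
    have hq : ((q, (0 : ℝ)) : BoundaryOf n X × ℝ) ∈ H := le_refl (0 : ℝ)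
    have hcont := ((hΘ q).self_of_nhdsWithin hq).1.continuousWithinAt
    have hΘU : ∀ᶠ c in 𝓝[H] (q, 0), Θ q c ∈ U :=
      hcont.eventually (hU.mem_nhds (by rw [hΘ0]; exact hbU q.2))
    have hrΘ : ∀ᶠ c in 𝓝[H] (q, 0), r c = Θ q c := by
      filter_upwards [hΘ q, hΘU] with c h1 h2
      have h3 : Φ (Θ q c) = c := Prod.ext h1.2.1 h1.2.2
      have h4 := hr _ h2
      rwa [h3] at h4
    filter_upwards [hΘ q, hΘU, hrΘ, eventually_eventually_nhdsWithin.2 hrΘ, self_mem_nhdsWithin]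
      with c h1 h2 h3 h4 h5
    exact ⟨h1.1.congr_of_eventuallyEq h4 h3, h3 ▸ h2, h3 ▸ Prod.ext h1.2.1 h1.2.2⟩
  -- The width of the new collar: below it `r` is smooth and a right inverse of `Φ`.
  obtain ⟨ε, hεc, hε, hεK⟩ := exists_continuous_pos_of_local_const (B := BoundaryOf n X)
    (t := fun q ↦ {ε | 0 < ε ∧ ∀ s, 0 ≤ s → s < ε →
      ContMDiffWithinAt ((𝓡 n).prod 𝓘(ℝ, ℝ)) (𝓡∂ (n + 1)) ∞ r H (q, s) ∧ r (q, s) ∈ U ∧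
        Φ (r (q, s)) = (q, s)}) (fun q ε h ↦ h.1)
    (fun q ε h δ h0 hle ↦ ⟨h0, fun s h1 h2 ↦ h.2 s h1 (h2.trans_le hle)⟩) (fun q ↦ by
      obtain ⟨t, ht, hts⟩ := mem_nhdsWithin_iff_exists_mem_nhds_inter.1 (hgood q)
      obtain ⟨u, hu, v, hv, huv⟩ := mem_nhds_prod_iff.1 ht
      obtain ⟨ρ, hρ, h2⟩ := Metric.mem_nhds_iff.1 hv
      refine ⟨ρ, (eventually_mem_set.2 hu).mono fun q' hq' ↦ ⟨hρ, fun s hs0 hs ↦ ?_⟩⟩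
      exact hts ⟨huv ⟨hq', h2 (by rwa [Metric.mem_ball, Real.dist_0_eq_abs, abs_of_nonneg hs0])⟩,
        hs0⟩)
  have hUP : U ⊆ P.domain := fun p hp ↦ (hOself p (hUO hp)).1
  have hx' : ContMDiffOn (𝓡∂ (n + 1)) 𝓘(ℝ, ℝ) ∞ (fun p ↦ P.x p * Real.exp (w p)) U :=
    (P.smooth_x.mono hUP).mul (Real.contDiff_exp.contMDiff.comp_contMDiffOn (hwO.mono hUO))
  let P' : ProductDecomposition n X :=
    { domain := {p | p ∈ U ∧ P.x p * Real.exp (w p) < ε (Y p)}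
      isOpen_domain := by
        rw [isOpen_iff_mem_nhds]
        rintro p ⟨h1, h2⟩
        have hp := hU.mem_nhds h1
        filter_upwards [hp, (hx'.continuousOn.continuousAt hp).eventually_lt
          (hεc.continuousAt.comp ((hYO.continuousOn.mono hUO).continuousAt hp)) h2] with p' e1 e2
          using ⟨e1, e2⟩
      boundary_subset_domain := fun p hp ↦ ⟨hbU hp, by
        rw [P.x_boundary_mem hp, zero_mul]
        exact (hε _).1⟩
      x := fun p ↦ P.x p * Real.exp (w p)
      y := Y
      width := ε
      width_pos := fun q ↦ (hε q).1
      continuous_width := hεc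
      param := r
      mapsTo_coord := fun p hp ↦
        ⟨mul_nonneg (P.mapsTo_coord p (hUP hp.1)).1 (Real.exp_pos _).le, hp.2⟩
      mapsTo_param := fun q t h0 ht ↦ by
        obtain ⟨-, h1, h2⟩ := (hε q).2 t h0 ht
        have e1 : Y (r (q, t)) = q := congrArg Prod.fst h2
        have e2 : P.x (r (q, t)) * Real.exp (w (r (q, t))) = t := congrArg Prod.snd h2
        refine ⟨h1, ?_⟩
        rw [e1, e2]
        exact ht
      param_coord := fun p hp ↦ hr p hp.1
      x_param := fun q t h0 ht ↦ congrArg Prod.snd ((hε q).2 t h0 ht).2.2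
      y_param := fun q t h0 ht ↦ congrArg Prod.fst ((hε q).2 t h0 ht).2.2
      param_zero := fun q ↦ by
        have h1 := hr q (hbU q.2)
        simp only [hΦ, (hbd q).2, x_boundary, zero_mul] at h1
        exact h1
      smooth_x := hx'.mono fun p hp ↦ hp.1
      smooth_y := hYO.mono fun p hp ↦ hUO hp.1
      smooth_param := fun c hc ↦ ((hε c.1).2 c.2 hc.1 hc.2).1.mono fun c hc ↦ hc.1 }
  exact ⟨P', rfl, rfl, fun p hp ↦ hUP hp.1, fun p hp ↦ (hOself p (hUO hp.1)).2, hεK⟩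

end ProductDecomposition

/-! ### The tensor of the normal form -/

theorem contDiff_smulRight_self {V : Type*} [NormedAddCommGroup V] [NormedSpace ℝ V] :
    ContDiff ℝ ∞ fun α : V →L[ℝ] ℝ ↦ α.smulRight α :=
  contDiff_id.smulRight contDiff_id

namespace ProductDecomposition

variable {n : ℕ} {X : Type*} [TopologicalSpace X]
  [ChartedSpace (EuclideanHalfSpace (n + 1)) X] [IsManifold (𝓡∂ (n + 1)) ∞ X]

/-- The square of the differential of a function. -/
def scalarDerivSq (f : X → ℝ) : TwoTensorField n X := fun p ↦
  let α : EuclideanSpace ℝ (Fin (n + 1)) →L[ℝ] ℝ := scalarDeriv f p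
  α.smulRight α

theorem scalarDerivSq_apply (f : X → ℝ) (p : X) (v v' : TangentSpace (𝓡∂ (n + 1)) p) :
    scalarDerivSq f p v v' = scalarDeriv f p v * scalarDeriv f p v' := rfl

/-- In the trivialization at `p₀` the tensor is the differential of `f` in tangent coordinates
followed by the smooth map `α ↦ α ⊗ α`. -/
theorem contMDiffAt_scalarDerivSq {f : X → ℝ} {p₀ : X}
    (hf : ContMDiffAt (𝓡∂ (n + 1)) 𝓘(ℝ, ℝ) ∞ f p₀) :
    ContMDiffAt (𝓡∂ (n + 1))
    ((𝓡∂ (n + 1)).prod 𝓘(ℝ, EuclideanSpace ℝ (Fin (n + 1)) →L[ℝ]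
      EuclideanSpace ℝ (Fin (n + 1)) →L[ℝ] ℝ)) ∞
    (fun p ↦ TotalSpace.mk' (EuclideanSpace ℝ (Fin (n + 1)) →L[ℝ]
      EuclideanSpace ℝ (Fin (n + 1)) →L[ℝ] ℝ)
      (E := fun p : X ↦ TangentSpace (𝓡∂ (n + 1)) p →L[ℝ]
        TangentSpace (𝓡∂ (n + 1)) p →L[ℝ] ℝ) p (scalarDerivSq f p)) p₀ := by
  rw [contMDiffAt_section]
  have hA := hf.mfderiv_const (m := ∞) (by simp)
  have h2 := contDiff_smulRight_self.contMDiff.contMDiffAt.comp p₀ hA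
  refine h2.congr_of_eventuallyEq ?_
  have hb : (trivializationAt (EuclideanSpace ℝ (Fin (n + 1))) (TangentSpace (𝓡∂ (n + 1))) p₀).baseSet ∈
      𝓝 p₀ := (trivializationAt _ _ p₀).open_baseSet.mem_nhds (mem_baseSet_trivializationAt _ _ p₀)
  filter_upwards [hb] with p hp
  refine ContinuousLinearMap.ext fun v ↦ ContinuousLinearMap.ext fun v' ↦ ?_
  rw [hom_trivializationAt_apply]
  refine (inCoordinates_apply_eq₂ hp hp (mem_univ p)).trans ?_
  have hAv : ∀ u, inTangentCoordinates (𝓡∂ (n + 1)) 𝓘(ℝ, ℝ) id f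
      (mfderiv (𝓡∂ (n + 1)) 𝓘(ℝ, ℝ) f) p₀ p u = scalarDeriv f p
        ((trivializationAt (EuclideanSpace ℝ (Fin (n + 1))) (TangentSpace (𝓡∂ (n + 1))) p₀).symm p u) := by
    intro u
    change (trivializationAt ℝ (TangentSpace 𝓘(ℝ, ℝ)) (f p₀)).continuousLinearMapAt ℝ (f p)
      (scalarDeriv f p ((trivializationAt (EuclideanSpace ℝ (Fin (n + 1)))
        (TangentSpace (𝓡∂ (n + 1))) p₀).symmL ℝ p u)) = _
    rw [TangentBundle.continuousLinearMapAt_model_space]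
    exact congrArg (scalarDeriv f p) (Trivialization.symmL_apply _ hp u)
  refine Eq.trans ?_ (congrArg₂ (· * ·) (hAv v) (hAv v')).symm
  rw [scalarDerivSq_apply]
  simp

variable [ChartedSpace (EuclideanSpace ℝ (Fin n)) (BoundaryOf n X)]
  [IsManifold (𝓡 n) ∞ (BoundaryOf n X)]
  {P P' : ProductDecomposition n X} {g h : TwoTensorField n X} {w : X → ℝ} {Y : X → BoundaryOf n X}

theorem dx_eq_of_x_eq_mul_exp (hx : P'.x = fun p ↦ P.x p * Real.exp (w p)) {p : X}
    (hp : p ∈ P.domain) (hw : ContMDiffAt (𝓡∂ (n + 1)) 𝓘(ℝ, ℝ) ∞ w p)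
    (v : TangentSpace (𝓡∂ (n + 1)) p) :
    P'.dx p v = Real.exp (w p) * (P.dx p v + P.x p * scalarDeriv w p v) := by
  have h1 : HasMFDerivAt (𝓡∂ (n + 1)) 𝓘(ℝ, ℝ) P.x p (P.dx p) :=
    ((P.smooth_x.contMDiffAt (P.isOpen_domain.mem_nhds hp)).mdifferentiableAt
      (by simp)).hasMFDerivAt
  have h2 : HasMFDerivAt (𝓡∂ (n + 1)) 𝓘(ℝ, ℝ) w p (scalarDeriv w p) :=
    (hw.mdifferentiableAt (by simp)).hasMFDerivAt
  have h3 := (Real.hasDerivAt_exp (w p)).hasFDerivAt.hasMFDerivAt.comp p h2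
  have h4 := h1.mul h3
  have h5 : P'.dx p = mfderiv (𝓡∂ (n + 1)) 𝓘(ℝ, ℝ) (P.x * (Real.exp ∘ w)) p := by
    rw [dx, hx]
    rfl
  rw [h5, h4.mfderiv]
  change P.x p * (scalarDeriv w p v * Real.exp (w p)) + Real.exp (w p) * P.dx p v = _
  ring

/-- The tensor `x̄² g - dx̄²`, where `x̄ = x exp w`. -/
def normalTensor (P P' : ProductDecomposition n X) (h : TwoTensorField n X) (w : X → ℝ) :
    TwoTensorField n X := fun p ↦
  Real.exp (2 * w p) • (scalarDerivSq P.x p + h p) - scalarDerivSq P'.x p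

theorem normalTensor_apply (p : X) (v v' : TangentSpace (𝓡∂ (n + 1)) p) :
    normalTensor P P' h w p v v' = Real.exp (2 * w p) * (P.dx p v * P.dx p v' + h p v v') -
      P'.dx p v * P'.dx p v' := rfl

theorem isSmoothSymmOn_normalTensor (hh : h.IsSmoothSymmOn P.domain) (hPP' : P'.domain ⊆ P.domain)
    (hw : ContMDiffOn (𝓡∂ (n + 1)) 𝓘(ℝ, ℝ) ∞ w P'.domain) :
    (normalTensor P P' h w).IsSmoothSymmOn P'.domain := by
  refine ⟨fun p hp ↦ ?_, fun p hp v v' ↦ ?_⟩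
  · have h1 := (contMDiffAt_scalarDerivSq
      (P.smooth_x.contMDiffAt (P.isOpen_domain.mem_nhds (hPP' hp)))).contMDiffWithinAt (s := P'.domain)
    have h2 := (contMDiffAt_scalarDerivSq
      (P'.smooth_x.contMDiffAt (P'.isOpen_domain.mem_nhds hp))).contMDiffWithinAt (s := P'.domain)
    have h3 := hh.smooth.mono hPP' p hp
    have h4 : ContMDiffWithinAt (𝓡∂ (n + 1)) 𝓘(ℝ, ℝ) ∞ (fun p ↦ Real.exp (2 * w p)) P'.domain p :=
      (Real.contDiff_exp.comp (contDiff_const.mul contDiff_id) :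
        ContDiff ℝ ∞ fun t : ℝ ↦ Real.exp (2 * t)).contMDiff.contMDiffAt.comp_contMDiffWithinAt p (hw p hp)
    exact (h4.smul_section (h1.add_section h3)).sub_section h2
  · rw [normalTensor_apply, normalTensor_apply, hh.symm p (hPP' hp), mul_comm (P.dx p v),
      mul_comm (P'.dx p v)]

/-- The kernel of `dȳ` is spanned by the normal vector `T`, since `(dȳ, dx̄)` is injective. On `T`
both parts of the tensor equal `exp (2w) α(T) α`, where `α = dx + x dw`, and cancel. -/
theorem normalTensor_eq_zero (hPP' : P'.domain ⊆ P.domain)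
    (hx : P'.x = fun p ↦ P.x p * Real.exp (w p)) (hY : P'.y = Y)
    (hwY : ∀ p ∈ P'.domain, P.IsNormalPair h w Y p) {p : X} (hp : p ∈ P'.domain)
    {u : TangentSpace (𝓡∂ (n + 1)) p} (hu : P'.dy p u = 0) (v : TangentSpace (𝓡∂ (n + 1)) p) :
    normalTensor P P' h w p u v = 0 := by
  obtain ⟨T, hT, hYT, hd⟩ := (hwY p hp).exists_vector
  have hdx := dx_eq_of_x_eq_mul_exp hx (hPP' hp) (hwY p hp).smooth_w
  have hd0 := P'.isOpen_domain.mem_nhds hp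
  have hdyT : P'.dy p T = 0 := by
    subst hY
    exact hYT
  -- Differentiating `param (ȳ, x̄) = id` gives a left inverse of `(dȳ, dx̄)`.
  have hinj : ∀ u : TangentSpace (𝓡∂ (n + 1)) p, P'.dy p u = 0 → P'.dx p u = 0 → u = 0 := by
    intro u h1 h2
    have e1 : HasMFDerivAt (𝓡∂ (n + 1)) (𝓡 n) P'.y p (P'.dy p) :=
      ((P'.smooth_y.contMDiffAt hd0).mdifferentiableAt (by simp)).hasMFDerivAt
    have e2 : HasMFDerivAt (𝓡∂ (n + 1)) 𝓘(ℝ, ℝ) P'.x p (P'.dx p) :=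
      ((P'.smooth_x.contMDiffAt hd0).mdifferentiableAt (by simp)).hasMFDerivAt
    have e3 := e1.prodMk e2
    have e4 := ((P'.smooth_param (P'.y p, P'.x p) (P'.mapsTo_coord p hp)).mdifferentiableWithinAt
      (by simp)).hasMFDerivWithinAt
    have hmaps : P'.domain ⊆ (fun p ↦ (P'.y p, P'.x p)) ⁻¹'
        {c : BoundaryOf n X × ℝ | 0 ≤ c.2 ∧ c.2 < P'.width c.1} := fun p hp ↦ P'.mapsTo_coord p hp
    have e5 := (HasMFDerivWithinAt.comp p e4 (e3.hasMFDerivWithinAt (s := P'.domain))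
      hmaps).hasMFDerivAt hd0
    have e6 := (hasMFDerivAt_id (I := 𝓡∂ (n + 1)) p).congr_of_eventuallyEq
      (f₁ := P'.param ∘ fun p ↦ (P'.y p, P'.x p))
      (by filter_upwards [hd0] with p hp using P'.param_coord p hp)
    have e7 := DFunLike.congr_fun (hasMFDerivAt_unique e6 e5) u
    have e8 : (P'.dy p).prod (P'.dx p) u = 0 := Prod.ext h1 h2
    refine e7.trans ?_
    exact (congrArg _ e8).trans (ContinuousLinearMap.map_zero _)
  have hdxT : P'.dx p T ≠ 0 := by
    intro h0
    rw [hinj T hdyT h0, map_zero] at hT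
    exact zero_ne_one hT
  have hTv : normalTensor P P' h w p T v = 0 := by
    have e1 : Real.exp (2 * w p) = Real.exp (w p) * Real.exp (w p) := by
      rw [two_mul, Real.exp_add]
    rw [normalTensor_apply, hd, hdx, hdx, hT, e1]
    ring
  have huT : u = (P'.dx p u / P'.dx p T) • T := by
    rw [← sub_eq_zero]
    apply hinj
    · rw [map_sub, map_smul, hu, hdyT, smul_zero, sub_zero]
    · rw [map_sub, map_smul, smul_eq_mul, div_mul_cancel₀ _ hdxT, sub_self]
  rw [huT, map_smul]
  exact (congrArg _ hTv).trans (mul_zero _)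

/-- The formula for `g` holds by construction, as the factor `exp (2w)` cancels against `x̄² = x²
exp (2w)`. On the boundary `w = 0` and `dx̄ = dx`, so the new tensor agrees with `h` on boundary
directions and inherits positivity. -/
theorem hasForm_normalTensor (hform : P.HasForm g h) (hPP' : P'.domain ⊆ P.domain)
    (hx : P'.x = fun p ↦ P.x p * Real.exp (w p))
    (hwY : ∀ p ∈ P'.domain, P.IsNormalPair h w Y p) : P'.HasForm g (normalTensor P P' h w) := by
  refine ⟨isSmoothSymmOn_normalTensor hform.smoothSymm hPP'
    fun p hp ↦ (hwY p hp).smooth_w.contMDiffWithinAt, fun p hp v hv hdv ↦ ?_, fun p hp v v' ↦ ?_⟩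
  · have hp' := P'.boundary_subset_domain hp
    have hx0 := P.x_boundary_mem hp
    have hdx := dx_eq_of_x_eq_mul_exp hx (hPP' hp') (hwY p hp').smooth_w v
    rw [hx0, ((hwY p hp').boundary hx0).1, Real.exp_zero, one_mul, zero_mul, add_zero] at hdx
    rw [normalTensor_apply, ((hwY p hp').boundary hx0).1, ← hdx, hdv, mul_zero, Real.exp_zero]
    have := hform.pos_boundary p hp v hv (hdx ▸ hdv)
    linarith
  · have e1 : Real.exp (2 * w p) = Real.exp (w p) ^ 2 := by
      rw [sq, ← Real.exp_add, two_mul]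
    rw [normalTensor_apply, add_sub_cancel, hform.eq_div p ⟨hPP' hp.1, hp.2⟩, hx, mul_pow, e1,
      mul_comm (P.x p ^ 2), mul_div_mul_left _ _ (pow_ne_zero 2 (Real.exp_pos _).ne')]

/-- Vectors with the same image under `dȳ` differ by an element of the kernel, which
`normalTensor_eq_zero` handles in the first slot and symmetry in the second. -/
theorem independentOfDx_normalTensor (hh : h.IsSmoothSymmOn P.domain)
    (hPP' : P'.domain ⊆ P.domain) (hx : P'.x = fun p ↦ P.x p * Real.exp (w p)) (hY : P'.y = Y)
    (hwY : ∀ p ∈ P'.domain, P.IsNormalPair h w Y p) :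
    P'.IndependentOfDx (normalTensor P P' h w) P'.domain := by
  have hs := (isSmoothSymmOn_normalTensor (P := P) (P' := P') (w := w) hh hPP'
    fun p hp ↦ (hwY p hp).smooth_w.contMDiffWithinAt).symm
  have key : ∀ p ∈ P'.domain, ∀ v v' z : TangentSpace (𝓡∂ (n + 1)) p, P'.dy p v = P'.dy p v' →
      normalTensor P P' h w p v z = normalTensor P P' h w p v' z := by
    intro p hp v v' z hv
    have := normalTensor_eq_zero hPP' hx hY hwY hp (u := v - v')
      (by rw [map_sub, hv, sub_self]) z
    rw [map_sub] at this
    exact sub_eq_zero.1 this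
  intro p hp v v' z z' hv hz
  rw [key p hp v v' z hv, hs p hp v', key p hp z z' v' hz, hs p hp z']

end ProductDecomposition

theorem proposition2p1 (n : ℕ) (X : Type*) [TopologicalSpace X] [T2Space X]
    [SecondCountableTopology X]
    [ChartedSpace (EuclideanHalfSpace (n + 1)) X] [IsManifold (𝓡∂ (n + 1)) ∞ X]
    [ChartedSpace (EuclideanSpace ℝ (Fin n)) (BoundaryOf n X)]
    [IsManifold (𝓡 n) ∞ (BoundaryOf n X)]
    (hincl : Manifold.IsSmoothEmbedding (𝓡 n) (𝓡∂ (n + 1)) ∞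
      (Subtype.val : BoundaryOf n X → X))
    (g : TwoTensorField n X) (hg : g.IsRiemannianMetricOn ((𝓡∂ (n + 1)).interior X))
    (P : ProductDecomposition n X) (h : TwoTensorField n X) (hform : P.HasForm g h)
    (hindep : P.IndependentOfDx h ((𝓡∂ (n + 1)).boundary X)) :
    ∃ (P' : ProductDecomposition n X) (h' : TwoTensorField n X),
      P'.HasForm g h' ∧ P'.IndependentOfDx h' P'.domain ∧
      (CompactSpace (BoundaryOf n X) → ∃ ε : ℝ, 0 < ε ∧ ∀ q, P'.width q = ε) := by
  -- A locally compact, second countable Hausdorff space is paracompact and metrizable, as gluing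
  -- and the injectivity argument require.
  have : LocallyCompactSpace (BoundaryOf n X) :=
    ChartedSpace.locallyCompactSpace (EuclideanSpace ℝ (Fin n)) (BoundaryOf n X)
  obtain ⟨w, Y, hwY⟩ := ProductDecomposition.exists_global_isNormalPair hform hindep
  obtain ⟨P', hx, hy, hPP', hN, hε⟩ :=
    ProductDecomposition.exists_productDecomposition hform hindep hwY
  exact ⟨P', ProductDecomposition.normalTensor P P' h w,
    ProductDecomposition.hasForm_normalTensor hform hPP' hx hN,
    ProductDecomposition.independentOfDx_normalTensor hform.smoothSymm hPP' hx hy hN, hε⟩
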